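/- All graphs are finite and simple. A graph $G$ is a \emph{brace} if it is bipartite and every matching of $G$ with at most two edges is contained in a perfect matching of $G$. A subgraph $K$ of $G$ is \emph{central} if $G\setminus V(K)$ has a perfect matching. An \emph{even subdivision} of a graph $R$ is a graph obtained from $R$ by replacing its edges by internally disjoint paths, each with an even number of vertices and at least one edge. A \emph{model} of $R$ in $G$ is a central subgraph of $G$ that is isomorphic to an even subdivision of $R$, and $G$ \emph{contains} $R$ if there is a model of $R$ in $G$. \emph{Rotunda} is the graph with the 16 vertices $s_j$ and $c_{i,j}$ ($i\in\{1,2,3\}$, $j\in\mathbb{Z}/4$), in which $c_{i,j}$ is adjacent to $c_{i,j+1}$ and to $s_j$ for all $i,j$, and there are no other edges; its \emph{center} is $\{s_0,s_1,s_2,s_3\}$. For a subgraph $H$ of $G$, an \emph{$H$-path} in $G$ is a path in $G$ with at least one edge that has both ends in $H$ and is otherwise disjoint from $H$. \textbf{Theorem.} Let $G$ be a brace, let $H$ be a model of Rotunda in $G$, and let $S$ be the set of the four vertices of $H$ corresponding to the center of Rotunda. If there exists an $H$-path in $G\setminus S$ with ends in different components of $H\setminus S$, then $G$ contains $K_{3,3}$.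 -/

import Mathlib

namespace SimpleGraph

/-- `G` is `k`-extendable: every matching with at most `k` edges is contained in a perfect
matching. -/
def IsExtendable {V : Type*} (G : SimpleGraph V) (k : ℕ) : Prop :=
  ∀ M : G.Subgraph, M.IsMatching → M.edgeSet.encard ≤ k →
    ∃ M' : G.Subgraph, M ≤ M' ∧ M'.IsPerfectMatching

/-- A brace is a 2-extendable bipartite graph. -/
def IsBrace {V : Type*} (G : SimpleGraph V) : Prop :=
  G.IsBipartite ∧ G.IsExtendable 2

/-- A subgraph `K` of `G` is central if `G \ V(K)` has a perfect matching, that is, if `G` has a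
matching whose set of covered vertices is exactly `V(G) - V(K)`. -/
def Subgraph.IsCentral {V : Type*} {G : SimpleGraph V} (K : G.Subgraph) : Prop :=
  ∃ M : G.Subgraph, M.IsMatching ∧ M.verts = K.vertsᶜ

/-- An embedding of `H` into `G` as an even subdivision: the vertices of `H` are sent to distinct
vertices of `G`, and the edges of `H` to internally disjoint paths of `G` with an even number of
vertices. The path of an edge is given once for each of its two directions, the two being
reverses of each other. -/
structure EvenEmbedding {W V : Type*} (H : SimpleGraph W) (G : SimpleGraph V) where
  /-- the vertex of `G` that corresponds to a vertex of `H` -/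
  vert : W → V
  /-- the path of `G` that corresponds to an edge of `H` -/
  path : ∀ {w w' : W}, H.Adj w w' → G.Walk (vert w) (vert w')
  path_symm : ∀ {w w' : W} (h : H.Adj w w'), path h.symm = (path h).reverse
  vert_injective : Function.Injective vert
  isPath : ∀ {w w' : W} (h : H.Adj w w'), (path h).IsPath
  even_vertices : ∀ {w w' : W} (h : H.Adj w w'), Even (path h).support.length
  vert_mem_path : ∀ {w w' : W} (h : H.Adj w w') (x : W),
    vert x ∈ (path h).support → x = w ∨ x = w'
  path_disjoint : ∀ {w w' x x' : W} (h : H.Adj w w') (k : H.Adj x x'), s(w, w') ≠ s(x, x') →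
    ∀ v : V, v ∈ (path h).support → v ∈ (path k).support →
      (v = vert w ∨ v = vert w') ∧ (v = vert x ∨ v = vert x')

/-- The subgraph of `G` formed by all the vertices and paths of the embedding. -/
def EvenEmbedding.toSubgraph {W V : Type*} {H : SimpleGraph W} {G : SimpleGraph V}
    (φ : EvenEmbedding H G) : G.Subgraph :=
  (⨆ w : W, G.singletonSubgraph (φ.vert w)) ⊔ ⨆ d : H.Dart, (φ.path d.adj).toSubgraph

/-- `K` is a model of `H` in `G`: a central subgraph of `G` that is (isomorphic to) an even
subdivision of `H`. -/
def IsModel {W V : Type*} (H : SimpleGraph W) {G : SimpleGraph V} (K : G.Subgraph) : Prop :=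
  K.IsCentral ∧ ∃ φ : EvenEmbedding H G, φ.toSubgraph = K

/-- `G` contains `H`: some even subdivision of `H` is isomorphic to a central subgraph of `G`. -/
def ContainsGraph {V W : Type*} (G : SimpleGraph V) (H : SimpleGraph W) : Prop :=
  ∃ K : G.Subgraph, IsModel H K

/-- A `K`-path in `G`: a path with at least one edge whose two ends are in `K` and which has
no other vertex, and no edge, in common with `K`. -/
structure Subgraph.IsPathOf {V : Type*} {G : SimpleGraph V} (K : G.Subgraph) {u v : V}
    (P : G.Walk u v) : Prop where
  isPath : P.IsPath
  not_nil : ¬ P.Nil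
  left_mem : u ∈ K.verts
  right_mem : v ∈ K.verts
  eq_end : ∀ x ∈ P.support, x ∈ K.verts → x = u ∨ x = v
  edges_disjoint : ∀ e ∈ P.edges, e ∉ K.edgeSet

/-- Rotunda. The vertices `Sum.inr (i, 0), …, Sum.inr (i, 3)` form, in this order, the circuit of
length four in the `i`-th of three copies; `Sum.inl j` is the vertex obtained by identifying the
three degree-one vertices that are adjacent to the `j`-th vertices of the three circuits. -/
def rotunda : SimpleGraph (Fin 4 ⊕ Fin 3 × Fin 4) where
  Adj
    | Sum.inl _, Sum.inl _ => False
    | Sum.inl j, Sum.inr (_, j') => j = j'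
    | Sum.inr (_, j), Sum.inl j' => j = j'
    | Sum.inr (i, j), Sum.inr (i', j') => i = i' ∧ (j' = j + 1 ∨ j = j' + 1)
  symm := ⟨by
    rintro (j | ⟨i, j⟩) (j' | ⟨i', j'⟩) h
    · exact h
    · exact h.symm
    · exact h.symm
    · exact ⟨h.1.symm, h.2.symm⟩⟩
  loopless := ⟨by
    rintro (j | ⟨i, j⟩) h
    · exact h
    · revert h
      revert j
      simp⟩

/-- The center of Rotunda. -/
def rotundaCenter : Set (Fin 4 ⊕ Fin 3 × Fin 4) := Set.range Sum.inl

end SimpleGraph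

/-! ### Directed paths inside a vertex set, gadgets and double jumps -/

namespace DigraphLinkage

variable {V : Type*} {r : V → V → Prop} {U W : Set V} {p q x : V}

/-! Suppose that there is no model of K₃,₃. Centrality of the model of Rotunda gives an involution m
whose fixed points are exactly the four center vertices s₀, …, s₃, whose other pairs form a matching
of G, and which pairs up the vertices of each of the three circuits with legs. Let A be the colour
class of s₀. Put an arc v → w whenever v is in A and v is adjacent to m w; this is G with its
matching edges contracted. Then s₀ and s₂ are sources, s₁ and s₃ are sinks (called t₁ and t₃), and
each circuit with its legs becomes a directed circuit with two incoming and two outgoing legs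
(`Gadget`).

Two facts about G enter. First, 2-extendability yields, by a Hall-type count
(`IsExtendable.not_reachable`), that every vertex in the component of the model other than the
center is reached from both sources and reaches both sinks. Second, a `DoubleJump` gives K₃,₃: two
disjoint directed paths from the two sources to the two sinks, with a jump from the second to the
first and a later jump back from the first to the second, all avoiding one gadget, combine with that
gadget to a model (`containsGraph_of_doubleJump`). Hence the digraph has no double jump. These
properties are collected in `Frame`, and the rest is a statement about digraphs that is invariant
under reversing all arcs and under exchanging the sources together with the sinks.

In a frame, no directed path leads from the circuit or an outgoing leg of one gadget to the circuit
or an incoming leg of another: a shortest such path, cut at one of its arcs into a part U and a part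
W, would give a double jump avoiding the third gadget (`Frame.not_reach`). Next, every vertex of a
leg is in the strong component of its circuit. Otherwise some path would lead from the s₂-side
incoming legs to an s₀-side incoming leg without meeting a circuit, again a double jump
(`Frame.hub_reach_i₀`). Finally, an arc (h, e) leaving the strong component of a gadget would give a
double jump with U the vertices that reach h and W the vertices reached from e, the second path
running through another gadget (`Frame.out_strong`). By reversal no arc enters either. So with the
terminals removed different gadgets are in different components even of the underlying graph
(`Frame.eq_of_reach`), and a path of G that avoids the center, projected to this digraph, cannot
join two of them. -/

/-- `q` can be reached from `p` by a directed path all of whose vertices belong to `U`. -/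
def ReachIn (r : V → V → Prop) (U : Set V) (p q : V) : Prop :=
  p ∈ U ∧ Relation.ReflTransGen (fun x y => r x y ∧ y ∈ U) p q

theorem ReachIn.refl (h : p ∈ U) : ReachIn r U p p := ⟨h, .refl⟩

theorem ReachIn.right_mem (h : ReachIn r U p q) : q ∈ U := by
  rcases Relation.ReflTransGen.cases_tail h.2 with h' | ⟨_, _, h'⟩
  · exact h' ▸ h.1
  · exact h'.2

theorem ReachIn.trans (h : ReachIn r U p q) (h' : ReachIn r U q x) : ReachIn r U p x :=
  ⟨h.1, h.2.trans h'.2⟩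

theorem ReachIn.mono (h : ReachIn r U p q) (hUW : U ⊆ W) : ReachIn r W p q :=
  ⟨hUW h.1, Relation.ReflTransGen.mono (fun _ _ h => ⟨h.1, hUW h.2⟩) _ _ h.2⟩

theorem ReachIn.reach (h : ReachIn r U p q) : Relation.ReflTransGen r p q :=
  Relation.ReflTransGen.mono (fun _ _ h => h.1) _ _ h.2

theorem ReachIn.of_reach_left (h : Relation.ReflTransGen r p q) :
    ReachIn r {v | Relation.ReflTransGen r p v} p q := by
  refine ⟨.refl, ?_⟩
  induction h with
  | refl => exact .refl
  | tail hab hbc ih => exact ih.tail ⟨hbc, hab.tail hbc⟩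

theorem ReachIn.of_reach_right (h : Relation.ReflTransGen r p q) :
    ReachIn r {v | Relation.ReflTransGen r v q} p q := by
  refine ⟨h, ?_⟩
  induction h using Relation.ReflTransGen.head_induction_on with
  | refl => exact .refl
  | head hab hbc ih => exact .head ⟨hab, hbc⟩ ih

theorem ReachIn.of_isChain_cons {l : List V} (hc : List.IsChain r (p :: l))
    (hU : ∀ v ∈ p :: l, v ∈ U) (hq : q ∈ p :: l) : ReachIn r U p q := by
  induction l generalizing p with
  | nil => obtain rfl := List.mem_singleton.1 hq; exact .refl (hU _ (by simp))
  | cons b l ih =>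
    rcases List.mem_cons.1 hq with rfl | hq
    · exact .refl (hU _ (by simp))
    · rw [List.isChain_cons_cons] at hc
      have := ih hc.2 (fun v hv => hU v (by grind)) hq
      exact ⟨hU _ (by simp), .head ⟨hc.1, this.1⟩ this.2⟩

theorem ReachIn.of_isChain_append {l₁ l₂ : List V} (hc : List.IsChain r (l₁ ++ l₂))
    (hU : ∀ v ∈ l₁ ++ l₂, v ∈ U) (hp : p ∈ l₁) (hq : q ∈ l₂) : ReachIn r U p q := by
  obtain ⟨a, b, rfl⟩ := List.append_of_mem hp
  have hc' : List.IsChain r (p :: (b ++ l₂)) := by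
    have : a ++ p :: b ++ l₂ = a ++ (p :: (b ++ l₂)) := by simp
    rw [this] at hc
    exact hc.right_of_append
  exact of_isChain_cons hc' (by grind) (by grind)

theorem ReachIn.exists_isChain (h : ReachIn r U p q) :
    ∃ l, List.IsChain r (p :: l) ∧ (p :: l).Nodup ∧ (∀ v ∈ p :: l, v ∈ U) ∧
      (p :: l).getLast (by simp) = q := by
  obtain ⟨hp, h⟩ := h
  induction h using Relation.ReflTransGen.head_induction_on with
  | refl => exact ⟨[], by simp [hp]⟩
  | @head a b hab _ ih =>
    obtain ⟨l, hc, hn, hU, hl⟩ := ih hab.2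
    by_cases ha : a ∈ b :: l
    · obtain ⟨s, t, hst⟩ := List.append_of_mem ha
      rw [hst] at hc hn hU
      refine ⟨t, hc.right_of_append, hn.of_append_right, by grind, ?_⟩
      simp only [hst] at hl
      rw [← hl, List.getLast_append_of_right_ne_nil]
    · refine ⟨b :: l, ?_, List.nodup_cons.2 ⟨ha, hn⟩, ?_, ?_⟩
      · exact List.isChain_cons_cons.2 ⟨hab.1, hc⟩
      · grind
      · simpa using hl

theorem ReachIn.exists_isChain_of_ne (h : ReachIn r U p q) (hpq : p ≠ q) :
    ∃ l, List.IsChain r (p :: (l ++ [q])) ∧ (p :: (l ++ [q])).Nodup ∧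
      ∀ v ∈ p :: (l ++ [q]), v ∈ U := by
  obtain ⟨l, hc, hn, hU, hl⟩ := h.exists_isChain
  have hl0 : l ≠ [] := by rintro rfl; exact hpq (by simpa using hl)
  rw [List.getLast_cons hl0] at hl
  rw [← List.dropLast_append_getLast hl0, hl] at hc hn hU
  exact ⟨_, hc, hn, hU⟩

/-- A directed path from `P` to `Q` of minimum length. -/
theorem exists_shortest_isChain {P Q : V → Prop} {p₀ q₀ : V} (h : ReachIn r U p₀ q₀) (hp : P p₀)
    (hq : Q q₀) (hPQ : ∀ v, P v → ¬ Q v) :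
    ∃ p q l, P p ∧ Q q ∧ List.IsChain r (p :: (l ++ [q])) ∧ (p :: (l ++ [q])).Nodup ∧
      (∀ v ∈ p :: (l ++ [q]), v ∈ U) ∧
      ∀ p' q' l', P p' → Q q' → List.IsChain r (p' :: (l' ++ [q'])) → (p' :: (l' ++ [q'])).Nodup →
        (∀ v ∈ p' :: (l' ++ [q']), v ∈ U) → l.length ≤ l'.length := by
  classical
  let S : Set ℕ := {n | ∃ p q l, P p ∧ Q q ∧ List.IsChain r (p :: (l ++ [q])) ∧
    (p :: (l ++ [q])).Nodup ∧ (∀ v ∈ p :: (l ++ [q]), v ∈ U) ∧ l.length = n}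
  have hS : ∃ n, n ∈ S := by
    obtain ⟨l, hl⟩ := h.exists_isChain_of_ne (fun e => hPQ _ hp (e ▸ hq))
    exact ⟨_, p₀, q₀, l, hp, hq, hl.1, hl.2.1, hl.2.2, rfl⟩
  obtain ⟨p, q, l, h1, h2, h3, h4, h5, h6⟩ := Nat.find_spec hS
  refine ⟨p, q, l, h1, h2, h3, h4, h5, fun p' q' l' h1' h2' h3' h4' h5' => ?_⟩
  rw [h6]
  exact Nat.find_min' hS ⟨p', q', l', h1', h2', h3', h4', h5', rfl⟩

/-- A directed path from `P` to `Q` that is otherwise disjoint from both. -/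
theorem exists_jump {P Q : V → Prop} {p₀ q₀ : V} (h : ReachIn r U p₀ q₀) (hp : P p₀)
    (hq : Q q₀) (hPQ : ∀ v, P v → ¬ Q v) :
    ∃ p q l, P p ∧ Q q ∧ List.IsChain r (p :: (l ++ [q])) ∧ (p :: (l ++ [q])).Nodup ∧
      (∀ v ∈ p :: (l ++ [q]), v ∈ U) ∧ ∀ v ∈ l, ¬ P v ∧ ¬ Q v := by
  obtain ⟨p, q, l, h1, h2, h3, h4, h5, h6⟩ := exists_shortest_isChain h hp hq hPQ
  refine ⟨p, q, l, h1, h2, h3, h4, h5, fun v hv => ?_⟩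
  obtain ⟨s, t, rfl⟩ := List.append_of_mem hv
  constructor
  · intro hP
    have e : p :: (s ++ v :: t ++ [q]) = (p :: s) ++ (v :: (t ++ [q])) := by simp
    rw [e] at h3 h4 h5
    have := h6 v q t hP h2 h3.right_of_append h4.of_append_right (by grind)
    simp at this
    omega
  · intro hQ
    have e : p :: (s ++ v :: t ++ [q]) = (p :: (s ++ [v])) ++ (t ++ [q]) := by simp
    rw [e] at h3 h4 h5
    have := h6 p v s h1 hQ h3.left_of_append h4.of_append_left (by grind)
    simp at this

theorem exists_split_first (P : V → Prop) (l : List V) :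
    ∃ l₁ l₂, l = l₁ ++ l₂ ∧ (∀ v ∈ l₁, ¬ P v) ∧ (l₂ = [] ∨ ∃ w t, l₂ = w :: t ∧ P w) := by
  induction l with
  | nil => exact ⟨[], [], by simp⟩
  | cons a l ih =>
    by_cases ha : P a
    · exact ⟨[], a :: l, by simp [ha]⟩
    · obtain ⟨l₁, l₂, rfl, h1, h2⟩ := ih
      exact ⟨a :: l₁, l₂, by simp, by grind, h2⟩

theorem exists_split_last (P : V → Prop) (l : List V) :
    ∃ l₁ l₂, l = l₁ ++ l₂ ∧ (∀ v ∈ l₂, ¬ P v) ∧ (l₁ = [] ∨ ∃ t w, l₁ = t ++ [w] ∧ P w) := by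
  obtain ⟨l₁, l₂, h, h1, h2⟩ := exists_split_first P l.reverse
  refine ⟨l₂.reverse, l₁.reverse, ?_, by simpa using h1, ?_⟩
  · rw [← List.reverse_append, ← h, List.reverse_reverse]
  · rcases h2 with rfl | ⟨w, t, rfl, hw⟩
    · simp
    · exact .inr ⟨t.reverse, w, by simp, hw⟩

/-- The digraph of a circuit of length four together with its four legs, two of them coming in from
`s₀` and `s₂`, and two of them going out to `t₁` and `t₃`. -/
structure Gadget (r : V → V → Prop) (s₀ s₂ t₁ t₃ : V) where
  i₀ : List V
  x₀₁ : List V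
  o₁ : List V
  x₁₂ : List V
  i₂ : List V
  x₂₃ : List V
  o₃ : List V
  x₃₀ : List V
  ne₀₁ : x₀₁ ≠ []
  ne₂₃ : x₂₃ ≠ []
  chain₀ : List.IsChain r (s₀ :: (i₀ ++ (x₀₁ ++ (o₁ ++ [t₁]))))
  chain₂ : List.IsChain r (s₂ :: (i₂ ++ (x₂₃ ++ (o₃ ++ [t₃]))))
  link₀₂ : List.IsChain r (x₀₁ ++ (x₁₂ ++ x₂₃))
  link₂₀ : List.IsChain r (x₂₃ ++ (x₃₀ ++ x₀₁))
  nodup : (i₀ ++ (x₀₁ ++ (o₁ ++ (x₁₂ ++ (i₂ ++ (x₂₃ ++ (o₃ ++ x₃₀))))))).Nodup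

/-- Two disjoint paths from `a` to `c` and from `a'` to `c'`, together with a jump from the second
to the first inside `U` and a later jump from the first to the second inside `W`. -/
def DoubleJump (r : V → V → Prop) (K : Set V) (a a' c c' : V) : Prop :=
  ∃ (U W : Set V) (h e : V) (l m l' : List V),
    Disjoint U W ∧ Disjoint U K ∧ Disjoint W K ∧
    (a' :: (l ++ (m ++ (l' ++ [c'])))).IsChain r ∧ (a' :: (l ++ (m ++ (l' ++ [c'])))).Nodup ∧
    (∀ v ∈ a' :: l, v ∈ U) ∧ (∀ v ∈ l' ++ [c'], v ∈ W) ∧ (∀ v ∈ m, v ∉ U ∧ v ∉ W ∧ v ∉ K) ∧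
    ReachIn r {v ∈ U | v ∉ a' :: l} a h ∧ r h e ∧ ReachIn r {v ∈ W | v ∉ l' ++ [c']} e c ∧
    ReachIn r U a' h ∧ ReachIn r W e c'

/-- The case in which the second path stays in U until its last vertex, so that the middle and late
parts are empty. The first path must then avoid T before the arc (h, e) and only c' after it. -/
theorem DoubleJump.of_reachIn_left {K T : Set V} {a a' c c' h e : V} (hUW : Disjoint U W)
    (hUK : Disjoint U K) (hWK : Disjoint W K) (hT : ∀ v ∈ T, v = c' ∨ v ∈ U)
    (hT' : ReachIn r T a' c') (ha' : a' ∈ U) (hah : ReachIn r {v ∈ U | v ∉ T} a h) (hhe : r h e)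
    (hec : ReachIn r {v ∈ W | v ≠ c'} e c) (ha'h : ReachIn r U a' h) (hec' : ReachIn r W e c') :
    DoubleJump r K a a' c c' := by
  have hd : ∀ v, v ∈ U → v ∉ W := fun v hv hv' => (Set.disjoint_left.1 hUW) hv hv'
  have hc'W := hec'.right_mem
  obtain ⟨l, h1, h2, h3⟩ := hT'.exists_isChain_of_ne (by rintro rfl; exact hd _ ha' hc'W)
  refine ⟨U, W, h, e, l, [], [], hUW, hUK, hWK, by simpa using h1, by simpa using h2, ?_, ?_,
    by simp, ?_, hhe, ?_, ha'h, hec'⟩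
  · intro v hv
    rcases hT v (h3 v (by grind)) with rfl | h
    · simp only [List.mem_cons, List.nodup_cons, List.nodup_append] at hv h2; grind
    · exact h
  · simpa using hc'W
  · exact hah.mono fun v hv => ⟨hv.1, fun hv' => hv.2 (h3 v (by grind))⟩
  · exact hec.mono fun v hv => ⟨hv.1, by simpa using hv.2⟩

theorem ReachIn.flip (h : ReachIn r U p q) : ReachIn (flip r) U q p := by
  refine ⟨h.right_mem, ?_⟩
  obtain ⟨hp, h⟩ := h
  induction h using Relation.ReflTransGen.head_induction_on with
  | refl => exact .refl
  | head hab _ ih => exact (ih hab.2).tail ⟨hab.1, hp⟩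

theorem isChain_flip_reverse {l : List V} (h : List.IsChain r l) :
    List.IsChain (_root_.flip r) l.reverse :=
  List.isChain_reverse.2 h

/-- Double jumps are self-dual: reversal exchanges U with W and h with e, and the later jump becomes
the earlier one. This halves the case analysis below. -/
theorem DoubleJump.rev {K : Set V} {a a' c c' : V} (h : DoubleJump r K a a' c c') :
    DoubleJump (_root_.flip r) K c c' a a' := by
  obtain ⟨U, W, h, e, l, m, l', h1, h2, h3, h4, h5, h6, h7, h8, h9, h10, h11, h12, h13⟩ := h
  refine ⟨W, U, e, h, l'.reverse, m.reverse, l.reverse, h1.symm, h3, h2, ?_, ?_, ?_, ?_, ?_,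
    ?_, h10, ?_, h13.flip, h12.flip⟩
  · have := isChain_flip_reverse h4
    simpa using this
  · have := List.nodup_reverse.2 h5
    simpa using this
  · grind
  · grind
  · grind
  · exact h11.flip.mono fun v hv => ⟨hv.1, by grind⟩
  · exact h9.flip.mono fun v hv => ⟨hv.1, by grind⟩

theorem DoubleJump.of_reachIn_right {K T : Set V} {a a' c c' h e : V} (hUW : Disjoint U W)
    (hUK : Disjoint U K) (hWK : Disjoint W K) (hT : ∀ v ∈ T, v = a' ∨ v ∈ W)
    (hT' : ReachIn r T a' c') (hc' : c' ∈ W) (hah : ReachIn r {v ∈ U | v ≠ a'} a h) (hhe : r h e)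
    (hec : ReachIn r {v ∈ W | v ∉ T} e c) (ha'h : ReachIn r U a' h) (hec' : ReachIn r W e c') :
    DoubleJump r K a a' c c' :=
  (DoubleJump.of_reachIn_left (r := _root_.flip r) hUW.symm hWK hUK hT hT'.flip hc' hec.flip hhe
    hah.flip hec'.flip ha'h.flip).rev

namespace Gadget

variable {s₀ s₂ t₁ t₃ : V}

/-- The vertices of a gadget, in one list. -/
def all (g : Gadget r s₀ s₂ t₁ t₃) : List V :=
  g.i₀ ++ (g.x₀₁ ++ (g.o₁ ++ (g.x₁₂ ++ (g.i₂ ++ (g.x₂₃ ++ (g.o₃ ++ g.x₃₀))))))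

/-- The vertices that can be reached from the circuit along the gadget. -/
def Src (g : Gadget r s₀ s₂ t₁ t₃) (v : V) : Prop :=
  v ∈ g.x₀₁ ∨ v ∈ g.x₁₂ ∨ v ∈ g.x₂₃ ∨ v ∈ g.x₃₀ ∨ v ∈ g.o₁ ∨ v ∈ g.o₃

/-- The vertices from which the circuit can be reached along the gadget. -/
def Tgt (g : Gadget r s₀ s₂ t₁ t₃) (v : V) : Prop :=
  v ∈ g.x₀₁ ∨ v ∈ g.x₁₂ ∨ v ∈ g.x₂₃ ∨ v ∈ g.x₃₀ ∨ v ∈ g.i₀ ∨ v ∈ g.i₂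

/-- A vertex on the circuit of a gadget. -/
def hub (g : Gadget r s₀ s₂ t₁ t₃) : V := g.x₀₁.head g.ne₀₁

/-- The gadget with the roles of its two incoming and its two outgoing legs exchanged. -/
@[simps] def swap (g : Gadget r s₀ s₂ t₁ t₃) : Gadget r s₂ s₀ t₃ t₁ where
  i₀ := g.i₂
  x₀₁ := g.x₂₃
  o₁ := g.o₃
  x₁₂ := g.x₃₀
  i₂ := g.i₀
  x₂₃ := g.x₀₁
  o₃ := g.o₁
  x₃₀ := g.x₁₂
  ne₀₁ := g.ne₂₃
  ne₂₃ := g.ne₀₁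
  chain₀ := g.chain₂
  chain₂ := g.chain₀
  link₀₂ := g.link₂₀
  link₂₀ := g.link₀₂
  nodup := by
    have := g.nodup
    simp only [List.nodup_append] at this ⊢
    grind

/-- The gadget with all its arcs reversed. -/
@[simps] def rev (g : Gadget r s₀ s₂ t₁ t₃) : Gadget (flip r) t₁ t₃ s₀ s₂ where
  i₀ := g.o₁.reverse
  x₀₁ := g.x₀₁.reverse
  o₁ := g.i₀.reverse
  x₁₂ := g.x₃₀.reverse
  i₂ := g.o₃.reverse
  x₂₃ := g.x₂₃.reverse
  o₃ := g.i₂.reverse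
  x₃₀ := g.x₁₂.reverse
  ne₀₁ := by simpa using g.ne₀₁
  ne₂₃ := by simpa using g.ne₂₃
  chain₀ := by
    have := isChain_flip_reverse g.chain₀
    simpa using this
  chain₂ := by
    have := isChain_flip_reverse g.chain₂
    simpa using this
  link₀₂ := by
    have := isChain_flip_reverse g.link₂₀
    simpa using this
  link₂₀ := by
    have := isChain_flip_reverse g.link₀₂
    simpa using this
  nodup := by
    have := g.nodup
    simp only [List.nodup_append, List.nodup_reverse, List.mem_reverse, List.mem_append] at this ⊢
    grind

variable (g : Gadget r s₀ s₂ t₁ t₃)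

theorem mem_all_swap {v : V} : v ∈ g.swap.all ↔ v ∈ g.all := by
  simp only [all, swap, List.mem_append]; tauto

theorem mem_all_rev {v : V} : v ∈ g.rev.all ↔ v ∈ g.all := by
  simp only [all, rev, List.mem_append, List.mem_reverse]; tauto

theorem src_swap {v : V} : g.swap.Src v ↔ g.Src v := by
  simp only [Src, swap]; tauto

theorem tgt_swap {v : V} : g.swap.Tgt v ↔ g.Tgt v := by
  simp only [Tgt, swap]; tauto

theorem src_mem_all {v : V} (h : g.Src v) : v ∈ g.all := by
  simp only [Src, all, List.mem_append] at *; tauto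

theorem tgt_mem_all {v : V} (h : g.Tgt v) : v ∈ g.all := by
  simp only [Tgt, all, List.mem_append] at *; tauto

theorem hub_mem : g.hub ∈ g.x₀₁ := List.head_mem _

theorem src_hub : g.Src g.hub := .inl g.hub_mem

theorem tgt_hub : g.Tgt g.hub := .inl g.hub_mem

theorem x₀₁_eq : g.x₀₁ = g.hub :: g.x₀₁.tail := (List.cons_head_tail _).symm

theorem notMem_of_mem_i₀ {v : V} (hv : v ∈ g.i₀) :
    v ∉ g.x₀₁ ∧ v ∉ g.o₁ ∧ v ∉ g.x₁₂ ∧ v ∉ g.i₂ ∧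
      v ∉ g.x₂₃ ∧ v ∉ g.o₃ ∧ v ∉ g.x₃₀ := by
  have hnd := g.nodup
  simp only [List.nodup_append, List.mem_append] at hnd
  refine ⟨?_, ?_, ?_, ?_, ?_, ?_, ?_⟩ <;> intro hw <;> grind

theorem notMem_of_mem_x₀₁ {v : V} (hv : v ∈ g.x₀₁) :
    v ∉ g.i₀ ∧ v ∉ g.o₁ ∧ v ∉ g.x₁₂ ∧ v ∉ g.i₂ ∧
      v ∉ g.x₂₃ ∧ v ∉ g.o₃ ∧ v ∉ g.x₃₀ := by
  have hnd := g.nodup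
  simp only [List.nodup_append, List.mem_append] at hnd
  refine ⟨?_, ?_, ?_, ?_, ?_, ?_, ?_⟩ <;> intro hw <;> grind

theorem notMem_of_mem_o₁ {v : V} (hv : v ∈ g.o₁) :
    v ∉ g.i₀ ∧ v ∉ g.x₀₁ ∧ v ∉ g.x₁₂ ∧ v ∉ g.i₂ ∧
      v ∉ g.x₂₃ ∧ v ∉ g.o₃ ∧ v ∉ g.x₃₀ := by
  have hnd := g.nodup
  simp only [List.nodup_append, List.mem_append] at hnd
  refine ⟨?_, ?_, ?_, ?_, ?_, ?_, ?_⟩ <;> intro hw <;> grind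

theorem notMem_of_mem_x₁₂ {v : V} (hv : v ∈ g.x₁₂) :
    v ∉ g.i₀ ∧ v ∉ g.x₀₁ ∧ v ∉ g.o₁ ∧ v ∉ g.i₂ ∧
      v ∉ g.x₂₃ ∧ v ∉ g.o₃ ∧ v ∉ g.x₃₀ := by
  have hnd := g.nodup
  simp only [List.nodup_append, List.mem_append] at hnd
  refine ⟨?_, ?_, ?_, ?_, ?_, ?_, ?_⟩ <;> intro hw <;> grind

variable {Z : Set V}

theorem reachIn_x₀₁_x₂₃ (hZ : ∀ v ∈ g.all, v ∈ Z) {v w : V} (hv : v ∈ g.x₀₁ ∨ v ∈ g.x₁₂)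
    (hw : w ∈ g.x₂₃) : ReachIn r Z v w := by
  have h := g.link₀₂
  rw [← List.append_assoc] at h
  exact .of_isChain_append h (fun u hu => hZ u (by grind [all])) (by grind) hw

theorem reachIn_x₂₃_hub (hZ : ∀ v ∈ g.all, v ∈ Z) {v : V} (hv : v ∈ g.x₂₃ ∨ v ∈ g.x₃₀) :
    ReachIn r Z v g.hub := by
  have h := g.link₂₀
  rw [← List.append_assoc] at h
  exact .of_isChain_append h (fun u hu => hZ u (by grind [all])) (by grind) g.hub_mem

/-- The incoming legs lead to `x₀₁` and `x₂₃`, which are never empty, and the two links between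
these make the circuit strongly connected. -/
theorem reachIn_hub {v : V} (hZ : ∀ v ∈ g.all, v ∈ Z) (hv : v = s₀ ∨ v = s₂ ∨ g.Tgt v)
    (hvZ : v ∈ Z) : ReachIn r Z v g.hub := by
  have hx : ∀ w ∈ g.x₀₁, ReachIn r Z w g.hub := fun w hw =>
    (g.reachIn_x₀₁_x₂₃ hZ (.inl hw) (List.head_mem g.ne₂₃)).trans
      (g.reachIn_x₂₃_hub hZ (.inl (List.head_mem _)))
  have h0 : ∀ w ∈ s₀ :: g.i₀, w ∈ Z → ReachIn r Z w g.hub := by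
    intro w hw hwZ
    obtain ⟨a, b, hab⟩ := List.append_of_mem hw
    have h := g.chain₀
    have e : s₀ :: (g.i₀ ++ (g.x₀₁ ++ (g.o₁ ++ [t₁]))) =
        a ++ ((w :: (b ++ g.x₀₁)) ++ (g.o₁ ++ [t₁])) := by
      rw [← List.cons_append, hab]; simp
    rw [e] at h
    have h' := h.right_of_append.left_of_append
    refine .of_isChain_cons h' (fun u hu => ?_) (by simp [g.hub_mem])
    rcases List.mem_cons.1 hu with rfl | hu
    · exact hwZ
    · rcases List.mem_append.1 hu with hu | hu
      · refine hZ u ?_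
        rcases a with _ | ⟨a, l⟩
        · simp only [List.nil_append, List.cons.injEq] at hab; grind [all]
        · simp only [List.cons_append, List.cons.injEq] at hab; grind [all]
      · exact hZ u (by grind [all])
  have h2 : ∀ w ∈ s₂ :: g.i₂, w ∈ Z → ReachIn r Z w g.hub := by
    intro w hw hwZ
    obtain ⟨a, b, hab⟩ := List.append_of_mem hw
    have h := g.chain₂
    have e : s₂ :: (g.i₂ ++ (g.x₂₃ ++ (g.o₃ ++ [t₃]))) =
        a ++ ((w :: (b ++ g.x₂₃)) ++ (g.o₃ ++ [t₃])) := by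
      rw [← List.cons_append, hab]; simp
    rw [e] at h
    have h' := h.right_of_append.left_of_append
    refine ReachIn.trans (q := g.x₂₃.head g.ne₂₃) (.of_isChain_cons h' (fun u hu => ?_) (by simp))
      (g.reachIn_x₂₃_hub hZ (.inl (List.head_mem _)))
    rcases List.mem_cons.1 hu with rfl | hu
    · exact hwZ
    · rcases List.mem_append.1 hu with hu | hu
      · refine hZ u ?_
        rcases a with _ | ⟨a, l⟩
        · simp only [List.nil_append, List.cons.injEq] at hab; grind [all]
        · simp only [List.cons_append, List.cons.injEq] at hab; grind [all]
      · exact hZ u (by grind [all])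
  rcases hv with rfl | rfl | hv | hv | hv | hv | hv | hv
  · exact h0 _ (by simp) hvZ
  · exact h2 _ (by simp) hvZ
  · exact hx _ hv
  · exact (g.reachIn_x₀₁_x₂₃ hZ (.inr hv) (List.head_mem g.ne₂₃)).trans
      (g.reachIn_x₂₃_hub hZ (.inl (List.head_mem _)))
  · exact g.reachIn_x₂₃_hub hZ (.inl hv)
  · exact g.reachIn_x₂₃_hub hZ (.inr hv)
  · exact h0 _ (by simp [hv]) hvZ
  · exact h2 _ (by simp [hv]) hvZ

theorem reachIn_of_hub {v : V} (hZ : ∀ v ∈ g.all, v ∈ Z) (hv : v = t₁ ∨ v = t₃ ∨ g.Src v)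
    (hvZ : v ∈ Z) : ReachIn r Z g.hub v := by
  have h := g.rev.reachIn_hub (Z := Z) (v := v) (fun v hv => hZ v (g.mem_all_rev.1 hv))
    (by
      rcases hv with rfl | rfl | hv
      · exact .inl rfl
      · exact .inr (.inl rfl)
      · refine .inr (.inr ?_)
        simp only [Src, Tgt, rev, List.mem_reverse] at hv ⊢
        tauto) hvZ
  have h' : ReachIn r Z g.rev.hub v := h.flip
  -- The hub of the reversed gadget is the last vertex of `x₀₁`, not the first, so the way along
  -- `x₀₁` has to be prefixed.
  have h'' : ReachIn r Z g.hub g.rev.hub := by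
    have hc : List.IsChain r (g.hub :: g.x₀₁.tail) := by
      rw [← g.x₀₁_eq]; exact g.link₀₂.left_of_append
    refine .of_isChain_cons hc (fun u hu => hZ u ?_) ?_
    · rw [← g.x₀₁_eq] at hu; grind [all]
    · rw [← g.x₀₁_eq]; simpa using g.rev.hub_mem
  exact h''.trans h'

theorem reachIn {v w : V} (hZ : ∀ v ∈ g.all, v ∈ Z) (hv : v = s₀ ∨ v = s₂ ∨ g.Tgt v)
    (hw : w = t₁ ∨ w = t₃ ∨ g.Src w) (hvZ : v ∈ Z) (hwZ : w ∈ Z) : ReachIn r Z v w :=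
  (g.reachIn_hub hZ hv hvZ).trans (g.reachIn_of_hub hZ hw hwZ)

theorem reachIn_chain₀ {w : V} (hZ : ∀ v, v = s₀ ∨ v = t₁ ∨ v ∈ g.i₀ ∨ v ∈ g.x₀₁ ∨ v ∈ g.o₁ → v ∈ Z)
    (hw : w = t₁ ∨ w ∈ g.i₀ ∨ w ∈ g.x₀₁ ∨ w ∈ g.o₁) : ReachIn r Z s₀ w :=
  .of_isChain_cons g.chain₀ (fun v hv => hZ v (by grind)) (by grind)

theorem reachIn_i₀ {w : V} (hZ : ∀ v, v = s₀ ∨ v ∈ g.i₀ → v ∈ Z) (hw : w ∈ g.i₀) :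
    ReachIn r Z s₀ w := by
  have h := g.chain₀
  rw [← List.cons_append] at h
  exact .of_isChain_cons h.left_of_append (fun v hv => hZ v (by grind)) (by grind)

theorem reachIn_x₀₁ {w : V}
    (hZ : ∀ v, v = s₀ ∨ v ∈ g.i₀ ∨ v ∈ g.x₀₁ ∨ v ∈ g.o₁ → v ∈ Z)
    (hw : w ∈ g.x₀₁ ∨ w ∈ g.o₁) : ReachIn r Z s₀ w := by
  have h := g.chain₀
  have e : s₀ :: (g.i₀ ++ (g.x₀₁ ++ (g.o₁ ++ [t₁]))) =
      (s₀ :: (g.i₀ ++ (g.x₀₁ ++ g.o₁))) ++ [t₁] := by simp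
  rw [e] at h
  exact .of_isChain_cons h.left_of_append (fun v hv => hZ v (by grind)) (by grind)

theorem reachIn_o₁ {v : V} (hZ : ∀ v, v = t₁ ∨ v ∈ g.o₁ → v ∈ Z) (hv : v ∈ g.o₁) :
    ReachIn r Z v t₁ := by
  have h := g.chain₀
  have e : s₀ :: (g.i₀ ++ (g.x₀₁ ++ (g.o₁ ++ [t₁]))) =
      (s₀ :: (g.i₀ ++ g.x₀₁)) ++ (g.o₁ ++ [t₁]) := by simp
  rw [e] at h
  exact .of_isChain_append h.right_of_append (fun v hv => hZ v (by grind)) hv (by simp)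

theorem reachIn_x₁₂ {w : V} (hZ : ∀ v, v = s₀ ∨ v ∈ g.i₀ ∨ v ∈ g.x₀₁ ∨ v ∈ g.x₁₂ → v ∈ Z)
    (hw : w ∈ g.x₁₂) : ReachIn r Z s₀ w := by
  have h := g.chain₀
  have e : s₀ :: (g.i₀ ++ (g.x₀₁ ++ (g.o₁ ++ [t₁]))) =
      (s₀ :: (g.i₀ ++ g.x₀₁)) ++ (g.o₁ ++ [t₁]) := by simp
  rw [e] at h
  have h' := g.link₀₂
  rw [← List.append_assoc] at h'
  exact (ReachIn.of_isChain_cons h.left_of_append (fun v hv => hZ v (by grind))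
    (by simp [g.hub_mem])).trans
    (.of_isChain_append h'.left_of_append (fun v hv => hZ v (by grind)) g.hub_mem hw)

/-- The way through the gadget from s₂ that leaves on the side of t₁. It avoids the legs `i₀` and
`o₃`, and serves as the second path when the first one is forced to end in t₃. -/
theorem reachIn_cross (hZ : ∀ v, v = s₂ ∨ v = t₁ ∨ v ∈ g.i₂ ∨ v ∈ g.x₂₃ ∨ v ∈ g.x₃₀ ∨ v ∈ g.x₀₁ ∨
    v ∈ g.o₁ → v ∈ Z) : ReachIn r Z s₂ t₁ := by
  have h := g.chain₂
  have e : s₂ :: (g.i₂ ++ (g.x₂₃ ++ (g.o₃ ++ [t₃]))) =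
      (s₂ :: (g.i₂ ++ g.x₂₃)) ++ (g.o₃ ++ [t₃]) := by simp
  rw [e] at h
  have h' := g.chain₀
  rw [← List.cons_append] at h'
  refine ((ReachIn.of_isChain_cons h.left_of_append (fun v hv => hZ v (by grind))
    (q := g.x₂₃.head g.ne₂₃) (by simp)).trans
    (.of_isChain_append g.link₂₀ (fun v hv => hZ v (by grind)) (List.head_mem _)
      (q := g.hub) (by simp [g.hub_mem]))).trans ?_
  have h'' := h'.right_of_append
  rw [← List.append_assoc] at h''
  exact .of_isChain_append h'' (fun v hv => hZ v (by grind)) (by simp [g.hub_mem]) (by simp)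

end Gadget

end DigraphLinkage

/-! ### Frames, and double jumps from a path between two gadgets -/

namespace DigraphLinkage

variable {V : Type*} {r : V → V → Prop} {s₀ s₂ t₁ t₃ : V}

/-- Three disjoint gadgets with common terminals in a digraph in which each vertex of interest is
joined to all the terminals, and which has no double jump. -/
structure Frame (r : V → V → Prop) (s₀ s₂ t₁ t₃ : V) where
  g : Fin 3 → Gadget r s₀ s₂ t₁ t₃
  terminals : [s₀, s₂, t₁, t₃].Nodup
  not_in₀ : ∀ v, ¬ r v s₀
  not_in₂ : ∀ v, ¬ r v s₂
  not_out₁ : ∀ v, ¬ r t₁ v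
  not_out₃ : ∀ v, ¬ r t₃ v
  not_mem : ∀ i, ∀ v ∈ (g i).all, v ≠ s₀ ∧ v ≠ s₂ ∧ v ≠ t₁ ∧ v ≠ t₃
  disj : ∀ i j, i ≠ j → ∀ v ∈ (g i).all, v ∉ (g j).all
  N : Set V
  mem_N : ∀ i, ∀ v ∈ (g i).all, v ∈ N
  out_N : ∀ v w, r v w → v ∈ N → w ≠ t₁ → w ≠ t₃ → w ∈ N
  in_N : ∀ v w, r v w → w ∈ N → v ≠ s₀ → v ≠ s₂ → v ∈ N
  reach₀ : ∀ v ∈ N, Relation.ReflTransGen r s₀ v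
  reach₂ : ∀ v ∈ N, Relation.ReflTransGen r s₂ v
  reach₁ : ∀ v ∈ N, Relation.ReflTransGen r v t₁
  reach₃ : ∀ v ∈ N, Relation.ReflTransGen r v t₃
  noJump : ∀ k a a' c c', (a = s₀ ∧ a' = s₂ ∨ a = s₂ ∧ a' = s₀) →
    (c = t₁ ∧ c' = t₃ ∨ c = t₃ ∧ c' = t₁) → ¬ DoubleJump r {v | v ∈ (g k).all} a a' c c'

namespace Frame

/-- The frame with the two sources and the two sinks exchanged. -/
def swap (F : Frame r s₀ s₂ t₁ t₃) : Frame r s₂ s₀ t₃ t₁ where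
  g i := (F.g i).swap
  terminals := by have := F.terminals; grind
  not_in₀ := F.not_in₂
  not_in₂ := F.not_in₀
  not_out₁ := F.not_out₃
  not_out₃ := F.not_out₁
  not_mem i v hv := by
    have := F.not_mem i v ((F.g i).mem_all_swap.1 hv); tauto
  disj i j hij v hv hv' :=
    F.disj i j hij v ((F.g i).mem_all_swap.1 hv) ((F.g j).mem_all_swap.1 hv')
  N := F.N
  mem_N i v hv := F.mem_N i v ((F.g i).mem_all_swap.1 hv)
  out_N v w h h' h1 h2 := F.out_N v w h h' h2 h1
  in_N v w h h' h1 h2 := F.in_N v w h h' h2 h1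
  reach₀ := F.reach₂
  reach₂ := F.reach₀
  reach₁ := F.reach₃
  reach₃ := F.reach₁
  noJump k a a' c c' ha hc h := by
    refine F.noJump k a a' c c' ha.symm hc.symm ?_
    simpa only [Gadget.mem_all_swap] using h

/-- The frame with all the arcs reversed. -/
def rev (F : Frame r s₀ s₂ t₁ t₃) : Frame (flip r) t₁ t₃ s₀ s₂ where
  g i := (F.g i).rev
  terminals := by have := F.terminals; grind
  not_in₀ := F.not_out₁
  not_in₂ := F.not_out₃
  not_out₁ := F.not_in₀
  not_out₃ := F.not_in₂
  not_mem i v hv := by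
    have := F.not_mem i v ((F.g i).mem_all_rev.1 hv); tauto
  disj i j hij v hv hv' :=
    F.disj i j hij v ((F.g i).mem_all_rev.1 hv) ((F.g j).mem_all_rev.1 hv')
  N := F.N
  mem_N i v hv := F.mem_N i v ((F.g i).mem_all_rev.1 hv)
  out_N v w h h' h1 h2 := F.in_N w v h h' h1 h2
  in_N v w h h' h1 h2 := F.out_N w v h h' h1 h2
  reach₀ v hv := (ReachIn.of_reach_left (F.reach₁ v hv)).flip.reach
  reach₂ v hv := (ReachIn.of_reach_left (F.reach₃ v hv)).flip.reach
  reach₁ v hv := (ReachIn.of_reach_left (F.reach₀ v hv)).flip.reach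
  reach₃ v hv := (ReachIn.of_reach_left (F.reach₂ v hv)).flip.reach
  noJump k a a' c c' ha hc h := by
    have h' : DoubleJump r _ c c' a a' := h.rev
    refine F.noJump k c c' a a' hc ha ?_
    simpa only [Gadget.mem_all_rev] using h'

theorem ne_of_rel (F : Frame r s₀ s₂ t₁ t₃) {v w : V} (h : r v w) :
    v ≠ t₁ ∧ v ≠ t₃ ∧ w ≠ s₀ ∧ w ≠ s₂ :=
  ⟨fun e => F.not_out₁ _ (e ▸ h), fun e => F.not_out₃ _ (e ▸ h), fun e => F.not_in₀ _ (e ▸ h),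
    fun e => F.not_in₂ _ (e ▸ h)⟩

theorem terminals_ne (F : Frame r s₀ s₂ t₁ t₃) :
    s₀ ≠ s₂ ∧ s₀ ≠ t₁ ∧ s₀ ≠ t₃ ∧ s₂ ≠ t₁ ∧ s₂ ≠ t₃ ∧ t₁ ≠ t₃ := by
  have := F.terminals; grind

/-- A path from the `i`-th to the `j`-th gadget through the arc `(h, e)`, where `U` contains the
part before this arc and `W` contains the part after it. -/
structure Link (F : Frame r s₀ s₂ t₁ t₃) (i j k : Fin 3) (U W : Set V) (u h e : V) : Prop where
  ij : i ≠ j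
  ik : i ≠ k
  jk : j ≠ k
  disjoint : Disjoint U W
  all_U : ∀ v ∈ (F.g i).all, v ∈ U
  all_W : ∀ v ∈ (F.g j).all, v ∈ W
  s_U : s₀ ∈ U ∧ s₂ ∈ U
  t_W : t₁ ∈ W ∧ t₃ ∈ W
  U_k : ∀ v ∈ U, v ∉ (F.g k).all
  W_k : ∀ v ∈ W, v ∉ (F.g k).all
  reach_h : ReachIn r {v ∈ U | v = u ∨ (∀ l, v ∉ (F.g l).all) ∧ v ≠ s₀ ∧ v ≠ s₂} u h
  rel : r h e
  reach_u : ∃ p, (F.g i).Src p ∧ ReachIn r U p u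
  reach_e : ∃ q, (F.g j).Tgt q ∧ ReachIn r W e q

namespace Link

variable {F : Frame r s₀ s₂ t₁ t₃} {i j k : Fin 3} {U W : Set V} {u h e : V}

theorem swap (L : Link F i j k U W u h e) : Link F.swap i j k U W u h e where
  ij := L.ij
  ik := L.ik
  jk := L.jk
  disjoint := L.disjoint
  all_U v hv := L.all_U v ((F.g i).mem_all_swap.1 hv)
  all_W v hv := L.all_W v ((F.g j).mem_all_swap.1 hv)
  s_U := L.s_U.symm
  t_W := L.t_W.symm
  U_k v hv hv' := L.U_k v hv ((F.g k).mem_all_swap.1 hv')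
  W_k v hv hv' := L.W_k v hv ((F.g k).mem_all_swap.1 hv')
  reach_h := L.reach_h.mono fun v hv => ⟨hv.1, hv.2.imp_right fun h =>
    ⟨fun l hl => h.1 l ((F.g l).mem_all_swap.1 hl), h.2.2, h.2.1⟩⟩
  rel := L.rel
  reach_u := by
    obtain ⟨p, hp, h⟩ := L.reach_u
    exact ⟨p, (F.g i).src_swap.2 hp, h⟩
  reach_e := by
    obtain ⟨p, hp, h⟩ := L.reach_e
    exact ⟨p, (F.g j).tgt_swap.2 hp, h⟩

theorem U_K (L : Link F i j k U W u h e) : Disjoint U {v | v ∈ (F.g k).all} :=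
  Set.disjoint_left.2 L.U_k

theorem W_K (L : Link F i j k U W u h e) : Disjoint W {v | v ∈ (F.g k).all} :=
  Set.disjoint_left.2 L.W_k

theorem reachIn_u (L : Link F i j k U W u h e) {v : V}
    (hv : v = s₀ ∨ v = s₂ ∨ (F.g i).Tgt v) : ReachIn r U v u := by
  obtain ⟨p, hp, hpu⟩ := L.reach_u
  refine ((F.g i).reachIn L.all_U hv (.inr (.inr hp)) ?_ hpu.1).trans hpu
  rcases hv with rfl | rfl | hv
  · exact L.s_U.1
  · exact L.s_U.2
  · exact L.all_U _ ((F.g i).tgt_mem_all hv)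

theorem reachIn_h (L : Link F i j k U W u h e) {v : V}
    (hv : v = s₀ ∨ v = s₂ ∨ (F.g i).Tgt v) : ReachIn r U v h :=
  (L.reachIn_u hv).trans (L.reach_h.mono fun _ hv => hv.1)

theorem reachIn_e (L : Link F i j k U W u h e) {v : V}
    (hv : v = t₁ ∨ v = t₃ ∨ (F.g j).Src v) : ReachIn r W e v := by
  obtain ⟨q, hq, heq⟩ := L.reach_e
  refine heq.trans ((F.g j).reachIn L.all_W (.inr (.inr hq)) hv heq.right_mem ?_)
  rcases hv with rfl | rfl | hv
  · exact L.t_W.1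
  · exact L.t_W.2
  · exact L.all_W _ ((F.g j).src_mem_all hv)

/-- The second path leads through the `i`-th gadget. -/
theorem false_left (L : Link F i j k U W u h e) {T Z : Set V} {a a' c c' : V}
    (ha : a = s₀ ∧ a' = s₂ ∨ a = s₂ ∧ a' = s₀) (hc : c = t₁ ∧ c' = t₃ ∨ c = t₃ ∧ c' = t₁)
    (hT : ∀ v ∈ T, v = c' ∨ v = a' ∨ v ∈ (F.g i).all) (hT' : ReachIn r T a' c')
    (hZ : ∀ v ∈ Z, v ∈ U ∧ v ∉ T) (hau : ReachIn r Z a u)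
    (hec : ReachIn r {v ∈ W | v ≠ c'} e c) : False := by
  have ha' : a' = s₀ ∨ a' = s₂ := by tauto
  have hc' : c' = t₁ ∨ c' = t₃ := by tauto
  have ha'U : a' ∈ U := by rcases ha' with rfl | rfl <;> simp [L.s_U]
  have hc'W : c' ∈ W := by rcases hc' with rfl | rfl <;> simp [L.t_W]
  -- The two jumps come for free: every source reaches h inside U through the i-th gadget, and e
  -- reaches every sink inside W through the j-th gadget.
  refine F.noJump k a a' c c' ha hc (.of_reachIn_left L.disjoint L.U_K L.W_K (T := T) ?_ hT' ha'U
    ((hau.mono hZ).trans (L.reach_h.mono ?_)) L.rel hec (L.reachIn_h (by tauto))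
    (L.reachIn_e (by tauto)))
  · intro v hv
    rcases hT v hv with h | rfl | h
    · exact .inl h
    · exact .inr ha'U
    · exact .inr (L.all_U v h)
  · rintro v ⟨hvU, rfl | hv⟩
    · exact hZ _ hau.right_mem
    · refine ⟨hvU, fun hvT => ?_⟩
      rcases hT v hvT with rfl | rfl | h
      · exact Set.disjoint_left.1 L.disjoint hvU hc'W
      · tauto
      · exact hv.1 i h

/-- The second path leads through the `j`-th gadget. -/
theorem false_right (L : Link F i j k U W u h e) {T Z : Set V} {a a' c c' : V}
    (ha : a = s₀ ∧ a' = s₂ ∨ a = s₂ ∧ a' = s₀) (hc : c = t₁ ∧ c' = t₃ ∨ c = t₃ ∧ c' = t₁)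
    (hT : ∀ v ∈ T, v = c' ∨ v = a' ∨ v ∈ (F.g j).all) (hT' : ReachIn r T a' c')
    (hZ : ∀ v ∈ Z, v ∈ W ∧ v ∉ T) (hec : ReachIn r Z e c)
    (hau : ReachIn r {v ∈ U | v ≠ a'} a u) : False := by
  have ha' : a' = s₀ ∨ a' = s₂ := by tauto
  have hc' : c' = t₁ ∨ c' = t₃ := by tauto
  have ha'U : a' ∈ U := by rcases ha' with rfl | rfl <;> simp [L.s_U]
  have hc'W : c' ∈ W := by rcases hc' with rfl | rfl <;> simp [L.t_W]
  refine F.noJump k a a' c c' ha hc (.of_reachIn_right L.disjoint L.U_K L.W_K (T := T) ?_ hT' hc'W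
    (hau.trans (L.reach_h.mono ?_)) L.rel (hec.mono hZ) (L.reachIn_h (by tauto))
    (L.reachIn_e (by tauto)))
  · intro v hv
    rcases hT v hv with rfl | rfl | h
    · exact .inr hc'W
    · exact .inl rfl
    · exact .inr (L.all_W v h)
  · rintro v ⟨hvU, rfl | hv⟩
    · exact hau.right_mem
    · exact ⟨hvU, by rcases ha' with rfl | rfl <;> tauto⟩

theorem mem_left (L : Link F i j k U W u h e) {v : V} (hv : v ∈ (F.g i).all) :
    v ∈ U ∧ v ≠ s₀ ∧ v ≠ s₂ ∧ v ≠ t₁ ∧ v ≠ t₃ :=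
  ⟨L.all_U v hv, F.not_mem i v hv⟩

theorem mem_right (L : Link F i j k U W u h e) {v : V} (hv : v ∈ (F.g j).all) :
    v ∈ W ∧ v ≠ s₀ ∧ v ≠ s₂ ∧ v ≠ t₁ ∧ v ≠ t₃ :=
  ⟨L.all_W v hv, F.not_mem j v hv⟩

theorem reachIn_of_tgt (L : Link F i j k U W u h e) (he : (F.g j).Tgt e) :
    ReachIn r {v ∈ W | v ≠ t₃} e t₁ := by
  have hjW : ∀ v ∈ (F.g j).all, v ∈ {v ∈ W | v ≠ t₃} := fun v hv =>
    ⟨(L.mem_right hv).1, (L.mem_right hv).2.2.2.2⟩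
  exact (F.g j).reachIn hjW (.inr (.inr he)) (.inl rfl) (hjW _ ((F.g j).tgt_mem_all he))
    ⟨L.t_W.1, F.terminals_ne.2.2.2.2.2⟩

theorem reachIn_of_o₁ (L : Link F i j k U W u h e) (he : e ∈ (F.g j).o₁) :
    ReachIn r {v ∈ W | v ≠ t₃} e t₁ := by
  refine (F.g j).reachIn_o₁ ?_ he
  rintro v (rfl | hv)
  · exact ⟨L.t_W.1, F.terminals_ne.2.2.2.2.2⟩
  · have := L.mem_right (v := v) (by simp [Gadget.all, hv])
    exact ⟨this.1, this.2.2.2.2⟩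

/-- Starting at s₀, the first path needs only the incoming leg `i₀` to get to u, so the second path
may use the rest of the gadget and leave it on either side. That side is chosen opposite to the sink
that e leads to. -/
theorem false_of_i₀ (L : Link F i j k U W u h e) (hu : u ∈ (F.g i).i₀)
    (he : (F.g j).Tgt e ∨ e ∈ (F.g j).o₁ ∨ e ∈ (F.g j).o₃) : False := by
  have hau := (F.g i).reachIn_i₀ (Z := {v | v = s₀ ∨ v ∈ (F.g i).i₀}) (fun v hv => hv) hu
  have hZ : ∀ v, v = s₀ ∨ v ∈ (F.g i).i₀ → v ∈ U ∧ v ≠ s₂ ∧ v ≠ t₁ ∧ v ≠ t₃ ∧ v ∉ (F.g i).i₂ ∧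
      v ∉ (F.g i).x₂₃ ∧ v ∉ (F.g i).x₃₀ ∧ v ∉ (F.g i).x₀₁ ∧ v ∉ (F.g i).o₁ ∧ v ∉ (F.g i).o₃ := by
    rintro v (rfl | hv)
    · have ht := F.terminals_ne
      refine ⟨L.s_U.1, ht.1, ht.2.1, ht.2.2.1, ?_, ?_, ?_, ?_, ?_, ?_⟩ <;> intro hw <;>
        exact (F.not_mem i v (by simp [Gadget.all, hw])).1 rfl
    · have h1 := (F.g i).notMem_of_mem_i₀ hv
      have h2 := L.mem_left (v := v) (by simp [Gadget.all, hv])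
      exact ⟨h2.1, h2.2.2.1, h2.2.2.2.1, h2.2.2.2.2, h1.2.2.2.1, h1.2.2.2.2.1, h1.2.2.2.2.2.2,
        h1.1, h1.2.1, h1.2.2.2.2.2.1⟩
  -- From `o₃` the first path continues along the leg to t₃, hence the second path crosses over to
  -- t₁. In all other cases e reaches t₁ without t₃, and the second path goes straight from s₂ to
  -- t₃.
  by_cases h3 : e ∈ (F.g j).o₃
  · refine L.false_left (a := s₀) (a' := s₂) (c := t₃) (c' := t₁) (by simp) (by simp)
      (T := {v | v = s₂ ∨ v = t₁ ∨ v ∈ (F.g i).i₂ ∨ v ∈ (F.g i).x₂₃ ∨ v ∈ (F.g i).x₃₀ ∨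
        v ∈ (F.g i).x₀₁ ∨ v ∈ (F.g i).o₁}) ?_ ((F.g i).reachIn_cross fun v hv => hv) ?_ hau
      (L.swap.reachIn_of_o₁ h3)
    · rintro v (h | h | h | h | h | h | h) <;> simp [h, Gadget.all]
    · intro v hv
      have := hZ v hv
      simp [this]
  · refine L.false_left (a := s₀) (a' := s₂) (c := t₁) (c' := t₃) (by simp) (by simp)
      (T := {v | v = s₂ ∨ v = t₃ ∨ v ∈ (F.g i).i₂ ∨ v ∈ (F.g i).x₂₃ ∨ v ∈ (F.g i).o₃}) ?_
      ((F.g i).swap.reachIn_chain₀ (fun v hv => hv) (.inl rfl)) ?_ hau ?_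
    · rintro v (h | h | h | h | h) <;> simp [h, Gadget.all]
    · intro v hv
      have := hZ v hv
      simp [this]
    · rcases he with he | he | he
      · exact L.reachIn_of_tgt he
      · exact L.reachIn_of_o₁ he
      · exact absurd he h3

/-- Here the paths are kept apart in the gadget that is entered: the first needs only the end of the
leg `o₁`, the second runs from s₂ to t₃ through the other half of the j-th gadget. In the i-th
gadget the first path need only avoid s₂. -/
theorem false_of_src_o₁ (L : Link F i j k U W u h e) (hu : (F.g i).Src u)
    (he : e ∈ (F.g j).o₁) : False := by
  refine L.false_right (a := s₀) (a' := s₂) (c := t₁) (c' := t₃) (by simp) (by simp)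
      (T := {v | v = s₂ ∨ v = t₃ ∨ v ∈ (F.g j).i₂ ∨ v ∈ (F.g j).x₂₃ ∨ v ∈ (F.g j).o₃}) ?_
      ((F.g j).swap.reachIn_chain₀ (fun v hv => hv) (.inl rfl))
      (Z := {v | v = t₁ ∨ v ∈ (F.g j).o₁}) ?_ ((F.g j).reachIn_o₁ (fun v hv => hv) he) ?_
  · rintro v (h | h | h | h | h) <;> simp [h, Gadget.all]
  · have ht := F.terminals_ne
    rintro v (rfl | hv)
    · have hi : v ∉ (F.g j).i₂ := fun h => (F.not_mem j v (by simp [Gadget.all, h])).2.2.1 rfl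
      have hx : v ∉ (F.g j).x₂₃ := fun h => (F.not_mem j v (by simp [Gadget.all, h])).2.2.1 rfl
      have ho : v ∉ (F.g j).o₃ := fun h => (F.not_mem j v (by simp [Gadget.all, h])).2.2.1 rfl
      simp [L.t_W, ht.2.2.2.1.symm, ht.2.2.2.2.2, hi, hx, ho]
    · have hv : v ∈ (F.g j).o₁ := hv
      have h1 := (F.g j).notMem_of_mem_o₁ hv
      have h2 := L.mem_right (v := v) (by simp [Gadget.all, hv])
      simp [h1, h2]
  · have hiU : ∀ v ∈ (F.g i).all, v ∈ {v ∈ U | v ≠ s₂} := fun v hv =>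
      ⟨(L.mem_left hv).1, (L.mem_left hv).2.2.1⟩
    exact (F.g i).reachIn hiU (.inl rfl) (.inr (.inr hu)) ⟨L.s_U.1, F.terminals_ne.1⟩
      (hiU _ ((F.g i).src_mem_all hu))

/-- The straight way from s₂ to t₃ through the i-th gadget leaves untouched the half entered from
s₀, which contains u; after e the first path goes through the j-th gadget to t₁. -/
theorem false_of_x₀₁_tgt (L : Link F i j k U W u h e)
    (hu : u ∈ (F.g i).x₀₁ ∨ u ∈ (F.g i).x₁₂ ∨ u ∈ (F.g i).o₁)
    (he : (F.g j).Tgt e) : False := by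
  refine L.false_left (a := s₀) (a' := s₂) (c := t₁) (c' := t₃) (by simp) (by simp)
    (T := {v | v = s₂ ∨ v = t₃ ∨ v ∈ (F.g i).i₂ ∨ v ∈ (F.g i).x₂₃ ∨ v ∈ (F.g i).o₃}) ?_
    ((F.g i).swap.reachIn_chain₀ (fun v hv => hv) (.inl rfl))
    (Z := {v ∈ U | ¬ (v = s₂ ∨ v = t₃ ∨ v ∈ (F.g i).i₂ ∨ v ∈ (F.g i).x₂₃ ∨ v ∈ (F.g i).o₃)})
    (fun v hv => hv) ?_ (L.reachIn_of_tgt he)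
  · rintro v (h | h | h | h | h) <;> simp [h, Gadget.all]
  · have h₀ : s₀ ∈ {v ∈ U | ¬ (v = s₂ ∨ v = t₃ ∨ v ∈ (F.g i).i₂ ∨ v ∈ (F.g i).x₂₃ ∨
        v ∈ (F.g i).o₃)} := by
      have ht := F.terminals_ne
      have hi : s₀ ∉ (F.g i).i₂ := fun h => (F.not_mem i _ (by simp [Gadget.all, h])).1 rfl
      have hx : s₀ ∉ (F.g i).x₂₃ := fun h => (F.not_mem i _ (by simp [Gadget.all, h])).1 rfl
      have ho : s₀ ∉ (F.g i).o₃ := fun h => (F.not_mem i _ (by simp [Gadget.all, h])).1 rfl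
      simp [L.s_U, ht.1, ht.2.2.1, hi, hx, ho]
    have h₁ : ∀ v, v ∈ (F.g i).i₀ ∨ v ∈ (F.g i).x₀₁ ∨ v ∈ (F.g i).x₁₂ ∨ v ∈ (F.g i).o₁ →
        v ∈ {v ∈ U | ¬ (v = s₂ ∨ v = t₃ ∨ v ∈ (F.g i).i₂ ∨ v ∈ (F.g i).x₂₃ ∨ v ∈ (F.g i).o₃)} := by
      rintro v (hv | hv | hv | hv)
      · simp [L.mem_left (v := v) (by simp [Gadget.all, hv]), (F.g i).notMem_of_mem_i₀ hv]
      · simp [L.mem_left (v := v) (by simp [Gadget.all, hv]), (F.g i).notMem_of_mem_x₀₁ hv]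
      · simp [L.mem_left (v := v) (by simp [Gadget.all, hv]), (F.g i).notMem_of_mem_x₁₂ hv]
      · simp [L.mem_left (v := v) (by simp [Gadget.all, hv]), (F.g i).notMem_of_mem_o₁ hv]
    have h₂ : ∀ v, v = s₀ ∨ v ∈ (F.g i).i₀ ∨ v ∈ (F.g i).x₀₁ ∨ v ∈ (F.g i).o₁ →
        v ∈ {v ∈ U | ¬ (v = s₂ ∨ v = t₃ ∨ v ∈ (F.g i).i₂ ∨ v ∈ (F.g i).x₂₃ ∨ v ∈ (F.g i).o₃)} := by
      rintro v (rfl | hv | hv | hv)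
      · exact h₀
      · exact h₁ v (.inl hv)
      · exact h₁ v (.inr (.inl hv))
      · exact h₁ v (.inr (.inr (.inr hv)))
    rcases hu with hu | hu | hu
    · exact (F.g i).reachIn_x₀₁ h₂ (.inl hu)
    · refine (F.g i).reachIn_x₁₂ ?_ hu
      rintro v (rfl | hv | hv | hv)
      · exact h₀
      · exact h₁ v (.inl hv)
      · exact h₁ v (.inr (.inl hv))
      · exact h₁ v (.inr (.inr (.inl hv)))
    · exact (F.g i).reachIn_x₀₁ h₂ (.inr hu)

/-- The three preceding cases and their images under exchanging sources and sinks cover all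
positions of u and e. -/
theorem false_of_mem (L : Link F i j k U W u h e) (hu : u ∈ (F.g i).all)
    (he : e ∈ (F.g j).all) : False := by
  simp only [Gadget.all, List.mem_append] at hu he
  by_cases h0 : u ∈ (F.g i).i₀
  · exact L.false_of_i₀ h0 (by simp only [Gadget.Tgt]; tauto)
  by_cases h2 : u ∈ (F.g i).i₂
  · refine L.swap.false_of_i₀ h2 ?_
    simp only [Gadget.Tgt, Frame.swap, Gadget.swap]; tauto
  have hu' : (F.g i).Src u := by simp only [Gadget.Src]; tauto
  by_cases h1 : e ∈ (F.g j).o₁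
  · exact L.false_of_src_o₁ hu' h1
  by_cases h3 : e ∈ (F.g j).o₃
  · exact L.swap.false_of_src_o₁ ((F.g i).src_swap.2 hu') h3
  have he' : (F.g j).Tgt e := by simp only [Gadget.Tgt]; tauto
  rcases hu' with h | h | h | h | h | h
  · exact L.false_of_x₀₁_tgt (.inl h) he'
  · exact L.false_of_x₀₁_tgt (.inr (.inl h)) he'
  · exact L.swap.false_of_x₀₁_tgt (.inl h) ((F.g j).tgt_swap.2 he')
  · exact L.swap.false_of_x₀₁_tgt (.inr (.inl h)) ((F.g j).tgt_swap.2 he')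
  · exact L.false_of_x₀₁_tgt (.inr (.inr h)) he'
  · exact L.swap.false_of_x₀₁_tgt (.inr (.inr h)) ((F.g j).tgt_swap.2 he')

end Link

end Frame
end DigraphLinkage

/-! ### No directed path between different circuits -/

namespace DigraphLinkage

variable {V : Type*} {r : V → V → Prop} {s₀ s₂ t₁ t₃ : V}

theorem ReachIn.of_reach {p q : V} (h : Relation.ReflTransGen r p q) :
    ReachIn r {v | Relation.ReflTransGen r p v ∧ Relation.ReflTransGen r v q} p q := by
  refine ⟨⟨.refl, h⟩, ?_⟩
  induction h with
  | refl => exact .refl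
  | tail hab hbc ih =>
    refine (Relation.ReflTransGen.mono (fun x y h => ⟨h.1, h.2.1, h.2.2.tail hbc⟩) _ _ ih).tail
      ⟨hbc, hab.tail hbc, .refl⟩

theorem Gadget.src_or_tgt (g : Gadget r s₀ s₂ t₁ t₃) {v : V} (hv : v ∈ g.all) :
    g.Src v ∨ g.Tgt v := by
  simp only [Gadget.all, List.mem_append, Gadget.Src, Gadget.Tgt] at *; tauto

namespace Frame

variable (F : Frame r s₀ s₂ t₁ t₃)

theorem index_eq {i j : Fin 3} {v : V} (hi : v ∈ (F.g i).all) (hj : v ∈ (F.g j).all) : i = j := by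
  by_contra h
  exact F.disj i j h v hi hj

/-- A shortest path between different gadgets that leads from a circuit or an outgoing leg to a
circuit or an incoming leg. -/
theorem exists_shortest {i j : Fin 3} (hij : i ≠ j) {p q : V} (hp : (F.g i).Src p)
    (hq : (F.g j).Tgt q) (h : Relation.ReflTransGen r p q) :
    ∃ i j p q l, i ≠ j ∧ (F.g i).Src p ∧ (F.g j).Tgt q ∧ List.IsChain r (p :: (l ++ [q])) ∧
      (p :: (l ++ [q])).Nodup ∧ ∀ i' j' x y a m b, i' ≠ j' → (F.g i').Src x → (F.g j').Tgt y →
        p :: (l ++ [q]) = a ++ (x :: (m ++ [y]) ++ b) → a = [] ∧ b = [] := by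
  classical
  let S : Set ℕ := {n | ∃ i j p q l, i ≠ j ∧ (F.g i).Src p ∧ (F.g j).Tgt q ∧
    List.IsChain r (p :: (l ++ [q])) ∧ (p :: (l ++ [q])).Nodup ∧ l.length = n}
  have hS : ∃ n, n ∈ S := by
    obtain ⟨l, hl⟩ := (ReachIn.of_reach h).exists_isChain_of_ne
      (fun e => hij (F.index_eq ((F.g i).src_mem_all hp) ((F.g j).tgt_mem_all (e ▸ hq))))
    exact ⟨_, i, j, p, q, l, hij, hp, hq, hl.1, hl.2.1, rfl⟩
  obtain ⟨i, j, p, q, l, h1, h2, h3, h4, h5, h6⟩ := Nat.find_spec hS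
  refine ⟨i, j, p, q, l, h1, h2, h3, h4, h5, fun i' j' x y a m b hij' hx hy e => ?_⟩
  have hc := h4
  have hn := h5
  rw [e] at hc hn
  have := Nat.find_min' hS ⟨i', j', x, y, m, hij', hx, hy, hc.right_of_append.left_of_append,
    hn.of_append_right.of_append_left, rfl⟩
  rw [← h6] at this
  have e' := congrArg List.length e
  simp only [List.length_cons, List.length_append, List.length_nil] at e'
  exact ⟨List.length_eq_zero_iff.1 (by omega), List.length_eq_zero_iff.1 (by omega)⟩

/-- A shortest path over all choices of gadgets and ends misses the third gadget. Cutting it where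
it first enters the j-th gadget, and looking back to its last vertex in the i-th one, produces a
`Link`, which is contradictory. -/
theorem not_reach {i j : Fin 3} (hij : i ≠ j) {p q : V} (hp : (F.g i).Src p)
    (hq : (F.g j).Tgt q) : ¬ Relation.ReflTransGen r p q := by
  intro h
  obtain ⟨i, j, p, q, l, hij, hp, hq, hc, hn, hmin⟩ := F.exists_shortest hij hp hq h
  clear h
  obtain ⟨k, hik, hjk⟩ : ∃ k, i ≠ k ∧ j ≠ k :=
    (by decide : ∀ i j : Fin 3, ∃ k, i ≠ k ∧ j ≠ k) i j
  have hpi := (F.g i).src_mem_all hp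
  have hqj := (F.g j).tgt_mem_all hq
  -- By minimality a vertex on the path from a circuit or outgoing leg outside the j-th gadget can
  -- only be the start; dually for the end in the next claim.
  have hsrc : ∀ k, k ≠ j → ∀ v ∈ p :: (l ++ [q]), (F.g k).Src v → v = p := by
    intro k hk v hv hvk
    rcases List.mem_cons.1 hv with h | hv
    · exact h
    · rcases List.mem_append.1 hv with hv | hv
      · obtain ⟨s, t, rfl⟩ := List.append_of_mem hv
        exact absurd (hmin k j v q (p :: s) t [] hk hvk hq (by simp)).1 (by simp)
      · obtain rfl := List.mem_singleton.1 hv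
        exact absurd (F.index_eq ((F.g k).src_mem_all hvk) hqj) hk
  have htgt : ∀ k, i ≠ k → ∀ v ∈ p :: (l ++ [q]), (F.g k).Tgt v → v = q := by
    intro k hk v hv hvk
    rcases List.mem_cons.1 hv with rfl | hv
    · exact absurd (F.index_eq hpi ((F.g k).tgt_mem_all hvk)) hk
    · rcases List.mem_append.1 hv with hv | hv
      · obtain ⟨s, t, rfl⟩ := List.append_of_mem hv
        exact absurd (hmin i k p v [] s (t ++ [q]) hk hp hvk (by simp)).2 (by simp)
      · exact List.mem_singleton.1 hv
  -- The path becomes `A ++ [u] ++ n ++ e :: B`: e is its first vertex in the j-th gadget, u its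
  -- last vertex in the i-th gadget before e.
  obtain ⟨L₁, L₂, hL, hL₁, hL₂⟩ := exists_split_first (· ∈ (F.g j).all) (p :: (l ++ [q]))
  obtain ⟨e, B, rfl, he⟩ : ∃ e B, L₂ = e :: B ∧ e ∈ (F.g j).all := by
    refine hL₂.resolve_left fun h => ?_
    subst h
    exact hL₁ q (by simp only [List.append_nil] at hL; simp [← hL]) hqj
  obtain ⟨L₁', rfl⟩ : ∃ L', L₁ = p :: L' := by
    rcases L₁ with _ | ⟨a, L'⟩
    · simp only [List.nil_append, List.cons.injEq] at hL
      exact absurd (F.index_eq hpi (hL.1 ▸ he)) hij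
    · simp only [List.cons_append, List.cons.injEq] at hL
      exact ⟨L', by rw [hL.1]⟩
  obtain ⟨A, n, hA, hnA, hA'⟩ := exists_split_last (· ∈ (F.g i).all) (p :: L₁')
  obtain ⟨A, u, rfl, hu⟩ : ∃ A' u, A = A' ++ [u] ∧ u ∈ (F.g i).all := by
    refine hA'.resolve_left fun h => ?_
    subst h
    simp only [List.nil_append] at hA
    exact hnA p (by simp [← hA]) hpi
  obtain ⟨B', hB'⟩ : ∃ B', e :: B = B' ++ [q] := by
    have := congrArg List.getLast? hL
    rw [List.getLast?_append_cons] at this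
    have h2 : (e :: B).getLast? = some q := by
      rw [← this, ← List.cons_append, List.getLast?_append]; simp
    exact ⟨(e :: B).dropLast, (List.dropLast_append_getLast? q h2).symm⟩
  rw [hA] at hL
  have hmem : ∀ v, v ∈ p :: (l ++ [q]) ↔ v ∈ A ++ [u] ∨ v ∈ n ∨ v ∈ e :: B := by
    intro v; rw [hL, List.mem_append, List.mem_append]; tauto
  have hjn : ∀ v, v ∈ A ++ [u] ∨ v ∈ n → v ∉ (F.g j).all := by
    intro v hv
    exact hL₁ v (by rw [hA]; exact List.mem_append.2 hv)
  have hc' := hc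
  rw [hL] at hc'
  have hn' := hn
  rw [hL] at hn'
  have hd : ∀ v, v ∈ A ++ [u] ∨ v ∈ n → v ∉ e :: B := fun v hv hv' =>
    (List.nodup_append.1 hn').2.2 v (List.mem_append.2 hv) v hv' rfl
  have hpB : p ∉ e :: B := hd p (List.mem_append.1 (by rw [← hA]; simp))
  have hqA : ∀ v, v ∈ A ++ [u] ∨ v ∈ n → v ≠ q := fun v hv h =>
    hjn v hv (h ▸ hqj)
  have hk : ∀ v ∈ p :: (l ++ [q]), v ∉ (F.g k).all := by
    intro v hv hvk
    rcases (F.g k).src_or_tgt hvk with h | h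
    · exact hik (F.index_eq hpi (hsrc k hjk.symm v hv h ▸ hvk))
    · exact hjk (F.index_eq hqj (htgt k hik v hv h ▸ hvk))
  -- The path cannot return to the i-th gadget after e. A return to a source vertex would repeat p.
  -- For a return to a target vertex, either e is a source vertex, and the piece from e on is a
  -- shorter path between gadgets, or e is a target vertex and hence already the end q.
  have hi : ∀ v ∈ e :: B, v ∉ (F.g i).all := by
    intro v hv hvi
    have hvL := (hmem v).2 (.inr (.inr hv))
    have hve : v ≠ e := fun h => hij (F.index_eq hvi (h ▸ he))
    rcases (F.g i).src_or_tgt hvi with h | h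
    · exact hpB (hsrc i hij v hvL h ▸ hv)
    · rcases (F.g j).src_or_tgt he with h' | h'
      · obtain ⟨s, t, hst⟩ := List.append_of_mem ((List.mem_cons.1 hv).resolve_left hve)
        have := (hmin j i e v (A ++ [u] ++ n) s t hij.symm h' h (by rw [hL, hst]; simp)).1
        simp at this
      · have heq := htgt j hij e ((hmem e).2 (.inr (.inr (by simp)))) h'
        rcases B' with _ | ⟨b, B'⟩
        · simp only [List.nil_append, List.cons.injEq] at hB'
          exact hve (by simpa [hB'.2] using hv)
        · have hnB := hn'.of_append_right
          rw [hB'] at hnB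
          simp only [List.cons_append, List.cons.injEq] at hB'
          rw [← hB'.1, heq] at hnB
          simp at hnB
  have hnt : ∀ v ∈ p :: (l ++ [q]), v ≠ s₀ ∧ v ≠ s₂ ∧ v ≠ t₁ ∧ v ≠ t₃ := by
    intro v hv
    rcases List.mem_cons.1 hv with rfl | hv
    · exact F.not_mem i _ hpi
    · rcases List.mem_append.1 hv with hv | hv
      · obtain ⟨s, t, rfl⟩ := List.append_of_mem hv
        have h1 : List.IsChain r (v :: (t ++ [q])) := by
          have e' : p :: (s ++ v :: t ++ [q]) = (p :: s) ++ (v :: (t ++ [q])) := by simp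
          rw [e'] at hc
          exact hc.right_of_append
        have h2 : List.IsChain r ((p :: s) ++ [v]) := by
          have e' : p :: (s ++ v :: t ++ [q]) = ((p :: s) ++ [v]) ++ (t ++ [q]) := by simp
          rw [e'] at hc
          exact hc.left_of_append
        obtain ⟨w, hw⟩ : ∃ w, r v w := by
          rcases t with _ | ⟨b, t⟩
          · exact ⟨q, by simpa using h1⟩
          · exact ⟨b, by
              rw [List.cons_append, List.isChain_cons_cons] at h1; exact h1.1⟩
        obtain ⟨w', hw'⟩ : ∃ w, r w v := by
          rcases s.eq_nil_or_concat with rfl | ⟨s, b, rfl⟩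
          · exact ⟨p, by simpa using h2⟩
          · refine ⟨b, ?_⟩
            rw [List.concat_eq_append] at h2
            have e' : p :: (s ++ [b]) ++ [v] = (p :: s) ++ [b, v] := by simp
            rw [e'] at h2
            simpa using h2.right_of_append
        exact ⟨(F.ne_of_rel hw').2.2.1, (F.ne_of_rel hw').2.2.2, (F.ne_of_rel hw).1,
          (F.ne_of_rel hw).2.1⟩
      · obtain rfl := List.mem_singleton.1 hv
        exact F.not_mem j _ hqj
  obtain ⟨h, hh, hre⟩ : ∃ h, (u :: n).getLast? = some h ∧ r h e := by
    refine ⟨(u :: n).getLast (by simp), List.getLast?_eq_some_getLast _, ?_⟩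
    have e' : A ++ [u] ++ n ++ e :: B = A ++ ((u :: n).dropLast ++
        ([(u :: n).getLast (by simp), e] ++ B)) := by
      conv_lhs => rw [List.append_assoc A, List.singleton_append,
        ← List.dropLast_append_getLast (l := u :: n) (by simp)]
      simp
    rw [e'] at hc'
    simpa using hc'.right_of_append.right_of_append.left_of_append
  have ht := F.terminals_ne
  have hun : List.IsChain r (u :: n) := by
    have := hc'.left_of_append
    rw [List.append_assoc] at this
    exact this.right_of_append
  let U : Set V := {v | v ∈ (F.g i).all ∨ v = s₀ ∨ v = s₂ ∨ v ∈ A ++ [u] ∨ v ∈ n}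
  let W : Set V := {v | v ∈ (F.g j).all ∨ v = t₁ ∨ v = t₃ ∨ v ∈ e :: B}
  have Lk : Link F i j k U W u h e := by
    refine ⟨hij, hik, hjk, ?_, fun v hv => .inl hv, fun v hv => .inl hv, by simp [U], by simp [W],
      ?_, ?_, ?_, hre, ⟨p, hp, ?_⟩, ⟨q, hq, ?_⟩⟩
    · rw [Set.disjoint_left]
      rintro v hvU (hw | rfl | rfl | hw)
      · rcases hvU with hv | rfl | rfl | hv
        · exact hij (F.index_eq hv hw)
        · exact (F.not_mem j _ hw).1 rfl
        · exact (F.not_mem j _ hw).2.1 rfl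
        · exact hjn v hv hw
      · rcases hvU with hv | hv | hv | hv
        · exact (F.not_mem i _ hv).2.2.1 rfl
        · exact ht.2.1 hv.symm
        · exact ht.2.2.2.1 hv.symm
        · exact (hnt v ((hmem v).2 (by tauto))).2.2.1 rfl
      · rcases hvU with hv | hv | hv | hv
        · exact (F.not_mem i _ hv).2.2.2 rfl
        · exact ht.2.2.1 hv.symm
        · exact ht.2.2.2.2.1 hv.symm
        · exact (hnt v ((hmem v).2 (by tauto))).2.2.2 rfl
      · have hvL := hnt v ((hmem v).2 (.inr (.inr hw)))
        rcases hvU with hv | rfl | rfl | hv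
        · exact hi v hw hv
        · exact hvL.1 rfl
        · exact hvL.2.1 rfl
        · exact hd v hv hw
    · rintro v (hv | rfl | rfl | hv) hvk
      · exact hik (F.index_eq hv hvk)
      · exact (F.not_mem k _ hvk).1 rfl
      · exact (F.not_mem k _ hvk).2.1 rfl
      · exact hk v ((hmem v).2 (by tauto)) hvk
    · rintro v (hv | rfl | rfl | hv) hvk
      · exact hjk (F.index_eq hv hvk)
      · exact (F.not_mem k _ hvk).2.2.1 rfl
      · exact (F.not_mem k _ hvk).2.2.2 rfl
      · exact hk v ((hmem v).2 (by tauto)) hvk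
    · refine .of_isChain_cons hun ?_ (List.mem_of_getLast? hh)
      intro v hv
      rcases List.mem_cons.1 hv with rfl | hv
      · exact ⟨.inl hu, .inl rfl⟩
      · have hvL := (hmem v).2 (.inr (.inl hv))
        refine ⟨.inr (.inr (.inr (.inr hv))), .inr ⟨fun m hm => ?_, (hnt v hvL).1,
          (hnt v hvL).2.1⟩⟩
        have hmi : m ≠ i := fun h => hnA v hv (h ▸ hm)
        have hmj : m ≠ j := fun h => hjn v (.inr hv) (h ▸ hm)
        have hmk : m ≠ k := fun h => hk v hvL (h ▸ hm)
        revert hmi hmj hmk hij hik hjk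
        -- Only the three gadget indices matter now: a fourth one does not exist.
        clear * -
        revert i j k m; decide
    · have h1 : ∃ A', A ++ [u] = p :: A' := by
        rcases A with _ | ⟨a, A⟩
        · simp only [List.nil_append, List.cons_append, List.cons.injEq] at hA
          exact ⟨[], by rw [hA.1]; rfl⟩
        · simp only [List.cons_append, List.cons.injEq] at hA
          exact ⟨A ++ [u], by rw [hA.1]; rfl⟩
      obtain ⟨A', h1⟩ := h1
      have h2 := hc'.left_of_append.left_of_append
      rw [h1] at h2
      refine .of_isChain_cons h2 (fun v hv => ?_) (by rw [← h1]; simp)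
      rw [← h1] at hv
      exact .inr (.inr (.inr (.inl hv)))
    · exact .of_isChain_cons hc'.right_of_append (fun v hv => .inr (.inr (.inr hv)))
        (by rw [hB']; simp)
  exact Lk.false_of_mem hu he

theorem not_reach_hub {i j : Fin 3} (hij : i ≠ j) {p q : V}
    (hp : Relation.ReflTransGen r (F.g i).hub p) (hq : Relation.ReflTransGen r q (F.g j).hub) :
    ¬ Relation.ReflTransGen r p q := fun h =>
  F.not_reach hij (F.g i).src_hub (F.g j).tgt_hub ((hp.trans h).trans hq)

end Frame
end DigraphLinkage

/-! ### Each gadget lies in one strong component, closed under arcs -/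

namespace DigraphLinkage

variable {V : Type*} {r : V → V → Prop} {s₀ s₂ t₁ t₃ : V}

theorem Gadget.reachIn_hub_t₁ (g : Gadget r s₀ s₂ t₁ t₃) {Z : Set V}
    (hZ : ∀ v, v = t₁ ∨ v ∈ g.x₀₁ ∨ v ∈ g.o₁ → v ∈ Z) : ReachIn r Z g.hub t₁ := by
  have h := g.chain₀
  rw [← List.cons_append] at h
  have h' := h.right_of_append
  rw [← List.append_assoc] at h'
  exact .of_isChain_append h' (fun v hv => hZ v (by grind)) (by simp [g.hub_mem]) (by simp)

/-- The hub is the first circuit vertex met from s₀. Its predecessor is the end of the incoming leg,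
or s₀ itself if that leg has no inner vertices. -/
theorem Gadget.exists_rel_hub (g : Gadget r s₀ s₂ t₁ t₃) {Z : Set V}
    (hZ : ∀ v, v = s₀ ∨ v ∈ g.i₀ → v ∈ Z) :
    ∃ h, r h g.hub ∧ ReachIn r Z s₀ h ∧ ∀ x ∈ g.i₀, ReachIn r Z x h := by
  have hc := g.chain₀
  rw [g.x₀₁_eq] at hc
  have h1 : List.IsChain r (s₀ :: g.i₀) := by
    rw [← List.cons_append] at hc
    exact hc.left_of_append
  refine ⟨(s₀ :: g.i₀).getLast (by simp), ?_, ?_, ?_⟩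
  · have e : s₀ :: (g.i₀ ++ (g.hub :: g.x₀₁.tail ++ (g.o₁ ++ [t₁]))) = (s₀ :: g.i₀).dropLast ++
        ([(s₀ :: g.i₀).getLast (by simp), g.hub] ++ (g.x₀₁.tail ++ (g.o₁ ++ [t₁]))) := by
      conv_lhs => rw [← List.cons_append,
        ← List.dropLast_append_getLast (l := s₀ :: g.i₀) (by simp)]
      simp
    rw [e] at hc
    simpa using hc.right_of_append.left_of_append
  · exact .of_isChain_cons h1 (fun v hv => hZ v (by simpa using hv)) (List.getLast_mem _)
  · intro x hx
    obtain ⟨a, b, hab⟩ := List.append_of_mem hx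
    rw [hab] at h1
    have h2 : List.IsChain r (x :: b) := by
      rw [← List.cons_append] at h1; exact h1.right_of_append
    refine .of_isChain_cons h2 (fun v hv => hZ v (.inr (by rw [hab]; simp only [List.mem_append]; exact .inr hv))) ?_
    have : (s₀ :: g.i₀).getLast (by simp) = (x :: b).getLast (by simp) := by
      simp only [hab, ← List.cons_append]
      rw [List.getLast_append_of_right_ne_nil]
    rw [this]
    exact List.getLast_mem _

namespace Frame

variable (F : Frame r s₀ s₂ t₁ t₃)

/-- The first path runs from s₀ through the l-th gadget to t₁, the second from s₂ through the k-th
to t₃. The given jump is the early one, and the l-th circuit supplies the late one, from its hub to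
t₃. The arc (h, e) of the double jump is the one that enters the hub. -/
theorem false_of_jump {k l : Fin 3} {z x : V} (hz : z = s₂ ∨ z ∈ (F.g k).i₂)
    (hx : x ∈ (F.g l).i₀)
    (hj : ReachIn r {v | v = z ∨ v = x ∨
      (∀ m, v ∉ (F.g m).all) ∧ v ≠ s₀ ∧ v ≠ s₂ ∧ v ≠ t₁ ∧ v ≠ t₃} z x) : False := by
  have ht := F.terminals_ne
  let N : Set V := {v | (∀ m, v ∉ (F.g m).all) ∧ v ≠ s₀ ∧ v ≠ s₂ ∧ v ≠ t₁ ∧ v ≠ t₃}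
  let U : Set V := {v | v = s₀ ∨ v = s₂ ∨ v ∈ (F.g l).i₀ ∨ v ∈ (F.g k).i₂ ∨ v ∈ N}
  let W : Set V := {v | v = t₁ ∨ v = t₃ ∨ v ∈ (F.g l).x₀₁ ∨ v ∈ (F.g l).x₁₂ ∨ v ∈ (F.g l).x₂₃ ∨
    v ∈ (F.g l).o₁ ∨ v ∈ (F.g l).o₃}
  have hU : ∀ v ∈ U, v = s₀ ∨ v = s₂ ∨ v ∈ (F.g l).all ∨ v ∈ (F.g k).all ∨ v ∈ N := by
    rintro v (h | h | h | h | h) <;> simp [h, Gadget.all]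
  have hW : ∀ v ∈ W, v = t₁ ∨ v = t₃ ∨ v ∈ (F.g l).all := by
    rintro v (h | h | h | h | h | h | h) <;> simp [h, Gadget.all]
  have hi₀ : ∀ v ∈ (F.g l).i₀, v ∈ (F.g l).all := fun v hv => by simp [Gadget.all, hv]
  have hi₂ : ∀ m, ∀ v ∈ (F.g m).i₂, v ∈ (F.g m).all := fun m v hv => by simp [Gadget.all, hv]
  have hUt : ∀ v ∈ U, v ≠ t₁ ∧ v ≠ t₃ := by
    intro v hv
    rcases hU v hv with rfl | rfl | h | h | h
    · exact ⟨ht.2.1, ht.2.2.1⟩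
    · exact ⟨ht.2.2.2.1, ht.2.2.2.2.1⟩
    · exact (F.not_mem _ _ h).2.2
    · exact (F.not_mem _ _ h).2.2
    · exact h.2.2.2
  have hUl : ∀ v ∈ U, v ∈ (F.g l).all → v ∈ (F.g l).i₀ ∨ v ∈ (F.g l).i₂ := by
    rintro v (rfl | rfl | h | h | h) hv
    · exact absurd rfl (F.not_mem _ _ hv).1
    · exact absurd rfl (F.not_mem _ _ hv).2.1
    · exact .inl h
    · exact .inr (F.index_eq hv (hi₂ k v h) ▸ h)
    · exact absurd hv (h.1 l)
  have hUW : Disjoint U W := by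
    rw [Set.disjoint_left]
    intro v hv hw
    have hv' : v ∈ (F.g l).all → False := fun h => by
      rcases hw with rfl | rfl | hw
      · exact (hUt _ hv).1 rfl
      · exact (hUt _ hv).2 rfl
      · rcases hUl v hv h with h' | h'
        · have := (F.g l).notMem_of_mem_i₀ h'
          tauto
        · have := (F.g l).swap.notMem_of_mem_i₀ h'
          simp only [Gadget.swap] at this
          tauto
    rcases hW v hw with rfl | rfl | h
    · exact (hUt _ hv).1 rfl
    · exact (hUt _ hv).2 rfl
    · exact hv' h
  have hUK : ∀ K, K ≠ l → K ≠ k → Disjoint U {v | v ∈ (F.g K).all} := by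
    intro K hl hk
    rw [Set.disjoint_left]
    intro v hv hvK
    have hvK : v ∈ (F.g K).all := hvK
    rcases hU v hv with rfl | rfl | h | h | h
    · exact (F.not_mem _ _ hvK).1 rfl
    · exact (F.not_mem _ _ hvK).2.1 rfl
    · exact hl (F.index_eq hvK h)
    · exact hk (F.index_eq hvK h)
    · exact h.1 K hvK
  have hWK : ∀ K, K ≠ l → Disjoint W {v | v ∈ (F.g K).all} := by
    intro K hl
    rw [Set.disjoint_left]
    intro v hv hvK
    have hvK : v ∈ (F.g K).all := hvK
    rcases hW v hv with rfl | rfl | h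
    · exact (F.not_mem _ _ hvK).2.2.1 rfl
    · exact (F.not_mem _ _ hvK).2.2.2 rfl
    · exact hl (F.index_eq hvK h)
  obtain ⟨h, hh, h0, hxh⟩ := (F.g l).exists_rel_hub (Z := {v | v = s₀ ∨ v ∈ (F.g l).i₀})
    (fun v hv => hv)
  have hU0 : {v | v = s₀ ∨ v ∈ (F.g l).i₀} ⊆ U := by
    rintro v (h | h) <;> simp [h, U]
  have hzx : ReachIn r U z x := by
    refine hj.mono ?_
    rintro v (rfl | rfl | h)
    · rcases hz with rfl | hz
      · exact .inr (.inl rfl)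
      · exact .inr (.inr (.inr (.inl hz)))
    · exact .inr (.inr (.inl hx))
    · exact .inr (.inr (.inr (.inr h)))
  have hzh := hzx.trans ((hxh x hx).mono hU0)
  have hsz : ReachIn r U s₂ h := by
    refine ReachIn.trans ?_ hzh
    rcases hz with rfl | hz
    · exact .refl (.inr (.inl rfl))
    · refine (F.g k).swap.reachIn_i₀ ?_ hz
      rintro v (h | h)
      · exact .inr (.inl h)
      · exact .inr (.inr (.inr (.inl h)))
  have het : ReachIn r W (F.g l).hub t₃ := by
    refine ReachIn.trans (q := (F.g l).x₂₃.head (F.g l).ne₂₃) ?_ ((F.g l).swap.reachIn_hub_t₁ ?_)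
    · have hc := (F.g l).link₀₂
      refine .of_isChain_append hc (fun v hv => ?_) (F.g l).hub_mem (by simp)
      simp only [List.mem_append] at hv
      simp only [W, Set.mem_ofPred_eq]; tauto
    · intro v hv
      simp only [Gadget.swap] at hv
      simp only [W, Set.mem_ofPred_eq]; tauto
  have hs₂ : ∀ m, s₂ ∉ (F.g m).all := fun m hm => (F.not_mem m _ hm).2.1 rfl
  have ht₃ : ∀ m, t₃ ∉ (F.g m).all := fun m hm => (F.not_mem m _ hm).2.2.2 rfl
  have hnd : ∀ m, (s₂ :: ((F.g m).i₂ ++ ((F.g m).x₂₃ ++ ((F.g m).o₃ ++ [t₃])))).Nodup := by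
    intro m
    have h1 := hs₂ m
    have h2 := ht₃ m
    have h3 := (F.g m).nodup
    simp only [Gadget.all, List.mem_append, not_or] at h1 h2
    simp only [List.nodup_append, List.mem_append] at h3
    have h4 := ht.2.2.2.2.1
    have h5 : ((F.g m).i₂ ++ ((F.g m).x₂₃ ++ (F.g m).o₃)).Nodup := by
      simp only [List.nodup_append, List.mem_append]
      grind
    have e : (F.g m).i₂ ++ ((F.g m).x₂₃ ++ ((F.g m).o₃ ++ [t₃])) =
      ((F.g m).i₂ ++ ((F.g m).x₂₃ ++ (F.g m).o₃)) ++ [t₃] := by simp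
    rw [List.nodup_cons, e]
    refine ⟨by simp [h1, h4], List.nodup_append.2 ⟨h5, by simp, ?_⟩⟩
    intro a ha b hb
    obtain rfl := List.mem_singleton.1 hb
    rintro rfl
    simp [h2] at ha
  have hah : ∀ m, ReachIn r {v ∈ U | v ∉ s₂ :: (F.g m).i₂} s₀ h := by
    intro m
    refine h0.mono ?_
    intro v hv
    refine ⟨hU0 hv, ?_⟩
    rcases hv with rfl | hv
    · simp only [List.mem_cons, not_or]
      exact ⟨ht.1, fun h => (F.not_mem m _ (hi₂ m _ h)).1 rfl⟩
    · simp only [List.mem_cons, not_or]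
      refine ⟨(F.not_mem l _ (hi₀ v hv)).2.1, fun h => ?_⟩
      have hm := F.index_eq (hi₀ v hv) (hi₂ m _ h)
      subst hm
      exact ((F.g l).notMem_of_mem_i₀ hv).2.2.2.1 h
  -- If k = l, the part of the second path after its incoming leg lies in W. Otherwise it is
  -- disjoint from both U and W except for t₃, and forms the middle part of the second path.
  by_cases hkl : k = l
  · subst hkl
    obtain ⟨K, hK⟩ := (by decide : ∀ i : Fin 3, ∃ k, k ≠ i) k
    refine F.noJump K s₀ s₂ t₁ t₃ (by simp) (by simp) ⟨U, W, h, (F.g k).hub, (F.g k).i₂, [],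
      (F.g k).x₂₃ ++ (F.g k).o₃, hUW, hUK K hK hK, hWK K hK, ?_, ?_, ?_, ?_, by simp, hah k, hh,
      ?_, hsz, het⟩
    · simpa using (F.g k).chain₂
    · simpa using hnd k
    · intro v hv
      rcases List.mem_cons.1 hv with rfl | hv <;> simp [U, *]
    · intro v hv
      simp only [List.mem_append, List.mem_singleton] at hv
      simp only [W, Set.mem_ofPred_eq]; tauto
    · refine (F.g k).reachIn_hub_t₁ ?_
      intro v hv
      refine ⟨by simp only [W, Set.mem_ofPred_eq]; tauto, ?_⟩
      simp only [List.mem_append, List.mem_singleton, not_or]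
      rcases hv with rfl | hv | hv
      · have : v ∉ (F.g k).all := fun h => (F.not_mem k v h).2.2.1 rfl
        simp only [Gadget.all, List.mem_append, not_or] at this
        exact ⟨⟨this.2.2.2.2.2.1, this.2.2.2.2.2.2.1⟩, ht.2.2.2.2.2⟩
      · have := (F.g k).notMem_of_mem_x₀₁ hv
        exact ⟨⟨this.2.2.2.2.1, this.2.2.2.2.2.1⟩,
          (F.not_mem k v (by simp [Gadget.all, hv])).2.2.2⟩
      · have := (F.g k).notMem_of_mem_o₁ hv
        exact ⟨⟨this.2.2.2.2.1, this.2.2.2.2.2.1⟩,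
          (F.not_mem k v (by simp [Gadget.all, hv])).2.2.2⟩
  · obtain ⟨K, hK, hK'⟩ := (by decide : ∀ i j : Fin 3, ∃ k, k ≠ i ∧ k ≠ j) k l
    refine F.noJump K s₀ s₂ t₁ t₃ (by simp) (by simp) ⟨U, W, h, (F.g l).hub, (F.g k).i₂,
      (F.g k).x₂₃ ++ (F.g k).o₃, [], hUW, hUK K hK' hK, hWK K hK', ?_, ?_, ?_, ?_, ?_, hah k, hh,
      ?_, hsz, het⟩
    · simpa using (F.g k).chain₂
    · simpa using hnd k
    · intro v hv
      rcases List.mem_cons.1 hv with rfl | hv <;> simp [U, *]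
    · simp [W]
    · intro v hv
      have hvk : v ∈ (F.g k).all := by
        simp only [Gadget.all, List.mem_append] at hv ⊢; tauto
      refine ⟨?_, ?_, fun h => hK (F.index_eq h hvk)⟩
      · rintro (h | h | h | h | h)
        · exact (F.not_mem _ _ hvk).1 h
        · exact (F.not_mem _ _ hvk).2.1 h
        · exact hkl (F.index_eq hvk (hi₀ v h))
        · have := (F.g k).swap.notMem_of_mem_i₀ h
          simp only [Gadget.swap] at this
          simp only [List.mem_append] at hv
          tauto
        · exact h.1 k hvk
      · intro h
        rcases hW v h with h | h | h
        · exact (F.not_mem _ _ hvk).2.2.1 h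
        · exact (F.not_mem _ _ hvk).2.2.2 h
        · exact hkl (F.index_eq hvk h)
    · refine (F.g l).reachIn_hub_t₁ ?_
      intro v hv
      refine ⟨by simp only [W, Set.mem_ofPred_eq]; tauto, ?_⟩
      simp only [List.nil_append, List.mem_singleton]
      rcases hv with rfl | hv | hv
      · exact ht.2.2.2.2.2
      · exact (F.not_mem l v (by simp [Gadget.all, hv])).2.2.2
      · exact (F.not_mem l v (by simp [Gadget.all, hv])).2.2.2

theorem reach_hub {i : Fin 3} {v : V} (hv : (F.g i).Tgt v) :
    Relation.ReflTransGen r v (F.g i).hub :=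
  ((F.g i).reachIn_hub (Z := Set.univ) (by simp) (.inr (.inr hv)) (Set.mem_univ _)).reach

theorem hub_reach {i : Fin 3} {v : V} (hv : (F.g i).Src v) :
    Relation.ReflTransGen r (F.g i).hub v :=
  ((F.g i).reachIn_of_hub (Z := Set.univ) (by simp) (.inr (.inr hv)) (Set.mem_univ _)).reach

/-- If the circuit does not reach h, then no hub does, so a path from s₂ to h avoids all circuits
and outgoing legs. A piece of it leads from s₂ or some `i₂` to some `i₀` and is otherwise outside
the gadgets, which `false_of_jump` excludes. -/
theorem hub_reach_i₀ {i : Fin 3} {h : V} (hh : h ∈ (F.g i).i₀) :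
    Relation.ReflTransGen r (F.g i).hub h := by
  by_contra hn
  have hall : h ∈ (F.g i).all := by simp [Gadget.all, hh]
  have hk : ∀ k, ¬ Relation.ReflTransGen r (F.g k).hub h := by
    intro k hk
    by_cases hki : k = i
    · exact hn (hki ▸ hk)
    · exact F.not_reach hki (F.g k).src_hub (q := h) (by simp [Gadget.Tgt, hh]) hk
  -- The jump is taken among the vertices that reach h, so that none of its vertices can be reached
  -- from a hub.
  obtain ⟨z, x, l, hz, hx, hc, -, hU, hl⟩ := exists_jump
    (P := fun v => v = s₂ ∨ ∃ k, v ∈ (F.g k).i₂) (Q := fun v => ∃ l, v ∈ (F.g l).i₀)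
    (ReachIn.of_reach_right (F.reach₂ h (F.mem_N i h hall))) (.inl rfl) ⟨i, hh⟩ (by
      rintro v (rfl | ⟨k, hk⟩) ⟨l, hl⟩
      · exact (F.not_mem l _ (by simp [Gadget.all, hl])).2.1 rfl
      · have := F.index_eq (i := l) (j := k) (v := v) (by simp [Gadget.all, hl])
          (by simp [Gadget.all, hk])
        subst this
        exact ((F.g l).notMem_of_mem_i₀ hl).2.2.2.1 hk)
  obtain ⟨m, hx⟩ := hx
  have hj : ReachIn r {v | v = z ∨ v = x ∨
      (∀ m, v ∉ (F.g m).all) ∧ v ≠ s₀ ∧ v ≠ s₂ ∧ v ≠ t₁ ∧ v ≠ t₃} z x := by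
    refine .of_isChain_cons hc ?_ (by simp)
    intro v hv
    have hvh : Relation.ReflTransGen r v h := hU v hv
    rcases List.mem_cons.1 hv with rfl | hv
    · exact .inl rfl
    rcases List.mem_append.1 hv with hv | hv
    · have hlv := hl v hv
      refine .inr (.inr ⟨fun m hm => ?_, ?_, fun e => hlv.1 (.inl e), ?_, ?_⟩)
      · by_cases hs : (F.g m).Src v
        · exact hk m ((F.hub_reach hs).trans hvh)
        · simp only [Gadget.all, List.mem_append, Gadget.Src, not_or] at hm hs
          rcases hm with h | h | h | h | h | h | h | h
          · exact hlv.2 ⟨m, h⟩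
          · tauto
          · tauto
          · tauto
          · exact hlv.1 (.inr ⟨m, h⟩)
          · tauto
          · tauto
          · tauto
      · rintro rfl
        obtain ⟨s, t, rfl⟩ := List.append_of_mem hv
        have e' : z :: (s ++ v :: t ++ [x]) = (z :: s ++ [v]) ++ (t ++ [x]) := by simp
        rw [e'] at hc
        have hzv := ReachIn.of_isChain_cons (U := Set.univ) hc.left_of_append (by simp)
          (q := v) (by simp)
        rcases Relation.ReflTransGen.cases_tail hzv.reach with h | ⟨w, -, hw⟩
        · subst h
          rcases hz with h | ⟨k, h⟩
          · exact F.terminals_ne.1 h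
          · exact (F.not_mem k _ (by simp [Gadget.all, h])).1 rfl
        · exact F.not_in₀ w hw
      · rintro rfl
        rcases Relation.ReflTransGen.cases_head hvh with h | ⟨w, hw, -⟩
        · exact (F.not_mem i _ hall).2.2.1 h.symm
        · exact F.not_out₁ w hw
      · rintro rfl
        rcases Relation.ReflTransGen.cases_head hvh with h | ⟨w, hw, -⟩
        · exact (F.not_mem i _ hall).2.2.2 h.symm
        · exact F.not_out₃ w hw
    · exact .inr (.inl (List.mem_singleton.1 hv))
  rcases hz with rfl | ⟨k, hz⟩
  · exact F.false_of_jump (k := m) (.inl rfl) hx hj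
  · exact F.false_of_jump (.inr hz) hx hj

theorem flip_reach {p q : V} (h : Relation.ReflTransGen (flip r) p q) :
    Relation.ReflTransGen r q p :=
  (ReachIn.of_reach_left h).flip.reach

theorem hub_reach_all {i : Fin 3} {v : V} (hv : v ∈ (F.g i).all) :
    Relation.ReflTransGen r (F.g i).hub v := by
  by_cases hs : (F.g i).Src v
  · exact F.hub_reach hs
  by_cases h0 : v ∈ (F.g i).i₀
  · exact F.hub_reach_i₀ h0
  · have h2 : v ∈ (F.g i).i₂ := by
      simp only [Gadget.all, Gadget.Src, List.mem_append] at *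
      tauto
    refine Relation.ReflTransGen.trans (F.hub_reach ?_) (F.swap.hub_reach_i₀ h2)
    exact .inr (.inr (.inl (List.head_mem (F.g i).ne₂₃)))

theorem all_reach_hub {i : Fin 3} {v : V} (hv : v ∈ (F.g i).all) :
    Relation.ReflTransGen r v (F.g i).hub := by
  have h := flip_reach (F.rev.hub_reach_all (i := i) ((F.g i).mem_all_rev.2 hv))
  -- Reversal gives a path to the hub of the reversed gadget, which is another vertex of `x₀₁` in
  -- general.
  refine h.trans (F.reach_hub (.inl ?_))
  have := (F.rev.g i).hub_mem
  simpa [Frame.rev] using this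

/-- The strong components of the gadgets are closed under outgoing arcs. -/
theorem out_strong {i : Fin 3} {h e : V} (h1 : Relation.ReflTransGen r (F.g i).hub h)
    (h2 : Relation.ReflTransGen r h (F.g i).hub) (hhe : r h e) (hN : h ∈ F.N) (he : e ∈ F.N) :
    Relation.ReflTransGen r e (F.g i).hub := by
  by_contra hn
  have ht := F.terminals_ne
  obtain ⟨j, k, hij, hik, hjk⟩ := (by decide : ∀ i : Fin 3, ∃ j k, i ≠ j ∧ i ≠ k ∧ j ≠ k) i
  -- These sets are disjoint, since a common vertex would let e reach h and then the hub. They miss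
  -- the other two gadgets, since there is no path between different hubs.
  let U : Set V := {v | Relation.ReflTransGen r v h}
  let W : Set V := {v | Relation.ReflTransGen r e v}
  have hU : ∀ m, i ≠ m → ∀ v ∈ (F.g m).all, v ∉ U := fun m hm v hv hvU =>
    F.not_reach_hub hm.symm (F.hub_reach_all hv) h2 hvU
  have hW : ∀ m, i ≠ m → ∀ v ∈ (F.g m).all, v ∉ W := fun m hm v hv hvW =>
    F.not_reach_hub hm (h1.tail hhe) (F.all_reach_hub hv) hvW
  have hnd : (s₂ :: ([] ++ (((F.g j).i₂ ++ ((F.g j).x₂₃ ++ (F.g j).o₃)) ++ ([] ++ [t₃])))).Nodup := by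
    have h1 : s₂ ∉ (F.g j).all := fun hm => (F.not_mem j _ hm).2.1 rfl
    have h2 : t₃ ∉ (F.g j).all := fun hm => (F.not_mem j _ hm).2.2.2 rfl
    have h3 := (F.g j).nodup
    simp only [Gadget.all, List.mem_append, not_or] at h1 h2
    simp only [List.nodup_append, List.mem_append] at h3
    have h5 : ((F.g j).i₂ ++ ((F.g j).x₂₃ ++ (F.g j).o₃)).Nodup := by
      simp only [List.nodup_append, List.mem_append]
      grind
    rw [List.nil_append, List.nodup_cons]
    refine ⟨by simp [h1, ht.2.2.2.2.1], List.nodup_append.2 ⟨h5, by simp, ?_⟩⟩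
    intro a ha b hb
    obtain rfl := List.mem_singleton.1 hb
    rintro rfl
    simp [h2] at ha
  -- The second path consists of s₂, the straight way through the j-th gadget as middle part, and
  -- t₃. Both jumps exist because s₂ reaches h and e reaches t₃.
  refine F.noJump k s₀ s₂ t₁ t₃ (by simp) (by simp) ⟨U, W, h, e, [],
    (F.g j).i₂ ++ ((F.g j).x₂₃ ++ (F.g j).o₃), [], ?_, ?_, ?_, ?_, hnd, ?_, ?_, ?_, ?_, hhe, ?_,
    .of_reach_right (F.reach₂ h hN), .of_reach_left (F.reach₃ e he)⟩
  · rw [Set.disjoint_left]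
    intro v hv hw
    exact hn ((hw.trans hv).trans h2)
  · rw [Set.disjoint_left]
    exact fun v hv hk => hU k hik v hk hv
  · rw [Set.disjoint_left]
    exact fun v hv hk => hW k hik v hk hv
  · simpa using (F.g j).chain₂
  · intro v hv
    obtain rfl := List.mem_singleton.1 hv
    exact F.reach₂ h hN
  · intro v hv
    obtain rfl : v = t₃ := by simpa using hv
    exact F.reach₃ e he
  · intro v hv
    have hvj : v ∈ (F.g j).all := by
      simp only [Gadget.all, List.mem_append] at hv ⊢; tauto
    exact ⟨hU j hij v hvj, hW j hij v hvj, fun hvk => hjk (F.index_eq hvj hvk)⟩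
  · refine (ReachIn.of_reach (F.reach₀ h hN)).mono ?_
    rintro v ⟨hv, hv'⟩
    refine ⟨hv', ?_⟩
    rw [List.mem_singleton]
    rintro rfl
    rcases Relation.ReflTransGen.cases_tail hv with h | ⟨w, -, hw⟩
    · exact ht.1 h.symm
    · exact F.not_in₂ w hw
  · refine (ReachIn.of_reach (F.reach₁ e he)).mono ?_
    rintro v ⟨hv, hv'⟩
    refine ⟨hv, ?_⟩
    rw [List.nil_append, List.mem_singleton]
    rintro rfl
    rcases Relation.ReflTransGen.cases_head hv' with h | ⟨w, hw, -⟩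
    · exact ht.2.2.2.2.2 h.symm
    · exact F.not_out₃ w hw

/-- The two hubs can be different vertices. Being strongly connected, they allow `out_strong` for
the reversed frame to be used for incoming arcs. -/
theorem rev_hub_reach (i : Fin 3) : Relation.ReflTransGen r (F.g i).hub (F.rev.g i).hub ∧
    Relation.ReflTransGen r (F.rev.g i).hub (F.g i).hub := by
  have h : (F.rev.g i).hub ∈ (F.g i).all :=
    (F.g i).mem_all_rev.1 ((F.rev.g i).src_mem_all (F.rev.g i).src_hub)
  exact ⟨F.hub_reach_all h, F.all_reach_hub h⟩

/-- Different gadgets belong to different components. -/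
theorem eq_of_reach {i j : Fin 3} {u v : V} (hu : u ∈ (F.g i).all) (hv : v ∈ (F.g j).all)
    (h : Relation.ReflTransGen (fun x y => (r x y ∨ r y x) ∧ y ∈ F.N) u v) : i = j := by
  -- Being in the strong component of the hub is preserved along each arc in N, in whichever
  -- direction the arc is traversed.
  have key : v ∈ F.N ∧ Relation.ReflTransGen r (F.g i).hub v ∧
      Relation.ReflTransGen r v (F.g i).hub := by
    clear hv
    induction h with
    | refl => exact ⟨F.mem_N i u hu, F.hub_reach_all hu, F.all_reach_hub hu⟩
    | @tail b c _ hbc ih =>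
      obtain ⟨hb, h1, h2⟩ := ih
      obtain ⟨hbc | hcb, hc⟩ := hbc
      · exact ⟨hc, h1.tail hbc, F.out_strong h1 h2 hbc hb hc⟩
      · refine ⟨hc, ?_, h2.head hcb⟩
        have h3 := (F.rev_hub_reach i)
        have := F.rev.out_strong (i := i) (h := b) (e := c)
          (ReachIn.of_reach_left (h2.trans h3.1)).flip.reach
          (ReachIn.of_reach_left (h3.2.trans h1)).flip.reach hcb hb hc
        exact h3.1.trans (flip_reach this)
  by_contra hij
  exact F.not_reach_hub hij key.2.1 (F.all_reach_hub hv) .refl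

end Frame
end DigraphLinkage

/-! ### Models of complete bipartite graphs and matchings, in terms of lists -/

namespace SimpleGraph

variable {V : Type*} {G : SimpleGraph V}

theorem exists_walk_of_isChain {u v : V} {l : List V} (h : List.IsChain G.Adj (u :: (l ++ [v]))) :
    ∃ p : G.Walk u v, p.support = u :: (l ++ [v]) := by
  induction l generalizing u with
  | nil =>
    have h' : G.Adj u v := by simpa using h
    exact ⟨.cons h' .nil, by simp⟩
  | cons a l ih =>
    rw [List.cons_append, List.isChain_cons_cons] at h
    obtain ⟨p, hp⟩ := ih h.2
    exact ⟨.cons h.1 p, by simp [hp]⟩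

theorem nodup_of_sum_count_le_one {ι : Type*} [Fintype ι] [DecidableEq V] {f : ι → List V}
    (h : ∀ v, ∑ x, (f x).count v ≤ 1) : (∀ x, (f x).Nodup) ∧
      ∀ x y v, v ∈ f x → v ∈ f y → x = y := by
  classical
  refine ⟨fun x => List.nodup_iff_count_le_one.2 fun v =>
    (Finset.single_le_sum (f := fun x => (f x).count v) (by simp) (Finset.mem_univ x)).trans (h v),
    fun x y v hx hy => ?_⟩
  by_contra hxy
  have h1 := Finset.sum_le_sum_of_subset (f := fun x => (f x).count v)
    (Finset.subset_univ ({x, y} : Finset ι))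
  rw [Finset.sum_pair hxy] at h1
  have h2 := h v
  have h3 := List.count_pos_iff.2 hx
  have h4 := List.count_pos_iff.2 hy
  omega

/-- The paths of a subdivision of a complete bipartite graph. -/
def subdivisionPath {I J : Type*} {α : I → V} {β : J → V}
    (P : ∀ i j, G.Walk (α i) (β j)) : ∀ {w w' : I ⊕ J}, (completeBipartiteGraph I J).Adj w w' →
      G.Walk (Sum.elim α β w) (Sum.elim α β w')
  | .inl i, .inr j, _ => P i j
  | .inr j, .inl i, _ => (P i j).reverse
  | .inl _, .inl _, h => absurd h (by simp)
  | .inr _, .inr _, h => absurd h (by simp)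

/-- Injectivity and disjointness are packed into one bound on multiplicities, so that in the
application they can be checked by counting and linear arithmetic. -/
theorem containsGraph_completeBipartiteGraph {I J : Type*} [Fintype I] [Fintype J]
    [DecidableEq V] (α : I → V) (β : J → V) (q : I → J → List V)
    (hchain : ∀ i j, List.IsChain G.Adj (α i :: (q i j ++ [β j])))
    (heven : ∀ i j, Even (q i j).length)
    (hcount : ∀ v, ∑ x : I ⊕ J ⊕ I × J, (Sum.elim (fun i => [α i])
      (Sum.elim (fun j => [β j]) fun x => q x.1 x.2) x).count v ≤ 1)
    (hcentral : ∃ M : G.Subgraph, M.IsMatching ∧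
      M.verts = {v | (∃ i, v = α i) ∨ (∃ j, v = β j) ∨ ∃ i j, v ∈ q i j}ᶜ) :
    ContainsGraph G (completeBipartiteGraph I J) := by
  obtain ⟨hn, hd⟩ := nodup_of_sum_count_le_one hcount
  have hα : Function.Injective α := fun i i' h => by
    simpa using hd (.inl i) (.inl i') (α i) (by simp) (by simp [h])
  have hβ : Function.Injective β := fun i i' h => by
    simpa using hd (.inr (.inl i)) (.inr (.inl i')) (β i) (by simp) (by simp [h])
  have hαβ : ∀ i j, α i ≠ β j := fun i j h => by
    simpa using hd (.inl i) (.inr (.inl j)) (α i) (by simp) (by simp [h])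
  have hαq : ∀ i i' j, α i ∉ q i' j := fun i i' j h => by
    simpa using hd (.inl i) (.inr (.inr (i', j))) (α i) (by simp) (by simpa using h)
  have hβq : ∀ j i' j', β j ∉ q i' j' := fun j i' j' h => by
    simpa using hd (.inr (.inl j)) (.inr (.inr (i', j'))) (β j) (by simp) (by simpa using h)
  have hqq : ∀ i j i' j' v, v ∈ q i j → v ∈ q i' j' → i = i' ∧ j = j' := fun i j i' j' v h h' => by
    simpa using hd (.inr (.inr (i, j))) (.inr (.inr (i', j'))) v (by simpa using h)
      (by simpa using h')
  have hqn : ∀ i j, (q i j).Nodup := fun i j => by simpa using hn (.inr (.inr (i, j)))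
  choose P hP using fun i j => exists_walk_of_isChain (hchain i j)
  have hPp : ∀ i j, (P i j).IsPath := by
    intro i j
    rw [Walk.isPath_def, hP, List.nodup_cons]
    refine ⟨by simp [hαq, hαβ], List.nodup_append.2 ⟨hqn i j, by simp, ?_⟩⟩
    intro a ha b hb
    obtain rfl := List.mem_singleton.1 hb
    rintro rfl
    exact hβq _ _ _ ha
  have hPm : ∀ i j v, v ∈ (P i j).support ↔ v = α i ∨ v ∈ q i j ∨ v = β j := by
    intro i j v; rw [hP]; simp
  have hPe : ∀ i j, Even (P i j).support.length := by
    intro i j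
    rw [hP]
    simpa [parity_simps] using heven i j
  let φ : EvenEmbedding (completeBipartiteGraph I J) G :=
    { vert := Sum.elim α β
      path := fun h => subdivisionPath P h
      path_symm := by
        rintro (i | j) (i' | j') h
        · simp at h
        · rfl
        · simp [subdivisionPath]
        · simp at h
      vert_injective := Sum.elim_injective.2 ⟨hα, hβ, hαβ⟩
      isPath := by
        rintro (i | j) (i' | j') h
        · simp at h
        · exact hPp i j'
        · exact (hPp i' j).reverse
        · simp at h
      even_vertices := by
        rintro (i | j) (i' | j') h
        · simp at h
        · exact hPe i j'
        · simpa [subdivisionPath] using hPe i' j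
        · simp at h
      vert_mem_path := by
        rintro (i | j) (i' | j') h (x | x) hx
        · simp at h
        · simp at h
        · simpa [subdivisionPath, hPm, hαq, hαβ, hα.eq_iff] using hx
        · simpa [subdivisionPath, hPm, hβq, (hαβ _ _).symm, hβ.eq_iff] using hx
        · simpa [subdivisionPath, hPm, hαq, hαβ, hα.eq_iff] using hx
        · simpa [subdivisionPath, hPm, hβq, (hαβ _ _).symm, hβ.eq_iff] using hx
        · simp at h
        · simp at h
      path_disjoint := by
        have key : ∀ i j i' j', ¬ (i = i' ∧ j = j') → ∀ v, v ∈ (P i j).support →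
            v ∈ (P i' j').support → (v = α i ∨ v = β j) ∧ (v = α i' ∨ v = β j') := by
          intro i j i' j' hne v hv hv'
          rw [hPm] at hv hv'
          have := hqq i j i' j' v
          rcases hv with rfl | hv | rfl <;> rcases hv' with hv' | hv' | hv'
          · simp [← hv']
          · exact absurd hv' (hαq _ _ _)
          · exact absurd hv' (hαβ _ _)
          · exact absurd (hv' ▸ hv) (hαq _ _ _)
          · exact absurd (this hv hv') hne
          · exact absurd (hv' ▸ hv) (hβq _ _ _)
          · exact absurd hv'.symm (hαβ _ _)
          · exact absurd hv' (hβq _ _ _)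
          · simp [← hv']
        have hrev : ∀ i j v, v ∈ (P i j).reverse.support → v ∈ (P i j).support := by simp
        rintro (i | j) (i' | j') (x | y) (x' | y') h k hne v hv hv'
        all_goals first | (simp at h; done) | (simp at k; done) | skip
        all_goals simp only [ne_eq, Sym2.eq_iff, Sum.inl.injEq, Sum.inr.injEq, reduceCtorEq,
          and_false, or_false, false_or] at hne
        · exact key _ _ _ _ hne v hv hv'
        · exact (key _ _ _ _ hne v hv (hrev _ _ _ hv')).imp_right Or.symm
        · exact (key _ _ _ _ (fun h => hne h.symm) v (hrev _ _ _ hv) hv').imp_left Or.symm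
        · exact (key _ _ _ _ (fun h => hne h.symm) v (hrev _ _ _ hv) (hrev _ _ _ hv')).imp
            Or.symm Or.symm }
  obtain ⟨M, hM, hMv⟩ := hcentral
  refine ⟨φ.toSubgraph, ⟨M, hM, ?_⟩, φ, rfl⟩
  rw [hMv]
  congr 1
  ext v
  simp only [EvenEmbedding.toSubgraph, Subgraph.verts_sup, Subgraph.verts_iSup, Set.mem_union,
    Set.mem_iUnion, singletonSubgraph_verts, Set.mem_singleton_iff, Walk.mem_verts_toSubgraph,
    Set.mem_ofPred_eq]
  constructor
  · rintro (⟨i, rfl⟩ | ⟨j, rfl⟩ | ⟨i, j, h⟩)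
    · exact .inl ⟨.inl i, rfl⟩
    · exact .inl ⟨.inr j, rfl⟩
    · exact .inr ⟨⟨(.inl i, .inr j), by simp⟩, (hPm i j v).2 (.inr (.inl h))⟩
  · rintro (⟨i | j, rfl⟩ | ⟨⟨⟨i | j, i' | j'⟩, h⟩, hv⟩)
    · exact .inl ⟨i, rfl⟩
    · exact .inr (.inl ⟨j, rfl⟩)
    · simp at h
    · rcases (hPm _ _ _).1 hv with h | h | h
      · exact .inl ⟨_, h⟩
      · exact .inr (.inr ⟨_, _, h⟩)
      · exact .inr (.inl ⟨_, h⟩)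
    · have hv : v ∈ (P i' j).reverse.support := hv
      rw [Walk.support_reverse, List.mem_reverse] at hv
      rcases (hPm _ _ _).1 hv with h | h | h
      · exact .inl ⟨_, h⟩
      · exact .inr (.inr ⟨_, _, h⟩)
      · exact .inr (.inl ⟨_, h⟩)
    · simp at h

/-- A matching that covers exactly the vertices of a set, as an involution of the set. -/
theorem exists_isMatching_of_involution {X : Set V} (f : V → V) (hX : ∀ v ∈ X, f v ∈ X)
    (hf : ∀ v ∈ X, f (f v) = v) (hadj : ∀ v ∈ X, G.Adj v (f v)) :
    ∃ M : G.Subgraph, M.IsMatching ∧ M.verts = X := by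
  refine ⟨{ verts := X
            Adj := fun v w => v ∈ X ∧ w = f v
            adj_sub := by rintro v w ⟨hv, rfl⟩; exact hadj v hv
            edge_vert := fun h => h.1
            symm := ⟨by rintro v w ⟨hv, rfl⟩; exact ⟨hX v hv, (hf v hv).symm⟩⟩ }, ?_, rfl⟩
  intro v hv
  exact ⟨f v, ⟨hv, rfl⟩, fun w hw => hw.2⟩

theorem exists_isMatching_union {X Y : Set V} (hX : ∃ M : G.Subgraph, M.IsMatching ∧ M.verts = X)
    (hY : ∃ M : G.Subgraph, M.IsMatching ∧ M.verts = Y) (h : Disjoint X Y) :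
    ∃ M : G.Subgraph, M.IsMatching ∧ M.verts = X ∪ Y := by
  obtain ⟨M, hM, rfl⟩ := hX
  obtain ⟨N, hN, rfl⟩ := hY
  exact ⟨M ⊔ N, hM.sup hN (by rwa [hM.support_eq_verts, hN.support_eq_verts]), rfl⟩

theorem exists_isMatching_list : ∀ {l : List V}, l.Nodup → Even l.length → List.IsChain G.Adj l →
    ∃ M : G.Subgraph, M.IsMatching ∧ M.verts = {v | v ∈ l}
  | [], _, _, _ => exists_isMatching_of_involution id (by simp) (by simp) (by simp)
  | [a], _, h, _ => by simp at h
  | a :: b :: l, hn, he, hc => by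
    rw [List.isChain_cons_cons] at hc
    have hn' := (List.nodup_cons.1 hn).2
    have h1 : a ∉ l ∧ b ∉ l := by simp at hn; tauto
    have h2 := exists_isMatching_list (List.nodup_cons.1 hn').2
      (by simpa [parity_simps] using he) hc.2.of_cons
    have h3 := exists_isMatching_union (X := {a, b})
      ⟨_, Subgraph.IsMatching.subgraphOfAdj hc.1, by simp⟩ h2 (by simp [h1])
    convert h3 using 4
    ext v; simp; tauto

end SimpleGraph

/-! ### The paths of a double jump -/

namespace DigraphLinkage

variable {V : Type*} {r : V → V → Prop}

/-- Reachability is turned into disjoint lists. The early jump J leaves the second path at z and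
meets the first at x; the late jump J' leaves the first at y and meets the second at z'. Both paths
are cut at these vertices, which come in the order x, y and z, z' because U precedes W. -/
theorem DoubleJump.exists_lists {K : Set V} {a a' c c' : V} (hj : DoubleJump r K a a' c c')
    (ha : ∀ v, ¬ r v a) (hc : ∀ v, ¬ r c v) :
    ∃ (p₁ : List V) (x : V) (p₂ : List V) (y : V) (q₂ n₁ : List V) (z : V) (k : List V) (z' : V)
      (o₂ J J' : List V),
      List.IsChain r (a :: (p₁ ++ x :: (p₂ ++ y :: (q₂ ++ [c])))) ∧
      List.IsChain r (n₁ ++ z :: (k ++ z' :: o₂)) ∧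
      (n₁ = [] ∧ z = a' ∨ ∃ n, n₁ = a' :: n) ∧ (o₂ = [] ∧ z' = c' ∨ ∃ o, o₂ = o ++ [c']) ∧
      List.IsChain r (z :: (J ++ [x])) ∧ List.IsChain r (y :: (J' ++ [z'])) ∧
      (a :: (p₁ ++ x :: (p₂ ++ y :: (q₂ ++ [c]))) ++ (n₁ ++ z :: (k ++ z' :: o₂) ++
        (J ++ J'))).Nodup ∧
      ∀ v ∈ a :: (p₁ ++ x :: (p₂ ++ y :: (q₂ ++ [c]))) ++ (n₁ ++ z :: (k ++ z' :: o₂) ++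
        (J ++ J')), v ∉ K := by
  obtain ⟨U, W, h, e, l, m, l', hUW, hUK, hWK, hA2, hA2n, hlU, hlW, hm, hah, hhe, hec, ha'h,
    hec'⟩ := hj
  rw [Set.disjoint_left] at hUW hUK hWK
  obtain ⟨t, ht, htn, htU, hth⟩ := hah.exists_isChain
  obtain ⟨t', ht', htn', htW, htc⟩ := hec.exists_isChain
  have hte : e ∈ e :: t' := by simp
  obtain ⟨b, hb⟩ : ∃ b, e :: t' = b ++ [c] :=
    ⟨_, (List.dropLast_append_getLast? c (by rw [← htc]; exact List.getLast?_eq_some_getLast _)).symm⟩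
  have hhl : h ∈ a :: t := by rw [← hth]; exact List.getLast_mem _
  -- Inside U the jump is taken from the early part of the second path to the early part of the
  -- first and meets both only in its ends; likewise for the late parts inside W.
  obtain ⟨z, x, J, hz, hx, hJ, hJn, hJU, hJd⟩ := exists_jump (P := (· ∈ a' :: l))
    (Q := (· ∈ a :: t)) ha'h (by simp) hhl (fun v hv hv' => (htU v hv').2 hv)
  obtain ⟨y, z', J', hy, hz', hJ', hJn', hJW, hJd'⟩ := exists_jump (P := (· ∈ e :: t'))
    (Q := (· ∈ l' ++ [c'])) hec' (by simp) (by simp) (fun v hv hv' => (htW v hv).2 hv')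
  -- The jump ends with an arc into x, and a has no incoming arc; dually, y has an outgoing arc and
  -- c has none. In contrast, z = a' and z' = c' are possible.
  have hxa : x ≠ a := by
    rintro rfl
    rcases J.eq_nil_or_concat with rfl | ⟨s, w, rfl⟩
    · exact ha z (by simpa using hJ)
    · rw [List.concat_eq_append] at hJ
      have e' : z :: (s ++ [w] ++ [x]) = (z :: s) ++ [w, x] := by simp
      rw [e'] at hJ
      exact ha w (by simpa using hJ.right_of_append)
  have hyc : y ≠ c := by
    rintro rfl
    rcases J' with _ | ⟨w, s⟩
    · exact hc z' (by simpa using hJ')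
    · rw [List.cons_append, List.isChain_cons_cons] at hJ'
      exact hc w hJ'.1
  obtain ⟨p₁, p₂, rfl⟩ := List.append_of_mem ((List.mem_cons.1 hx).resolve_left hxa)
  obtain ⟨q₁, q₂, rfl⟩ : ∃ q₁ q₂, b = q₁ ++ y :: q₂ := by
    refine List.append_of_mem ?_
    have : y ∈ b ++ [c] := hb ▸ hy
    simpa [hyc] using this
  obtain ⟨n₁, n₂, hn⟩ := List.append_of_mem hz
  obtain ⟨o₁, o₂, ho⟩ := List.append_of_mem hz'
  have hhead : (q₁ ++ y :: (q₂ ++ [c])).head? = some e := by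
    have := congrArg List.head? hb
    simpa using this.symm
  have hlast : (a :: (p₁ ++ x :: p₂)).getLast? = some h := by
    rw [← hth]; exact List.getLast?_eq_some_getLast _
  have hA2' : a' :: (l ++ (m ++ (l' ++ [c']))) = n₁ ++ z :: ((n₂ ++ m ++ o₁) ++ z' :: o₂) := by
    rw [← List.cons_append, hn, ho]; simp
  have eb : q₁ ++ y :: q₂ ++ [c] = q₁ ++ y :: (q₂ ++ [c]) := by simp
  rw [eb] at hb
  rw [hb] at ht' htn' htW hJd'
  -- The first path is glued at the arc (h, e), which lies between `p₂` and `q₁`.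
  refine ⟨p₁, x, p₂ ++ q₁, y, q₂, n₁, z, n₂ ++ m ++ o₁, z', o₂, J, J', ?_, ?_, ?_, ?_, hJ, hJ', ?_,
    ?_⟩
  · have e' : a :: (p₁ ++ x :: (p₂ ++ q₁ ++ y :: (q₂ ++ [c]))) =
      (a :: (p₁ ++ x :: p₂)) ++ (q₁ ++ y :: (q₂ ++ [c])) := by simp
    rw [e', List.isChain_append]
    refine ⟨ht, ht', ?_⟩
    intro u hu v hv
    rw [hlast] at hu
    rw [hhead] at hv
    simp only [Option.mem_def, Option.some.injEq] at hu hv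
    rw [← hu, ← hv]
    exact hhe
  · rw [← hA2']; exact hA2
  · rcases n₁ with _ | ⟨n, n₁⟩
    · simp only [List.nil_append, List.cons.injEq] at hn
      exact .inl ⟨rfl, hn.1.symm⟩
    · simp only [List.cons_append, List.cons.injEq] at hn
      exact .inr ⟨n₁, by rw [hn.1]⟩
  · rcases o₂.eq_nil_or_concat with rfl | ⟨s, w, rfl⟩
    · have := congrArg List.getLast? ho
      exact .inl ⟨rfl, by simpa using this.symm⟩
    · have := congrArg List.getLast? ho
      simp only [List.concat_eq_append, ← List.cons_append, ← List.append_assoc,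
        List.getLast?_concat, Option.some.injEq] at this
      exact .inr ⟨s, by rw [this, List.concat_eq_append]⟩
  · have hJ1 : J.Nodup := (List.nodup_cons.1 hJn).2.of_append_left
    have hJ2 : J'.Nodup := (List.nodup_cons.1 hJn').2.of_append_left
    have e' : a :: (p₁ ++ x :: (p₂ ++ q₁ ++ y :: (q₂ ++ [c]))) =
      (a :: (p₁ ++ x :: p₂)) ++ (q₁ ++ y :: (q₂ ++ [c])) := by simp
    rw [e', ← hA2']
    have hJU' : ∀ v ∈ J, v ∈ U := fun v hv => hJU v (by simp [hv])
    have hJW' : ∀ v ∈ J', v ∈ W := fun v hv => hJW v (by simp [hv])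
    have hA : ∀ v ∈ a' :: (l ++ (m ++ (l' ++ [c']))), v ∈ a' :: l ∨ v ∈ m ∨ v ∈ l' ++ [c'] := by
      intro v hv
      simp only [List.mem_cons, List.mem_append] at hv ⊢
      tauto
    refine List.nodup_append.2 ⟨List.nodup_append.2 ⟨htn, htn', ?_⟩,
      List.nodup_append.2 ⟨hA2n, List.nodup_append.2 ⟨hJ1, hJ2, ?_⟩, ?_⟩, ?_⟩
    · rintro u hu v hv rfl
      exact hUW (htU u hu).1 (htW u hv).1
    · rintro u hu v hv rfl
      exact hUW (hJU' u hu) (hJW' u hv)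
    · rintro u hu v hv rfl
      rcases hA u hu with hu | hu | hu <;> rcases List.mem_append.1 hv with hv | hv
      · exact (hJd u hv).1 hu
      · exact hUW (hlU u hu) (hJW' u hv)
      · exact (hm u hu).1 (hJU' u hv)
      · exact (hm u hu).2.1 (hJW' u hv)
      · exact hUW (hJU' u hv) (hlW u hu)
      · exact (hJd' u hv).2 hu
    · rintro u hu v hv rfl
      rcases List.mem_append.1 hu with hu | hu <;> rcases List.mem_append.1 hv with hv | hv
      · rcases hA u hv with hv | hv | hv
        · exact (htU u hu).2 hv
        · exact (hm u hv).1 (htU u hu).1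
        · exact hUW (htU u hu).1 (hlW u hv)
      · rcases List.mem_append.1 hv with hv | hv
        · exact (hJd u hv).2 hu
        · exact hUW (htU u hu).1 (hJW' u hv)
      · rcases hA u hv with hv | hv | hv
        · exact hUW (hlU u hv) (htW u hu).1
        · exact (hm u hv).2.1 (htW u hu).1
        · exact (htW u hu).2 hv
      · rcases List.mem_append.1 hv with hv | hv
        · exact hUW (hJU' u hv) (htW u hu).1
        · exact (hJd' u hv).1 hu
  · have e' : a :: (p₁ ++ x :: (p₂ ++ q₁ ++ y :: (q₂ ++ [c]))) =
      (a :: (p₁ ++ x :: p₂)) ++ (q₁ ++ y :: (q₂ ++ [c])) := by simp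
    rw [e', ← hA2']
    intro v hv
    rcases List.mem_append.1 hv with hv | hv
    · rcases List.mem_append.1 hv with hv | hv
      · exact hUK (htU v hv).1
      · exact hWK (htW v hv).1
    · rcases List.mem_append.1 hv with hv | hv
      · rw [← List.cons_append, List.mem_append, List.mem_append] at hv
        rcases hv with hv | hv | hv
        · exact hUK (hlU v hv)
        · exact (hm v hv).2.2
        · exact hWK (hlW v hv)
      · rcases List.mem_append.1 hv with hv | hv
        · exact hUK (hJU v (by simp [hv]))
        · exact hWK (hJW v (by simp [hv]))

end DigraphLinkage

/-! ### K₃,₃ from a double jump and a circuit with legs -/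

namespace SimpleGraph

variable {V : Type*} {G : SimpleGraph V}

theorem isChain_reverse_path {u v : V} {l : List V} (h : List.IsChain G.Adj (u :: (l ++ [v]))) :
    List.IsChain G.Adj (v :: (l.reverse ++ [u])) := by
  have h' : List.IsChain G.Adj (u :: (l ++ [v])).reverse :=
    List.isChain_reverse.2 (h.imp fun _ _ h => h.symm)
  simpa using h'

theorem isChain_join {r : V → V → Prop} {u v w : V} {l l' : List V}
    (h : List.IsChain r (u :: (l ++ [v]))) (h' : List.IsChain r (v :: (l' ++ [w]))) :
    List.IsChain r (u :: ((l ++ v :: l') ++ [w])) := by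
  induction l generalizing u with
  | nil =>
    have h1 : r u v := by simpa using h
    simpa [List.isChain_cons_cons] using ⟨h1, h'⟩
  | cons a l ih =>
    rw [List.cons_append, List.isChain_cons_cons] at h
    rw [List.cons_append, List.cons_append, List.isChain_cons_cons]
    exact ⟨h.1, ih h.2⟩

/-- Parity of a path in a bipartite graph is decided by the colours of its ends, so path lengths in
the model of K₃,₃ need not be computed. -/
theorem even_length_iff_of_isChain {A : V → Prop} (hA : ∀ u v, G.Adj u v → (A u ↔ ¬ A v)) {v : V} :
    ∀ {l : List V} {u : V}, List.IsChain G.Adj (u :: (l ++ [v])) →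
      (Even l.length ↔ (A u ↔ ¬ A v))
  | [], u, h => by
    have h1 : G.Adj u v := by simpa using h
    simp [hA _ _ h1]
  | a :: l, u, h => by
    rw [List.cons_append, List.isChain_cons_cons] at h
    have h1 := hA _ _ h.1
    have h2 := even_length_iff_of_isChain hA h.2
    rw [List.length_cons, Nat.even_add_one, h2]
    tauto

variable (m : V → V)

/-- The vertices of a directed path of the digraph of a matching together with their partners. -/
noncomputable def expand [DecidableEq V] (l : List V) : List V :=
  l.flatMap fun v => if m v = v then [v] else [m v, v]

section expand

variable [DecidableEq V]

theorem expand_nil : expand m [] = [] := rfl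

theorem expand_append (l l' : List V) : expand m (l ++ l') = expand m l ++ expand m l' := by
  simp [expand]

theorem expand_cons_of_eq {v : V} (h : m v = v) (l : List V) :
    expand m (v :: l) = v :: expand m l := by
  simp [expand, h]

theorem expand_cons_of_ne {v : V} (h : m v ≠ v) (l : List V) :
    expand m (v :: l) = m v :: v :: expand m l := by
  simp [expand, h]

variable {m}

theorem mem_expand (hm : ∀ v, m (m v) = v) {l : List V} {v : V} :
    v ∈ expand m l ↔ v ∈ l ∨ m v ∈ l := by
  induction l with
  | nil => simp [expand_nil]
  | cons a l ih =>
    by_cases h : m a = a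
    · rw [expand_cons_of_eq m h, List.mem_cons, ih, List.mem_cons, List.mem_cons]
      have : m v = a → v = a := fun e => by rw [← hm v, e, h]
      tauto
    · rw [expand_cons_of_ne m h, List.mem_cons, List.mem_cons, ih, List.mem_cons, List.mem_cons]
      have : m v = a ↔ v = m a := ⟨fun e => by rw [← hm v, e], fun e => by rw [e, hm]⟩
      tauto

variable {A : V → Prop}

/-- The partner of a vertex of colour A has the other colour, hence is not in the list itself unless
it is a fixed point. -/
theorem nodup_expand (hA : ∀ u v, G.Adj u v → (A u ↔ ¬ A v)) (hm : ∀ v, m (m v) = v)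
    (hadj : ∀ v, m v ≠ v → G.Adj v (m v)) {l : List V} (hl : l.Nodup)
    (hd : ∀ v ∈ l, A v ∨ m v = v) : (expand m l).Nodup := by
  induction l with
  | nil => simp [expand_nil]
  | cons a l ih =>
    have hl' := List.nodup_cons.1 hl
    have ih' := ih hl'.2 fun v hv => hd v (by simp [hv])
    by_cases h : m a = a
    · rw [expand_cons_of_eq m h, List.nodup_cons, mem_expand hm, h, or_self]
      exact ⟨hl'.1, ih'⟩
    · have h1 : m a ∉ l := by
        intro h1
        rcases hd (m a) (by simp [h1]) with h2 | h2
        · rcases hd a (by simp) with h3 | h3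
          · exact (hA _ _ (hadj a h)).1 h3 h2
          · exact h h3
        · rw [hm] at h2; exact h h2.symm
      rw [expand_cons_of_ne m h, List.nodup_cons, List.nodup_cons, List.mem_cons, mem_expand hm,
        mem_expand hm, hm]
      exact ⟨by tauto, by tauto, ih'⟩

/-- An arc v → w stands for the edge from v to m w followed by the matching edge from m w to w. The
last vertex is entered only at its partner. -/
theorem isChain_expand (hadj : ∀ v, m v ≠ v → G.Adj v (m v)) {u v : V} {l : List V}
    (h : List.IsChain (fun v w => A v ∧ G.Adj v (m w)) (u :: (l ++ [v]))) :
    List.IsChain G.Adj (u :: (expand m l ++ [m v])) := by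
  induction l generalizing u with
  | nil =>
    have h' : A u ∧ G.Adj u (m v) := by simpa using h
    simpa [expand_nil] using h'.2
  | cons a l ih =>
    rw [List.cons_append, List.isChain_cons_cons] at h
    by_cases ha : m a = a
    · rw [expand_cons_of_eq m ha, List.cons_append, List.isChain_cons_cons]
      exact ⟨ha ▸ h.1.2, ih h.2⟩
    · rw [expand_cons_of_ne m ha, List.cons_append, List.cons_append, List.isChain_cons_cons,
        List.isChain_cons_cons]
      exact ⟨h.1.2, (hadj a ha).symm, ih h.2⟩

end expand

/-- A circuit with four legs, without the terminals of the legs, as five paths and the remainder of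
the circuit. -/
structure Theta (G : SimpleGraph V) (A : V → Prop) (K : Set V) (a a' c c' : V) where
  α : V
  β : V
  T₁ : List V
  T₂ : List V
  T₃ : List V
  T₄ : List V
  T₅ : List V
  R : List V
  mem_iff : ∀ v, v ∈ K ↔ v ∈ α :: β :: (T₁ ++ (T₂ ++ (T₃ ++ (T₄ ++ (T₅ ++ R)))))
  nodup : (α :: β :: (T₁ ++ (T₂ ++ (T₃ ++ (T₄ ++ (T₅ ++ R)))))).Nodup
  chain₁ : List.IsChain G.Adj (β :: (T₁ ++ [a]))
  chain₂ : List.IsChain G.Adj (c :: (T₂ ++ [α]))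
  chain₃ : List.IsChain G.Adj (β :: (T₃ ++ [α]))
  chain₄ : List.IsChain G.Adj (a' :: (T₄ ++ [α]))
  chain₅ : List.IsChain G.Adj (β :: (T₅ ++ [c']))
  chainR : List.IsChain G.Adj R
  evenR : Even R.length
  colour_α : ¬ A α
  colour_β : A β

section DoubleJump

variable {m : V → V} {A : V → Prop}

theorem colour_of_isChain (hA : ∀ u v, G.Adj u v → (A u ↔ ¬ A v)) :
    ∀ (l : List V) (u v : V),
    List.IsChain (fun v w => A v ∧ G.Adj v (m w)) (u :: (l ++ [v])) →
      A u ∧ (∀ w ∈ l, A w ∧ m w ≠ w) ∧ ¬ A (m v)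
  | [], u, v, h => by
    have h' : A u ∧ G.Adj u (m v) := by simpa using h
    exact ⟨h'.1, by simp, (hA _ _ h'.2).1 h'.1⟩
  | b :: l, u, v, h => by
    rw [List.cons_append, List.isChain_cons_cons] at h
    have := colour_of_isChain hA l b v h.2
    refine ⟨h.1.1, ?_, this.2.2⟩
    rintro w hw
    rcases List.mem_cons.1 hw with rfl | hw
    · exact ⟨this.1, fun e => (hA _ _ h.1.2).1 h.1.1 (by rw [e]; exact this.1)⟩
    · exact this.2.1 w hw

/-- Go from z back along the second path to the source a, then along the leg T; if z = a, the leg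
alone suffices. The multiplicities record that exactly the vertices of these pieces are used. -/
theorem exists_path_from_source [DecidableEq V] (hA : ∀ u v, G.Adj u v → (A u ↔ ¬ A v))
    (hadj : ∀ v, m v ≠ v → G.Adj v (m v)) {a z α : V} {n T : List V} (ha : m a = a)
    (hT : List.IsChain G.Adj (a :: (T ++ [α]))) (hn : n = [] ∧ z = a ∨ ∃ n', n = a :: n')
    (hz : A z) (hc : List.IsChain (fun v w => A v ∧ G.Adj v (m w)) (n ++ [z])) :
    ∃ q, List.IsChain G.Adj (z :: (q ++ [α])) ∧
      ∀ v, (z :: q).count v = (expand m (n ++ [z])).count v + T.count v := by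
  rcases hn with ⟨rfl, rfl⟩ | ⟨n, rfl⟩
  · exact ⟨_, hT, fun v => by
      rw [List.nil_append, expand_cons_of_eq m ha, expand_nil]
      simp [List.count_cons]; omega⟩
  · have hzm : m z ≠ z := fun e => (colour_of_isChain hA _ _ _ hc).2.2 (by rwa [e])
    have hp : List.IsChain G.Adj (m z :: ([] ++ [z])) := by simpa using (hadj z hzm).symm
    refine ⟨_, isChain_join (isChain_reverse_path (isChain_join (isChain_expand hadj hc) hp)) hT,
      fun v => ?_⟩
    rw [List.cons_append, expand_cons_of_eq m ha, expand_append, expand_cons_of_ne m hzm]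
    simp [List.count_cons, List.count_append, expand_nil]
    omega

/-- Go along the leg T to the sink c, then back along the path to m z; if z = c, then m z = c and
the leg alone suffices. -/
theorem exists_path_to_sink [DecidableEq V] (hA : ∀ u v, G.Adj u v → (A u ↔ ¬ A v))
    (hadj : ∀ v, m v ≠ v → G.Adj v (m v)) {c z β : V} {o T : List V} (hc : m c = c)
    (hT : List.IsChain G.Adj (β :: (T ++ [c]))) (ho : o = [] ∧ z = c ∨ ∃ o', o = o' ++ [c])
    (hz : ¬ A (m z)) (h : List.IsChain (fun v w => A v ∧ G.Adj v (m w)) (z :: o)) :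
    ∃ q, List.IsChain G.Adj (β :: (q ++ [m z])) ∧
      ∀ v, (m z :: q).count v = (expand m (z :: o)).count v + T.count v := by
  rcases ho with ⟨rfl, rfl⟩ | ⟨o, rfl⟩
  · refine ⟨T, by rw [hc]; exact hT, fun v => ?_⟩
    rw [expand_cons_of_eq m hc, expand_nil, hc]
    simp [List.count_cons]; omega
  · have hzm : m z ≠ z := fun e => hz (by rw [e]; exact (colour_of_isChain hA _ _ _ h).1)
    have hp : List.IsChain G.Adj (m z :: ([] ++ [z])) := by simpa using (hadj z hzm).symm
    have k8 := isChain_expand hadj h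
    rw [hc] at k8
    refine ⟨_, isChain_join hT (isChain_reverse_path (isChain_join hp k8)), fun v => ?_⟩
    rw [expand_cons_of_ne m hzm, expand_append, expand_cons_of_eq m hc, expand_nil]
    simp [List.count_cons, List.count_append]
    omega

theorem colour_or_fixed (hA : ∀ u v, G.Adj u v → (A u ↔ ¬ A v)) {a c : V} {l : List V}
    (hc : m c = c) (h : List.IsChain (fun v w => A v ∧ G.Adj v (m w)) (a :: (l ++ [c]))) :
    ∀ v ∈ a :: (l ++ [c]), A v ∨ m v = v := by
  have := colour_of_isChain hA _ _ _ h
  intro v hv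
  rcases List.mem_cons.1 hv with rfl | hv
  · exact .inl this.1
  · rcases List.mem_append.1 hv with hv | hv
    · exact .inl (this.2.1 v hv).1
    · exact .inr (by rw [List.mem_singleton.1 hv, hc])

end DoubleJump

theorem containsGraph_of_nodup [DecidableEq V] {A : V → Prop}
    (hA : ∀ u v, G.Adj u v → (A u ↔ ¬ A v)) {a₁ a₂ a₃ b₁ b₂ b₃ : V}
    {q₁ q₂ q₃ q₄ q₅ q₆ q₇ q₈ q₉ R : List V}
    (ha₁ : A a₁) (ha₂ : A a₂) (ha₃ : A a₃) (hb₁ : ¬ A b₁) (hb₂ : ¬ A b₂) (hb₃ : ¬ A b₃)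
    (h₁ : List.IsChain G.Adj (a₁ :: (q₁ ++ [b₁]))) (h₂ : List.IsChain G.Adj (a₁ :: (q₂ ++ [b₂])))
    (h₃ : List.IsChain G.Adj (a₁ :: (q₃ ++ [b₃]))) (h₄ : List.IsChain G.Adj (a₂ :: (q₄ ++ [b₁])))
    (h₅ : List.IsChain G.Adj (a₂ :: (q₅ ++ [b₂]))) (h₆ : List.IsChain G.Adj (a₂ :: (q₆ ++ [b₃])))
    (h₇ : List.IsChain G.Adj (a₃ :: (q₇ ++ [b₁]))) (h₈ : List.IsChain G.Adj (a₃ :: (q₈ ++ [b₂])))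
    (h₉ : List.IsChain G.Adj (a₃ :: (q₉ ++ [b₃])))
    (hn : ((a₁ :: a₂ :: a₃ :: b₁ :: b₂ :: b₃ ::
      (q₁ ++ (q₂ ++ (q₃ ++ (q₄ ++ (q₅ ++ (q₆ ++ (q₇ ++ (q₈ ++ q₉))))))))) ++ R).Nodup)
    (hR : List.IsChain G.Adj R) (hR' : Even R.length)
    (hM : ∃ M : G.Subgraph, M.IsMatching ∧ M.verts = {v | v ∈ (a₁ :: a₂ :: a₃ :: b₁ :: b₂ :: b₃ ::
      (q₁ ++ (q₂ ++ (q₃ ++ (q₄ ++ (q₅ ++ (q₆ ++ (q₇ ++ (q₈ ++ q₉))))))))) ++ R}ᶜ) :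
    ContainsGraph G (completeBipartiteGraph (Fin 3) (Fin 3)) := by
  have hev : ∀ {a b : V} {q : List V}, A a → ¬ A b → List.IsChain G.Adj (a :: (q ++ [b])) →
      Even q.length := fun ha hb h => (even_length_iff_of_isChain hA h).2 (by tauto)
  refine containsGraph_completeBipartiteGraph ![a₁, a₂, a₃] ![b₁, b₂, b₃]
    ![![q₁, q₂, q₃], ![q₄, q₅, q₆], ![q₇, q₈, q₉]] ?_ ?_ ?_ ?_
  · intro i j
    fin_cases i <;> fin_cases j <;> assumption
  · intro i j
    fin_cases i <;> fin_cases j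
    exacts [hev ha₁ hb₁ h₁, hev ha₁ hb₂ h₂, hev ha₁ hb₃ h₃, hev ha₂ hb₁ h₄, hev ha₂ hb₂ h₅,
      hev ha₂ hb₃ h₆, hev ha₃ hb₁ h₇, hev ha₃ hb₂ h₈, hev ha₃ hb₃ h₉]
  · intro v
    have h := List.nodup_iff_count_le_one.1 hn.of_append_left v
    have cs : ∀ a l, List.count v (a :: l) = List.count v [a] + List.count v l := fun a l =>
      List.count_append (l₁ := [a])
    rw [cs a₁, cs a₂, cs a₃, cs b₁, cs b₂, cs b₃] at h
    simp only [List.count_append] at h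
    simp only [Fintype.sum_sum_type, Fintype.sum_prod_type, Fin.sum_univ_three, Sum.elim_inl,
      Sum.elim_inr, Matrix.cons_val_zero, Matrix.cons_val_one, Matrix.cons_val]
    omega
  · have hn' := List.nodup_append.1 hn
    have h := exists_isMatching_union hM (exists_isMatching_list hn'.2.1 hR' hR)
      (Set.disjoint_left.2 fun v hv hv' => hv (List.mem_append_right _ hv'))
    convert h using 4
    ext v
    have hd : v ∈ a₁ :: a₂ :: a₃ :: b₁ :: b₂ :: b₃ ::
      (q₁ ++ (q₂ ++ (q₃ ++ (q₄ ++ (q₅ ++ (q₆ ++ (q₇ ++ (q₈ ++ q₉)))))))) → v ∉ R :=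
      fun h h' => hn'.2.2 v h v h' rfl
    have he : (v ∈ {v | (∃ i, v = ![a₁, a₂, a₃] i) ∨ (∃ j, v = ![b₁, b₂, b₃] j) ∨ ∃ i j,
        v ∈ ![![q₁, q₂, q₃], ![q₄, q₅, q₆], ![q₇, q₈, q₉]] i j}) ↔
        v ∈ a₁ :: a₂ :: a₃ :: b₁ :: b₂ :: b₃ ::
      (q₁ ++ (q₂ ++ (q₃ ++ (q₄ ++ (q₅ ++ (q₆ ++ (q₇ ++ (q₈ ++ q₉)))))))) := by
      simp only [Set.mem_ofPred_eq, Fin.exists_fin_succ, Matrix.cons_val_zero, List.mem_cons,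
        List.mem_append, Matrix.cons_val_succ, Fin.succ_zero_eq_one, Matrix.cons_val_one,
        IsEmpty.exists_iff, or_false, or_assoc]
    rw [Set.mem_compl_iff, he, Set.mem_union, Set.mem_compl_iff, Set.mem_ofPred_eq,
      Set.mem_ofPred_eq, List.mem_append]
    tauto

/-- The branch vertices are y, β, z of colour A and m x, α, m z' of the other colour. The first path
gives y to m x directly, y to α beyond c, and m x to β beyond a; the second path does the same for z
and m z' by way of a' and c'. The jumps give z to m x and y to m z', and the circuit gives β to α.
-/
theorem containsGraph_of_doubleJump [DecidableEq V] {m : V → V} {A : V → Prop}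
    (hA : ∀ u v, G.Adj u v → (A u ↔ ¬ A v)) (hm : ∀ v, m (m v) = v)
    (hadj : ∀ v, m v ≠ v → G.Adj v (m v)) {a a' c c' : V}
    (hfix : ∀ v, m v = v ↔ v = a ∨ v = a' ∨ v = c ∨ v = c') (ha : A a) (hc : ¬ A c)
    {K : Set V} (hK : ∀ v ∈ K, m v ∈ K) (hKfix : ∀ v ∈ K, m v ≠ v)
    (θ : Theta G A K a a' c c')
    (hj : DigraphLinkage.DoubleJump (fun v w => A v ∧ G.Adj v (m w)) {v | v ∈ K ∧ A v} a a' c c') :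
    ContainsGraph G (completeBipartiteGraph (Fin 3) (Fin 3)) := by
  have mc : m c = c := (hfix c).2 (by simp)
  have mc' : m c' = c' := (hfix c').2 (by simp)
  have ma : m a = a := (hfix a).2 (by simp)
  have ma' : m a' = a' := (hfix a').2 (by simp)
  have hsrc : ∀ u, ¬ (A u ∧ G.Adj u (m a)) := fun u hu => (hA _ _ hu.2).1 hu.1 (by rwa [ma])
  obtain ⟨p₁, x, p₂, y, q₂, n₁, z, k, z', o₂, J, J', h1, h2, h3, h4, h5, h6, hn, hd⟩ :=
    hj.exists_lists hsrc (fun v hv => hc hv.1)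
  have e0 : a :: (p₁ ++ x :: (p₂ ++ y :: (q₂ ++ [c]))) =
      (a :: (p₁ ++ [x])) ++ (p₂ ++ y :: (q₂ ++ [c])) := by simp
  have e1 : a :: (p₁ ++ x :: (p₂ ++ y :: (q₂ ++ [c]))) =
      (a :: p₁) ++ ((x :: (p₂ ++ [y])) ++ (q₂ ++ [c])) := by simp
  have e2 : a :: (p₁ ++ x :: (p₂ ++ y :: (q₂ ++ [c]))) =
      (a :: p₁ ++ x :: p₂) ++ ((y :: (q₂ ++ [c]))) := by simp
  have e3 : a :: (p₁ ++ x :: (p₂ ++ y :: (q₂ ++ [c]))) =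
      a :: ((p₁ ++ x :: (p₂ ++ y :: q₂)) ++ [c]) := by simp
  have e4 : n₁ ++ z :: (k ++ z' :: o₂) = n₁ ++ ((z :: (k ++ [z'])) ++ o₂) := by simp
  have e5 : n₁ ++ z :: (k ++ z' :: o₂) = (n₁ ++ [z]) ++ (k ++ z' :: o₂) := by simp
  have e6 : n₁ ++ z :: (k ++ z' :: o₂) = (n₁ ++ z :: k) ++ z' :: o₂ := by simp
  have c1 := (e0 ▸ h1).left_of_append
  have c2 := (e1 ▸ h1).right_of_append.left_of_append
  have c3 := (e2 ▸ h1).right_of_append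
  have c4 := (e4 ▸ h2).right_of_append.left_of_append
  have c5 := (e5 ▸ h2).left_of_append
  have c6 := (e6 ▸ h2).right_of_append
  have hx : m x ≠ x := fun e => (colour_of_isChain hA _ _ _ c1).2.2
    (by rw [e]; exact (colour_of_isChain hA _ _ _ c2).1)
  have hy : m y ≠ y := fun e => (colour_of_isChain hA _ _ _ c2).2.2
    (by rw [e]; exact (colour_of_isChain hA _ _ _ c3).1)
  have hz : A z := (colour_of_isChain hA _ _ _ c4).1
  have hz' : ¬ A (m z') := (colour_of_isChain hA _ _ _ c4).2.2
  have hmx : ¬ A (m x) := (colour_of_isChain hA _ _ _ c1).2.2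
  have hyA : A y := (colour_of_isChain hA _ _ _ c3).1
  have hpair : ∀ v, m v ≠ v → List.IsChain G.Adj (m v :: ([] ++ [v])) := fun v hv => by
    simpa using (hadj v hv).symm
  have k1 := isChain_reverse_path (isChain_join (isChain_join (hpair x hx) (isChain_expand hadj c2))
    (hpair y hy))
  have k3 := isChain_expand hadj c3
  rw [mc] at k3
  replace k3 := isChain_join k3 θ.chain₂
  have k7 := isChain_join θ.chain₁ (isChain_expand hadj c1)
  obtain ⟨q₆, hq6, hq6'⟩ := exists_path_from_source hA hadj ma' θ.chain₄ h3 hz c5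
  obtain ⟨q₈, hq8, hq8'⟩ := exists_path_to_sink hA hadj mc' θ.chain₅ h4 hz' c6
  have hA2 : ∀ v ∈ n₁ ++ z :: (k ++ z' :: o₂), A v ∨ m v = v := by
    obtain ⟨w, hw⟩ : ∃ w, n₁ ++ z :: (k ++ z' :: o₂) = a' :: (w ++ [c']) := by
      rcases h3 with ⟨rfl, rfl⟩ | ⟨n, rfl⟩ <;> rcases h4 with ⟨rfl, rfl⟩ | ⟨o, rfl⟩
      · exact ⟨k, by simp⟩
      · exact ⟨k ++ z' :: o, by simp⟩
      · exact ⟨n ++ z :: k, by simp⟩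
      · exact ⟨n ++ z :: (k ++ z' :: o), by simp⟩
    have h2' := h2
    rw [hw] at h2' ⊢
    exact colour_or_fixed hA mc' h2'
  have hDd : ∀ v ∈ a :: (p₁ ++ x :: (p₂ ++ y :: (q₂ ++ [c]))) ++
      (n₁ ++ z :: (k ++ z' :: o₂) ++ (J ++ J')), A v ∨ m v = v := by
    intro v hv
    rcases List.mem_append.1 hv with hv | hv
    · exact colour_or_fixed hA mc (e3 ▸ h1) v (e3 ▸ hv)
    · rcases List.mem_append.1 hv with hv | hv
      · exact hA2 v hv
      · rcases List.mem_append.1 hv with hv | hv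
        · exact .inl ((colour_of_isChain hA _ _ _ h5).2.1 v hv).1
        · exact .inl ((colour_of_isChain hA _ _ _ h6).2.1 v hv).1
  have hDK : ∀ v ∈ a :: (p₁ ++ x :: (p₂ ++ y :: (q₂ ++ [c]))) ++
      (n₁ ++ z :: (k ++ z' :: o₂) ++ (J ++ J')), v ∉ K := by
    intro v hv hvK
    rcases hDd v hv with h | h
    · exact hd v hv ⟨hvK, h⟩
    · exact hKfix v hvK h
  have hEn := nodup_expand hA hm hadj hn hDd
  have hDS : ∀ v, v = a ∨ v = a' ∨ v = c ∨ v = c' →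
      v ∈ a :: (p₁ ++ x :: (p₂ ++ y :: (q₂ ++ [c]))) ++
        (n₁ ++ z :: (k ++ z' :: o₂) ++ (J ++ J')) := by
    rintro v (rfl | rfl | rfl | rfl)
    · simp
    · rcases h3 with ⟨rfl, rfl⟩ | ⟨n, rfl⟩ <;> simp
    · simp
    · rcases h4 with ⟨rfl, rfl⟩ | ⟨o, rfl⟩ <;> simp
  have hX : ∀ v, v ∈ expand m (a :: (p₁ ++ x :: (p₂ ++ y :: (q₂ ++ [c]))) ++
      (n₁ ++ z :: (k ++ z' :: o₂) ++ (J ++ J'))) ∨ v ∈ K →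
      m v ∈ expand m (a :: (p₁ ++ x :: (p₂ ++ y :: (q₂ ++ [c]))) ++
      (n₁ ++ z :: (k ++ z' :: o₂) ++ (J ++ J'))) ∨ m v ∈ K := by
    intro v hv
    simp only [mem_expand hm, hm] at hv ⊢
    rcases hv with h | h
    · exact .inl h.symm
    · exact .inr (hK v h)
  have hDE : ∀ v, v ∈ expand m (a :: (p₁ ++ x :: (p₂ ++ y :: (q₂ ++ [c]))) ++
      (n₁ ++ z :: (k ++ z' :: o₂) ++ (J ++ J'))) → v ∉ K := by
    intro v hv hvK
    rcases (mem_expand hm).1 hv with h | h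
    · exact hDK v h hvK
    · exact hDK _ h (hK v hvK)
  have hfixX : ∀ v, m v = v → v ∈ expand m (a :: (p₁ ++ x :: (p₂ ++ y :: (q₂ ++ [c]))) ++
      (n₁ ++ z :: (k ++ z' :: o₂) ++ (J ++ J'))) := fun v hv =>
    (mem_expand hm).2 (.inl (hDS v ((hfix v).1 hv)))
  have hE : expand m (a :: (p₁ ++ x :: (p₂ ++ y :: (q₂ ++ [c]))) ++
      (n₁ ++ z :: (k ++ z' :: o₂) ++ (J ++ J'))) = a :: (expand m p₁ ++ m x :: x :: (expand m p₂ ++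
        m y :: y :: (expand m q₂ ++ [c]))) ++ (expand m (n₁ ++ [z]) ++ (expand m k ++
        expand m (z' :: o₂)) ++ (expand m J ++ expand m J')) := by
    rw [e5]
    simp only [expand_append, expand_cons_of_eq m ma, expand_cons_of_ne m hx,
      expand_cons_of_ne m hy, expand_cons_of_eq m mc, expand_nil]
  generalize hEd : expand m (a :: (p₁ ++ x :: (p₂ ++ y :: (q₂ ++ [c]))) ++
      (n₁ ++ z :: (k ++ z' :: o₂) ++ (J ++ J'))) = E at *
  have k2 := isChain_expand hadj h6
  have k4 := isChain_expand hadj h5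
  have k5 := isChain_expand hadj c4
  clear e0 e1 e2 e3 e4 e5 e6 h1 h2 c1 c2 c3 c4 c5 c6 h3 h4 h5 h6 hn hd hA2 hDd hDK hDS
  have hnd : (E ++ (θ.α :: θ.β ::
      (θ.T₁ ++ (θ.T₂ ++ (θ.T₃ ++ (θ.T₄ ++ (θ.T₅ ++ θ.R))))))).Nodup := by
    refine List.nodup_append.2 ⟨hEn, θ.nodup, ?_⟩
    rintro u hu v hv rfl
    exact hDE u hu ((θ.mem_iff u).2 hv)
  -- The nine paths, the branch vertices and the rest R of the circuit use every vertex of the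
  -- expanded double jump and of the gadget exactly once.
  have hperm : (E ++ (θ.α :: θ.β ::
      (θ.T₁ ++ (θ.T₂ ++ (θ.T₃ ++ (θ.T₄ ++ (θ.T₅ ++ θ.R))))))).Perm
      ((y :: θ.β :: z :: m x :: θ.α :: m z' :: ((([] ++ x :: expand m p₂) ++ m y :: []).reverse ++
      ((expand m q₂ ++ c :: θ.T₂) ++ (expand m J' ++ ((θ.T₁ ++ a :: expand m p₁) ++ (θ.T₃ ++
        (q₈ ++ (expand m J ++ (q₆ ++ expand m k))))))))) ++ θ.R) := by
    rw [List.perm_iff_count]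
    intro v
    have h1 := hq6' v
    have h2 := hq8' v
    rw [hE]
    clear * - h1 h2
    simp only [List.count_cons, List.count_append, List.count_nil, List.count_reverse] at h1 h2 ⊢
    omega
  refine containsGraph_of_nodup hA hyA θ.colour_β hz hmx θ.colour_α hz' k1 k3 k2 k7 θ.chain₃ hq8 k4
    hq6 k5 (hperm.nodup_iff.1 hnd) θ.chainR θ.evenR ?_
  -- Everything used so far is closed under m and contains its fixed points, so m matches the
  -- remaining vertices.
  refine exists_isMatching_of_involution m ?_ (fun v _ => hm v) ?_
  · intro v hv
    simp only [Set.mem_compl_iff, Set.mem_ofPred_eq, ← hperm.mem_iff, List.mem_append (s := E),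
      ← θ.mem_iff] at hv ⊢
    intro h
    have := hX (m v) h
    rw [hm] at this
    exact hv this
  · intro v hv
    simp only [Set.mem_compl_iff, Set.mem_ofPred_eq, ← hperm.mem_iff, List.mem_append (s := E),
      ← θ.mem_iff] at hv
    exact hadj v fun e => hv (.inl (hfixX v e))

end SimpleGraph

/-! ### Reachability in the digraph of a brace -/

namespace SimpleGraph

variable {V : Type*} {G : SimpleGraph V}

theorem exists_involution_of_isPerfectMatching {M : G.Subgraph} (hM : M.IsPerfectMatching) :
    ∃ f : V → V, (∀ v, f (f v) = v) ∧ (∀ v, G.Adj v (f v)) ∧ ∀ u v, M.Adj u v → f u = v := by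
  choose f hf hf' using Subgraph.isPerfectMatching_iff.1 hM
  have h : ∀ u v, M.Adj u v → f u = v := fun u v h => (hf' u v h).symm
  exact ⟨f, fun v => h _ _ (hf v).symm, fun v => (hf v).adj_sub, h⟩

theorem IsExtendable.exists_involution_pair (h : G.IsExtendable 2) {u v u' v' : V}
    (huv : G.Adj u v) (huv' : G.Adj u' v')
    (hd : Disjoint (G.subgraphOfAdj huv).support (G.subgraphOfAdj huv').support) :
    ∃ f : V → V, (∀ v, f (f v) = v) ∧ (∀ v, G.Adj v (f v)) ∧ f u = v ∧ f u' = v' := by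
  obtain ⟨M, hM, hM'⟩ := h (G.subgraphOfAdj huv ⊔ G.subgraphOfAdj huv')
    ((Subgraph.IsMatching.subgraphOfAdj huv).sup (.subgraphOfAdj huv') hd) (by
      rw [Subgraph.edgeSet_sup, edgeSet_subgraphOfAdj, edgeSet_subgraphOfAdj]
      refine (Set.encard_union_le _ _).trans ?_
      rw [Set.encard_singleton, Set.encard_singleton]
      norm_num)
  obtain ⟨f, h1, h2, h3⟩ := exists_involution_of_isPerfectMatching hM'
  exact ⟨f, h1, h2, h3 _ _ (hM.2 (by simp)), h3 _ _ (hM.2 (by simp))⟩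

theorem IsExtendable.exists_involution (h : G.IsExtendable 2) {u v : V} (huv : G.Adj u v) :
    ∃ f : V → V, (∀ v, f (f v) = v) ∧ (∀ v, G.Adj v (f v)) ∧ f u = v := by
  obtain ⟨M, hM, hM'⟩ := h (G.subgraphOfAdj huv) (.subgraphOfAdj huv) (by
      rw [edgeSet_subgraphOfAdj, Set.encard_singleton]; norm_num)
  obtain ⟨f, h1, h2, h3⟩ := exists_involution_of_isPerfectMatching hM'
  exact ⟨f, h1, h2, h3 _ _ (hM.2 (by simp))⟩

theorem mem_of_reachable {Z : Set V} (hZ : ∀ u v, G.Adj u v → u ∈ Z → v ∈ Z) {u v : V}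
    (h : G.Reachable u v) (hu : u ∈ Z) : v ∈ Z := by
  obtain ⟨p⟩ := h
  induction p with
  | nil => exact hu
  | cons h _ ih => exact ih (hZ _ _ h hu)

/-- In a brace, a set with at most one more neighbour than members has all the vertices of the other
side of its components as neighbours. -/
theorem IsExtendable.not_reachable [Finite V] (hG : G.IsExtendable 2) {C : V → Prop}
    (hC : ∀ u v, G.Adj u v → (C u ↔ ¬ C v)) {X Y : Set V} (hX : ∀ x ∈ X, C x)
    (hY : ∀ y ∈ Y, ¬ C y) (hN : ∀ x ∈ X, ∀ y, G.Adj x y → y ∈ Y) (hcard : Y.ncard ≤ X.ncard + 1)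
    {a x : V} (ha : a ∉ Y) (haC : ¬ C a) (hx : x ∈ X) : ¬ G.Reachable x a := by
  intro hr
  have hinj : ∀ f : V → V, (∀ v, f (f v) = v) → ∀ Z, Set.InjOn f Z := fun f hf Z u _ v _ h => by
    rw [← hf u, h, hf]
  have haX : a ∉ X := fun h => haC (hX a h)
  -- Two disjoint edges from Y to vertices outside X would extend to a perfect matching that sends X
  -- into Y minus two vertices, which is too small. Hence the edges from Y that leave X have a
  -- common end, either outside X or in Y.
  have two : ∀ y c y' c', y ∈ Y → c ∉ X → G.Adj y c → y' ∈ Y → c' ∉ X → G.Adj y' c' → y ≠ y' →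
      c = c' := by
    intro y c y' c' hy hc h hy' hc' h' hyy'
    by_contra hcc'
    have h1 := (hC _ _ h).not.1 (hY y hy)
    have h2 := (hC _ _ h').not.1 (hY y' hy')
    rw [not_not] at h1 h2
    obtain ⟨f, hf, hf', hfy, hfy'⟩ := hG.exists_involution_pair h h' (by
      rw [support_subgraphOfAdj, support_subgraphOfAdj, Set.disjoint_left]
      have hyc' : y ≠ c' := fun e => hY y hy (e ▸ h2)
      have hcy' : c ≠ y' := fun e => hY y' hy' (e ▸ h1)
      rintro v (rfl | rfl) (hv | hv)
      · exact hyy' hv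
      · exact hyc' hv
      · exact hcy' hv
      · exact hcc' hv)
    have h3 : X.ncard ≤ (Y \ {y, y'}).ncard := by
      refine Set.ncard_le_ncard_of_injOn f (fun v hv => ⟨hN v hv _ (hf' v), ?_⟩) (hinj f hf X)
      rintro (e | e)
      · exact hc (by rw [← hfy, ← e, hf]; exact hv)
      · exact hc' (by rw [← hfy', ← e, hf]; exact hv)
    have h4 := Set.ncard_sdiff_add_ncard_of_subset (s := {y, y'}) (t := Y)
      (by rintro v (rfl | rfl) <;> assumption)
    rw [Set.ncard_pair hyy'] at h4
    omega
  by_cases hb : ∃ y c, y ∈ Y ∧ c ∉ X ∧ G.Adj y c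
  swap
  · push Not at hb
    refine absurd (mem_of_reachable (Z := X ∪ Y) ?_ hr (.inl hx)) (by rintro (h | h) <;> tauto)
    rintro u v huv (hu | hu)
    · exact .inr (hN u hu v huv)
    · exact .inl (by by_contra h; exact hb u v hu h huv)
  obtain ⟨y₀, c₀, hy₀, hc₀, h₀⟩ := hb
  obtain ⟨f, hf, hf', hfy⟩ := hG.exists_involution h₀
  -- One leaving edge already forces |X| ≤ |Y| - 1; this is contradicted in both remaining cases.
  have hfX : X.ncard ≤ (Y \ {y₀}).ncard := by
    refine Set.ncard_le_ncard_of_injOn f (fun v hv => ⟨hN v hv _ (hf' v), ?_⟩) (hinj f hf X)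
    intro e
    exact hc₀ (by rw [← hfy, ← Set.mem_singleton_iff.1 e, hf]; exact hv)
  have hY1 := Set.ncard_sdiff_singleton_add_one hy₀
  by_cases hc : ∀ y c, y ∈ Y → c ∉ X → G.Adj y c → c = c₀
  -- All leaving edges end in c₀. If c₀ had a neighbour outside Y, a perfect matching using that
  -- edge would send Y into X.
  · refine absurd (mem_of_reachable (Z := X ∪ {c₀} ∪ Y) ?_ hr (.inl (.inl hx))) ?_
    · rintro u v huv ((hu | rfl) | hu)
      · exact .inr (hN u hu v huv)
      · obtain ⟨g, hg, hg', hgu⟩ := hG.exists_involution huv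
        by_contra hv
        have : Y.ncard ≤ X.ncard := by
          refine Set.ncard_le_ncard_of_injOn g (fun y hy => ?_) (hinj g hg Y)
          by_contra h
          have e := hc y _ hy h (hg' y)
          exact hv (.inr (by rw [← hgu, ← e, hg]; exact hy))
        omega
      · by_cases hv : v ∈ X
        · exact .inl (.inl hv)
        · exact .inl (.inr (hc u v hu hv huv))
    · rintro ((h | rfl) | h)
      · exact haX h
      · exact haC (by
          have := (hC _ _ h₀).not.1 (hY _ hy₀)
          rwa [not_not] at this)
      · exact ha h
  · push Not at hc
    obtain ⟨y₁, c₁, hy₁, hc₁, h₁, hne⟩ := hc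
    have hy₁₀ : y₁ = y₀ := by
      by_contra h
      exact hne (two _ _ _ _ hy₁ hc₁ h₁ hy₀ hc₀ h₀ h)
    subst hy₁₀
    have hy : ∀ y c, y ∈ Y → c ∉ X → G.Adj y c → y = y₁ := by
      intro y c hy hc h
      by_contra hyy
      have e1 := two _ _ _ _ hy hc h hy₁ hc₁ h₁ hyy
      have e2 := two _ _ _ _ hy hc h hy₁ hc₀ h₀ hyy
      exact hne (e1.symm.trans e2)
    have hX1 : ∀ u ∈ Y \ {y₁}, ∀ v, G.Adj u v → v ∈ X := by
      intro u hu v huv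
      by_contra hv
      exact hu.2 (hy u v hu.1 hv huv)
    -- All leaving edges start in y₁. If X had an edge to y₁, a perfect matching using it would send
    -- the rest of Y into the rest of X.
    refine absurd (mem_of_reachable (Z := X ∪ (Y \ {y₁})) ?_ hr (.inl hx)) (by
      rintro (h | h)
      · exact haX h
      · exact ha h.1)
    rintro u v huv (hu | hu)
    · refine .inr ⟨hN u hu v huv, ?_⟩
      intro e
      obtain rfl := Set.mem_singleton_iff.1 e
      obtain ⟨g, hg, hg', hgu⟩ := hG.exists_involution huv
      have h3 : (Y \ {v}).ncard ≤ (X \ {u}).ncard := by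
        refine Set.ncard_le_ncard_of_injOn g (fun y hy => ⟨hX1 y hy _ (hg' y), ?_⟩) (hinj g hg _)
        intro e'
        refine hy.2 ?_
        rw [Set.mem_singleton_iff, ← hgu, ← Set.mem_singleton_iff.1 e', hg]
      have := Set.ncard_sdiff_singleton_add_one hu
      omega
    · exact .inl (hX1 u hu v huv)

/-- In the digraph of an almost perfect matching of a brace, each vertex can be reached from both
sources. -/
theorem IsExtendable.reach_of_source [Finite V] (hG : G.IsExtendable 2) {A : V → Prop} {m : V → V}
    (hA : ∀ u v, G.Adj u v → (A u ↔ ¬ A v)) (hm : ∀ v, m (m v) = v)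
    (hadj : ∀ v, m v ≠ v → G.Adj v (m v)) {s s' t t' : V}
    (hfix : ∀ v, m v = v ↔ v = s ∨ v = s' ∨ v = t ∨ v = t') (hs : A s) (hs' : A s') (ht : ¬ A t)
    (ht' : ¬ A t') (hss' : s ≠ s') {v : V} (hv : A v) (hmv : m v ≠ v) (hr : G.Reachable s v) :
    Relation.ReflTransGen (fun v w => A v ∧ G.Adj v (m w)) s v := by
  by_contra hn
  let R : Set V := {w | Relation.ReflTransGen (fun v w => A v ∧ G.Adj v (m w)) s w}
  have hs'R : s' ∉ R := by
    intro h
    rcases Relation.ReflTransGen.cases_tail h with h | ⟨w, -, hw, hw'⟩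
    · exact hss' h.symm
    · rw [(hfix s').2 (by simp)] at hw'
      exact (hA _ _ hw').1 hw hs'
  have hadj' : ∀ v, m v ≠ v → (A v ↔ ¬ A (m v)) := fun v hv => hA _ _ (hadj v hv)
  -- X consists of the reached vertices of colour A, and Y of the vertices of the other colour whose
  -- partners are reached. If v is not reached, its partner lies outside Y but in the same
  -- component.
  refine hG.not_reachable hA (X := {w | A w ∧ w ∈ R}) (Y := {w | ¬ A w ∧ m w ∈ R}) (a := m v)
    (x := s) (fun _ h => h.1) (fun _ h => h.1) ?_ ?_ ?_ ?_ ⟨hs, .refl⟩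
    (hr.trans (hadj v hmv).reachable)
  · rintro x ⟨hx, hxR⟩ y hxy
    exact ⟨(hA _ _ hxy).1 hx, hxR.tail ⟨hx, by rw [hm]; exact hxy⟩⟩
  -- The partners of Y are reached vertices other than s, except that t and t' are their own
  -- partners; this gives |Y| ≤ (|X| - 1) + 2.
  · have hsub : {w | ¬ A w ∧ m w ∈ R} ⊆ (m '' ({w | A w ∧ w ∈ R} \ {s})) ∪ {t, t'} := by
      rintro w ⟨hw, hwR⟩
      by_cases h : m w = w
      · rcases (hfix w).1 h with rfl | rfl | rfl | rfl
        · exact absurd hs hw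
        · exact absurd hs' hw
        · simp
        · simp
      · refine .inl ⟨m w, ⟨⟨?_, hwR⟩, ?_⟩, hm w⟩
        · have := hadj' w h; tauto
        · intro e
          have e : m w = s := e
          have e2 := (hfix s).2 (by simp)
          rw [← e, hm] at e2
          exact h e2.symm
    have h1 := Set.ncard_le_ncard hsub
    have h2 := Set.ncard_union_le (m '' ({w | A w ∧ w ∈ R} \ {s})) {t, t'}
    have h3 := Set.ncard_image_le (f := m) (s := {w | A w ∧ w ∈ R} \ {s})
    have h4 := Set.ncard_sdiff_singleton_add_one (a := s) (s := {w | A w ∧ w ∈ R}) ⟨hs, .refl⟩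
    have h5 := Set.ncard_insert_le t {t'}
    rw [Set.ncard_singleton] at h5
    omega
  · rintro ⟨-, h⟩
    rw [hm] at h
    exact hn h
  · have := hadj' v hmv; tauto

/-- In the digraph of an almost perfect matching of a brace, both sinks can be reached from each
vertex. -/
theorem IsExtendable.reach_to_sink [Finite V] (hG : G.IsExtendable 2) {A : V → Prop} {m : V → V}
    (hA : ∀ u v, G.Adj u v → (A u ↔ ¬ A v)) (hm : ∀ v, m (m v) = v)
    (hadj : ∀ v, m v ≠ v → G.Adj v (m v)) {s s' t t' : V}
    (hfix : ∀ v, m v = v ↔ v = s ∨ v = s' ∨ v = t ∨ v = t') (hs : A s) (hs' : A s') (ht : ¬ A t)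
    (ht' : ¬ A t') (htt' : t ≠ t') {v : V} (hv : A v) (hmv : m v ≠ v) (hr : G.Reachable t v) :
    Relation.ReflTransGen (fun v w => A v ∧ G.Adj v (m w)) v t := by
  have hadj' : ∀ v, m v ≠ v → (A v ↔ ¬ A (m v)) := fun v hv => hA _ _ (hadj v hv)
  -- Exchanging the colours turns sinks into sources; the resulting digraph is the reversed one,
  -- read on the partners.
  have h := hG.reach_of_source (A := fun v => ¬ A v) (m := m)
    (fun u v h => not_congr (hA u v h)) hm hadj (s := t) (s' := t') (t := s) (t' := s')
    (fun v => (hfix v).trans (by tauto)) ht ht' (not_not.2 hs) (not_not.2 hs') htt' (v := m v)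
    ((hadj' v hmv).1 hv) (by rw [hm]; exact hmv.symm) (hr.trans (hadj v hmv).reachable)
  have key : ∀ w, Relation.ReflTransGen (fun v w => ¬ A v ∧ G.Adj v (m w)) t w →
      Relation.ReflTransGen (fun v w => A v ∧ G.Adj v (m w)) (m w) t := by
    intro w hw
    induction hw with
    | refl => rw [(hfix t).2 (by simp)]
    | @tail b c _ hbc ih =>
      refine .head ⟨?_, ?_⟩ ih
      · have := hA _ _ hbc.2; tauto
      · rw [hm]; exact hbc.2.symm
  simpa [hm] using key _ h

end SimpleGraph

/-! ### From circuits with legs to gadgets and thetas -/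

namespace SimpleGraph

variable {V : Type*} {G : SimpleGraph V} {A : V → Prop} {m : V → V}

/-- A list that consists of consecutive pairs of adjacent vertices, of which the second one has the
colour `A`. -/
inductive PairList (G : SimpleGraph V) (A : V → Prop) : List V → Prop
  | nil : PairList G A []
  | cons {a b : V} {l : List V} : G.Adj a b → ¬ A a → A b → PairList G A l →
      PairList G A (a :: b :: l)

/-- The map `m` exchanges the two elements of each consecutive pair. -/
inductive Swaps (m : V → V) : List V → Prop
  | nil : Swaps m []
  | cons {a b : V} {l : List V} : m a = b → m b = a → Swaps m l → Swaps m (a :: b :: l)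

/-- The second elements of the consecutive pairs of a list. -/
def seconds : List V → List V
  | _ :: b :: l => b :: seconds l
  | _ => []

theorem PairList.append {l l' : List V} (h : PairList G A l) (h' : PairList G A l') :
    PairList G A (l ++ l') := by
  induction h with
  | nil => exact h'
  | cons h1 h2 h3 _ ih => exact .cons h1 h2 h3 ih

theorem PairList.of_isChain (hA : ∀ u v, G.Adj u v → (A u ↔ ¬ A v)) :
    ∀ {l : List V}, (∀ a, l.head? = some a → ¬ A a) → List.IsChain G.Adj l → Even l.length →
      PairList G A l
  | [], _, _, _ => .nil
  | [a], _, _, h => by simp at h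
  | a :: b :: l, ha, hc, he => by
    rw [List.isChain_cons_cons] at hc
    have h1 := ha a rfl
    have h2 := hA _ _ hc.1
    refine .cons hc.1 h1 (by tauto) (PairList.of_isChain hA ?_ hc.2.of_cons
      (by simpa [parity_simps] using he))
    intro c hcl
    cases l with
    | nil => simp at hcl
    | cons d l =>
      obtain rfl : d = c := by simpa using hcl
      have := hA _ _ (List.isChain_cons_cons.1 hc.2).1
      tauto

theorem PairList.of_path (hA : ∀ u v, G.Adj u v → (A u ↔ ¬ A v)) {u v : V} {l : List V}
    (hc : List.IsChain G.Adj (u :: (l ++ [v]))) (hu : A u) (he : Even l.length) :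
    PairList G A l := by
  refine .of_isChain hA ?_ hc.of_cons.left_of_append he
  intro a ha
  cases l with
  | nil => simp at ha
  | cons d l =>
    obtain rfl : d = a := by simpa using ha
    rw [List.cons_append, List.isChain_cons_cons] at hc
    exact (hA _ _ hc.1).1 hu

theorem PairList.mem_seconds {l : List V} (h : PairList G A l) {v : V} :
    v ∈ seconds l ↔ v ∈ l ∧ A v := by
  induction h with
  | nil => simp [seconds]
  | @cons a b l h1 h2 h3 _ ih =>
    simp only [seconds, List.mem_cons, ih]
    constructor
    · rintro (rfl | h)
      · exact ⟨.inr (.inl rfl), h3⟩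
      · exact ⟨.inr (.inr h.1), h.2⟩
    · rintro ⟨rfl | rfl | h, hv⟩
      · exact absurd hv h2
      · exact .inl rfl
      · exact .inr ⟨h, hv⟩

theorem PairList.seconds_append {l : List V} (h : PairList G A l) (l' : List V) :
    seconds (l ++ l') = seconds l ++ seconds l' := by
  induction h with
  | nil => rfl
  | cons h1 h2 h3 _ ih => simp [seconds, ih]

theorem PairList.nodup_seconds {l : List V} (h : PairList G A l) (hn : l.Nodup) :
    (seconds l).Nodup := by
  induction h with
  | nil => exact List.nodup_nil
  | cons h1 h2 h3 h ih =>
    have hn' := (List.nodup_cons.1 hn).2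
    rw [seconds, List.nodup_cons, h.mem_seconds]
    exact ⟨fun h => (List.nodup_cons.1 hn').1 h.1, ih (List.nodup_cons.1 hn').2⟩

theorem PairList.seconds_ne_nil {l : List V} (h : PairList G A l) (hl : l ≠ []) :
    seconds l ≠ [] := by
  cases h with
  | nil => exact absurd rfl hl
  | cons _ _ _ _ => simp [seconds]

theorem PairList.mem_of_swaps {l : List V} (h : PairList G A l) (hm : Swaps m l) {v : V}
    (hv : v ∈ l) : m v ∈ l ∧ m (m v) = v ∧ G.Adj v (m v) := by
  induction h with
  | nil => simp at hv
  | cons h1 h2 h3 _ ih =>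
    cases hm with
    | cons ha hb hm =>
      rcases List.mem_cons.1 hv with rfl | hv
      · exact ⟨by simp [ha], by rw [ha, hb], ha.symm ▸ h1⟩
      rcases List.mem_cons.1 hv with rfl | hv
      · exact ⟨by simp [hb], by rw [hb, ha], hb.symm ▸ h1.symm⟩
      · have := ih hm hv
        exact ⟨by simp [this.1], this.2⟩

theorem PairList.swaps_append {l l' : List V} (h : PairList G A l) :
    Swaps m (l ++ l') ↔ Swaps m l ∧ Swaps m l' := by
  induction h with
  | nil => exact ⟨fun h => ⟨.nil, h⟩, fun h => h.2⟩
  | cons _ _ _ _ ih =>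
    constructor
    · rintro (_ | ⟨ha, hb, h⟩)
      exact ⟨.cons ha hb (ih.1 h).1, (ih.1 h).2⟩
    · rintro ⟨_ | ⟨ha, hb, h⟩, h'⟩
      exact .cons ha hb (ih.2 ⟨h, h'⟩)

theorem Swaps.congr {m' : V → V} {l : List V} (h : Swaps m l) (hm : ∀ v ∈ l, m' v = m v) :
    Swaps m' l := by
  induction h with
  | nil => exact .nil
  | @cons a b l ha hb _ ih =>
    exact .cons (by rw [hm a (by simp), ha]) (by rw [hm b (by simp), hb])
      (ih fun v hv => hm v (by simp [hv]))

/-- The map `m₀` stands for the matching off the model, which is kept while the pairs of the list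
are installed. -/
theorem PairList.exists_swaps {l : List V} (h : PairList G A l) (hn : l.Nodup) (m₀ : V → V) :
    ∃ m, Swaps m l ∧ ∀ v ∉ l, m v = m₀ v := by
  classical
  induction h with
  | nil => exact ⟨m₀, .nil, fun _ _ => rfl⟩
  | @cons a b l h1 h2 h3 _ ih =>
    simp only [List.nodup_cons, List.mem_cons, not_or] at hn
    obtain ⟨⟨hab, hal⟩, hbl, hl⟩ := hn
    obtain ⟨m, hm, hm'⟩ := ih hl
    refine ⟨Function.update (Function.update m b a) a b, .cons (by simp)
      (by rw [Function.update_of_ne (Ne.symm hab), Function.update_self]) (hm.congr ?_), ?_⟩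
    · intro v hv
      rw [Function.update_of_ne (by rintro rfl; exact hal hv),
        Function.update_of_ne (by rintro rfl; exact hbl hv)]
    · intro v hv
      simp only [List.mem_cons, not_or] at hv
      rw [Function.update_of_ne hv.1, Function.update_of_ne hv.2.1, hm' v hv.2.2]

/-- The inverse of `expand`: contracting the matched pairs of a path of G leaves a directed path on
their members of colour A. -/
theorem PairList.isChain_seconds_cons {l : List V} (h : PairList G A l) (hm : Swaps m l) {u t : V}
    (hu : A u) (ht : m t = t) (hc : List.IsChain G.Adj (u :: (l ++ [t]))) :
    List.IsChain (fun v w => A v ∧ G.Adj v (m w)) (u :: (seconds l ++ [t])) := by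
  induction h generalizing u with
  | nil =>
    have h' : G.Adj u t := by simpa using hc
    simpa [seconds, ht] using ⟨hu, h'⟩
  | cons h1 h2 h3 _ ih =>
    cases hm with
    | cons ha hb hm =>
      simp only [List.cons_append, List.isChain_cons_cons, seconds] at hc ⊢
      exact ⟨⟨hu, by rw [hb]; exact hc.1⟩, ih hm h3 hc.2.2⟩

theorem PairList.isChain_seconds {l : List V} (h : PairList G A l) (hm : Swaps m l)
    (hc : List.IsChain G.Adj l) : List.IsChain (fun v w => A v ∧ G.Adj v (m w)) (seconds l) := by
  have key : ∀ {l : List V}, PairList G A l → Swaps m l → ∀ u, A u → List.IsChain G.Adj (u :: l) →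
      List.IsChain (fun v w => A v ∧ G.Adj v (m w)) (u :: seconds l) := by
    intro l h
    induction h with
    | nil => intro _ u _ _; simp [seconds]
    | cons h1 h2 h3 _ ih =>
      intro hm u hu hc
      cases hm with
      | cons ha hb hm =>
        simp only [List.isChain_cons_cons, seconds] at hc ⊢
        exact ⟨⟨hu, by rw [hb]; exact hc.1⟩, ih hm _ h3 hc.2.2⟩
  cases h with
  | nil => simp [seconds]
  | cons h1 h2 h3 h =>
    cases hm with
    | cons ha hb hm => exact key h hm _ h3 (List.isChain_cons_cons.1 hc).2

/-- A circuit through `c 0, …, c 3` with paths that join these vertices to `s 0, …, s 3`. -/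
structure LeggedCircuit (G : SimpleGraph V) (s : Fin 4 → V) where
  c : Fin 4 → V
  leg : Fin 4 → List V
  cyc : Fin 4 → List V
  chain_leg : ∀ j, List.IsChain G.Adj (s j :: (leg j ++ [c j]))
  chain_cyc : ∀ j, List.IsChain G.Adj (c j :: (cyc j ++ [c (j + 1)]))
  even_leg : ∀ j, Even (leg j).length
  even_cyc : ∀ j, Even (cyc j).length
  nodup : (c 0 :: c 1 :: c 2 :: c 3 :: (leg 0 ++ (leg 1 ++ (leg 2 ++ (leg 3 ++ (cyc 0 ++ (cyc 1 ++
    (cyc 2 ++ cyc 3)))))))).Nodup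

namespace LeggedCircuit

variable {s : Fin 4 → V}

/-- The same circuit in a larger graph. -/
def mono {G' : SimpleGraph V} (C : LeggedCircuit G s) (h : G ≤ G') : LeggedCircuit G' s where
  c := C.c
  leg := C.leg
  cyc := C.cyc
  chain_leg j := (C.chain_leg j).imp fun _ _ h' => h h'
  chain_cyc j := (C.chain_cyc j).imp fun _ _ h' => h h'
  even_leg := C.even_leg
  even_cyc := C.even_cyc
  nodup := C.nodup

variable (C : LeggedCircuit G s)

/-- The vertices of the circuit and its legs, in matched pairs. -/
def all : List V :=
  C.leg 0 ++ (C.c 0 :: (C.cyc 0 ++ [C.c 1]) ++ ((C.leg 1).reverse ++ (C.cyc 1 ++ (C.leg 2 ++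
    (C.c 2 :: (C.cyc 2 ++ [C.c 3]) ++ ((C.leg 3).reverse ++ C.cyc 3))))))

theorem perm_all : (C.c 0 :: C.c 1 :: C.c 2 :: C.c 3 :: (C.leg 0 ++ (C.leg 1 ++ (C.leg 2 ++
    (C.leg 3 ++ (C.cyc 0 ++ (C.cyc 1 ++ (C.cyc 2 ++ C.cyc 3)))))))).Perm C.all := by
  classical
  rw [List.perm_iff_count]
  intro v
  simp only [all, List.count_cons, List.count_append, List.count_nil, List.count_reverse]
  omega

theorem nodup_all : C.all.Nodup := C.perm_all.nodup_iff.1 C.nodup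

theorem mem_all {v : V} : v ∈ C.all ↔ ∃ j, v = C.c j ∨ v ∈ C.leg j ∨ v ∈ C.cyc j := by
  rw [← C.perm_all.mem_iff]
  simp only [Fin.exists_fin_succ, List.mem_cons, List.mem_append, IsEmpty.exists_iff, or_false]
  have h1 : Fin.succ (0 : Fin 3) = (1 : Fin 4) := rfl
  have h2 : Fin.succ (Fin.succ (0 : Fin 2)) = (2 : Fin 4) := rfl
  have h3 : Fin.succ (Fin.succ (Fin.succ (0 : Fin 1))) = (3 : Fin 4) := rfl
  rw [h1, h2, h3]
  tauto

theorem colour_c (hA : ∀ u v, G.Adj u v → (A u ↔ ¬ A v)) (j : Fin 4) : A (s j) ↔ ¬ A (C.c j) :=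
  (even_length_iff_of_isChain hA (C.chain_leg j)).1 (C.even_leg j)

theorem colour_c_succ (hA : ∀ u v, G.Adj u v → (A u ↔ ¬ A v)) (j : Fin 4) :
    A (C.c j) ↔ ¬ A (C.c (j + 1)) :=
  (even_length_iff_of_isChain hA (C.chain_cyc j)).1 (C.even_cyc j)

theorem colour (hA : ∀ u v, G.Adj u v → (A u ↔ ¬ A v)) (h0 : A (s 0)) :
    (¬ A (s 1) ∧ A (s 2) ∧ ¬ A (s 3)) ∧ ¬ A (C.c 0) ∧ A (C.c 1) ∧ ¬ A (C.c 2) ∧ A (C.c 3) := by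
  have h0' := C.colour_c hA 0
  have h1 := C.colour_c hA 1
  have h2 := C.colour_c hA 2
  have h3 := C.colour_c hA 3
  have h01 : A (C.c 0) ↔ ¬ A (C.c 1) := C.colour_c_succ hA 0
  have h12 : A (C.c 1) ↔ ¬ A (C.c 2) := C.colour_c_succ hA 1
  have h23 : A (C.c 2) ↔ ¬ A (C.c 3) := C.colour_c_succ hA 2
  tauto

theorem pairLists (hA : ∀ u v, G.Adj u v → (A u ↔ ¬ A v)) (h0 : A (s 0)) :
    PairList G A (C.leg 0) ∧ PairList G A (C.c 0 :: (C.cyc 0 ++ [C.c 1])) ∧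
    PairList G A (C.leg 1).reverse ∧ PairList G A (C.cyc 1) ∧ PairList G A (C.leg 2) ∧
    PairList G A (C.c 2 :: (C.cyc 2 ++ [C.c 3])) ∧ PairList G A (C.leg 3).reverse ∧
    PairList G A (C.cyc 3) := by
  obtain ⟨⟨h1, h2, h3⟩, k0, k1, k2, k3⟩ := C.colour hA h0
  refine ⟨.of_path hA (C.chain_leg 0) h0 (C.even_leg 0),
    .of_isChain hA ?_ (C.chain_cyc 0) ?_,
    .of_path hA (isChain_reverse_path (C.chain_leg 1)) k1 (by simpa using C.even_leg 1),
    .of_path hA (C.chain_cyc 1) k1 (C.even_cyc 1),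
    .of_path hA (C.chain_leg 2) h2 (C.even_leg 2),
    .of_isChain hA ?_ (C.chain_cyc 2) ?_,
    .of_path hA (isChain_reverse_path (C.chain_leg 3)) k3 (by simpa using C.even_leg 3),
    .of_path hA (C.chain_cyc 3) k3 (C.even_cyc 3)⟩
  · intro a ha
    obtain rfl : C.c 0 = a := by simpa using ha
    exact k0
  · simpa [parity_simps] using C.even_cyc 0
  · intro a ha
    obtain rfl : C.c 2 = a := by simpa using ha
    exact k2
  · simpa [parity_simps] using C.even_cyc 2

theorem pairList_all (hA : ∀ u v, G.Adj u v → (A u ↔ ¬ A v)) (h0 : A (s 0)) :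
    PairList G A C.all := by
  obtain ⟨p1, p2, p3, p4, p5, p6, p7, p8⟩ := C.pairLists hA h0
  exact p1.append (p2.append (p3.append (p4.append (p5.append (p6.append (p7.append p8))))))

/-- The digraph of a circuit with legs and a matching. -/
noncomputable def gadget (hA : ∀ u v, G.Adj u v → (A u ↔ ¬ A v)) (h0 : A (s 0))
    (hm : Swaps m C.all) (h1 : m (s 1) = s 1) (h3 : m (s 3) = s 3) :
    DigraphLinkage.Gadget (fun v w => A v ∧ G.Adj v (m w)) (s 0) (s 2) (s 1) (s 3) where
  i₀ := seconds (C.leg 0)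
  x₀₁ := seconds (C.c 0 :: (C.cyc 0 ++ [C.c 1]))
  o₁ := seconds (C.leg 1).reverse
  x₁₂ := seconds (C.cyc 1)
  i₂ := seconds (C.leg 2)
  x₂₃ := seconds (C.c 2 :: (C.cyc 2 ++ [C.c 3]))
  o₃ := seconds (C.leg 3).reverse
  x₃₀ := seconds (C.cyc 3)
  ne₀₁ := (C.pairLists hA h0).2.1.seconds_ne_nil (by simp)
  ne₂₃ := (C.pairLists hA h0).2.2.2.2.2.1.seconds_ne_nil (by simp)
  chain₀ := by
    obtain ⟨p1, p2, p3, p4, p5, p6, p7, p8⟩ := C.pairLists hA h0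
    simp only [all, p1.swaps_append, p2.swaps_append, p3.swaps_append] at hm
    have h := (p1.append (p2.append p3)).isChain_seconds_cons (m := m)
      (p1.swaps_append.2 ⟨hm.1, p2.swaps_append.2 ⟨hm.2.1, hm.2.2.1⟩⟩) h0 h1 (by
        have := isChain_join (C.chain_leg 0) (isChain_join (C.chain_cyc 0)
          (isChain_reverse_path (C.chain_leg 1)))
        simpa using this)
    rw [p1.seconds_append, p2.seconds_append] at h
    simpa using h
  chain₂ := by
    obtain ⟨p1, p2, p3, p4, p5, p6, p7, p8⟩ := C.pairLists hA h0
    simp only [all, p1.swaps_append, p2.swaps_append, p3.swaps_append, p4.swaps_append,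
      p5.swaps_append, p6.swaps_append, p7.swaps_append] at hm
    have h := (p5.append (p6.append p7)).isChain_seconds_cons (m := m)
      (p5.swaps_append.2 ⟨hm.2.2.2.2.1, p6.swaps_append.2 ⟨hm.2.2.2.2.2.1, hm.2.2.2.2.2.2.1⟩⟩)
      (C.colour hA h0).1.2.1 h3 (by
        have := isChain_join (C.chain_leg 2) (isChain_join (C.chain_cyc 2)
          (isChain_reverse_path (C.chain_leg 3)))
        simpa using this)
    rw [p5.seconds_append, p6.seconds_append] at h
    simpa using h
  link₀₂ := by
    obtain ⟨p1, p2, p3, p4, p5, p6, p7, p8⟩ := C.pairLists hA h0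
    simp only [all, p1.swaps_append, p2.swaps_append, p3.swaps_append, p4.swaps_append,
      p5.swaps_append, p6.swaps_append, p7.swaps_append] at hm
    have h := (p2.append (p4.append p6)).isChain_seconds (m := m)
      (p2.swaps_append.2 ⟨hm.2.1, p4.swaps_append.2 ⟨hm.2.2.2.1, hm.2.2.2.2.2.1⟩⟩) (by
        have := isChain_join (C.chain_cyc 0) (isChain_join (C.chain_cyc 1) (C.chain_cyc 2))
        simpa using this)
    rwa [p2.seconds_append, p4.seconds_append] at h
  link₂₀ := by
    obtain ⟨p1, p2, p3, p4, p5, p6, p7, p8⟩ := C.pairLists hA h0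
    simp only [all, p1.swaps_append, p2.swaps_append, p3.swaps_append, p4.swaps_append,
      p5.swaps_append, p6.swaps_append, p7.swaps_append] at hm
    have h := (p6.append (p8.append p2)).isChain_seconds (m := m)
      (p6.swaps_append.2 ⟨hm.2.2.2.2.2.1, p8.swaps_append.2 ⟨hm.2.2.2.2.2.2.2, hm.2.1⟩⟩) (by
        have := isChain_join (C.chain_cyc 2) (isChain_join (C.chain_cyc 3) (C.chain_cyc 0))
        simpa using this)
    rwa [p6.seconds_append, p8.seconds_append] at h
  nodup := by
    obtain ⟨p1, p2, p3, p4, p5, p6, p7, p8⟩ := C.pairLists hA h0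
    have h := (C.pairList_all hA h0).nodup_seconds C.nodup_all
    rwa [all, p1.seconds_append, p2.seconds_append, p3.seconds_append, p4.seconds_append,
      p5.seconds_append, p6.seconds_append, p7.seconds_append] at h

theorem mem_gadget (hA : ∀ u v, G.Adj u v → (A u ↔ ¬ A v)) (h0 : A (s 0))
    (hm : Swaps m C.all) (h1 : m (s 1) = s 1) (h3 : m (s 3) = s 3) {v : V} :
    v ∈ (C.gadget hA h0 hm h1 h3).all ↔ v ∈ C.all ∧ A v := by
  obtain ⟨p1, p2, p3, p4, p5, p6, p7, p8⟩ := C.pairLists hA h0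
  rw [← (C.pairList_all hA h0).mem_seconds, all, p1.seconds_append, p2.seconds_append,
    p3.seconds_append, p4.seconds_append, p5.seconds_append, p6.seconds_append, p7.seconds_append]
  rfl

theorem sum_fin_four (f : Fin 4 → ℕ) (j : Fin 4) :
    f 0 + f 1 + f 2 + f 3 = f j + f (j + 1) + f (j + 1 + 1) + f (j + 1 + 1 + 1) := by
  match j with
  | 0 => rfl
  | 1 => exact (by omega : f 0 + f 1 + f 2 + f 3 = f 1 + f 2 + f 3 + f 0)
  | 2 => exact (by omega : f 0 + f 1 + f 2 + f 3 = f 2 + f 3 + f 0 + f 1)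
  | 3 => exact (by omega : f 0 + f 1 + f 2 + f 3 = f 3 + f 0 + f 1 + f 2)

theorem perm_all_shift (j : Fin 4) : C.all.Perm
    (C.c j :: C.c (j + 1) :: C.c (j + 1 + 1) :: C.c (j + 1 + 1 + 1) :: (C.leg j ++ (C.leg (j + 1) ++
    (C.leg (j + 1 + 1) ++ (C.leg (j + 1 + 1 + 1) ++ (C.cyc j ++ (C.cyc (j + 1) ++
    (C.cyc (j + 1 + 1) ++ C.cyc (j + 1 + 1 + 1))))))))) := by
  classical
  refine C.perm_all.symm.trans ?_
  rw [List.perm_iff_count]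
  intro v
  have h1 := sum_fin_four (fun j => List.count v [C.c j]) j
  have h2 := sum_fin_four (fun j => List.count v (C.leg j)) j
  have h3 := sum_fin_four (fun j => List.count v (C.cyc j)) j
  simp only [List.count_cons, List.count_append, List.count_nil] at h1 h2 h3 ⊢
  omega

/-- The five paths of a circuit with legs, in one orientation of the circuit. -/
def theta (hA : ∀ u v, G.Adj u v → (A u ↔ ¬ A v)) (j : Fin 4) (hj : A (s j)) :
    Theta G A {v | v ∈ C.all} (s j) (s (j + 1 + 1)) (s (j + 1)) (s (j + 1 + 1 + 1)) := by
  have hperm : C.all.Perm (C.c (j + 1 + 1) :: C.c (j + 1 + 1 + 1) ::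
      ((C.cyc (j + 1 + 1 + 1) ++ C.c j :: (C.leg j).reverse) ++
        ((C.leg (j + 1) ++ C.c (j + 1) :: C.cyc (j + 1)) ++ ((C.cyc (j + 1 + 1)).reverse ++
          (C.leg (j + 1 + 1) ++ ((C.leg (j + 1 + 1 + 1)).reverse ++ C.cyc j)))))) := by
    classical
    refine (C.perm_all_shift j).trans ?_
    rw [List.perm_iff_count]
    intro v
    simp only [List.count_cons, List.count_append, List.count_reverse]
    omega
  have h4 : j + 1 + 1 + 1 + 1 = j := (by decide : ∀ j : Fin 4, j + 1 + 1 + 1 + 1 = j) j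
  have h := C.chain_cyc (j + 1 + 1 + 1)
  rw [h4] at h
  have hc := C.colour_c hA j
  have hc1 := C.colour_c_succ hA j
  have hc2 := C.colour_c_succ hA (j + 1)
  have hc3 := C.colour_c_succ hA (j + 1 + 1)
  exact
  { α := C.c (j + 1 + 1)
    β := C.c (j + 1 + 1 + 1)
    T₁ := C.cyc (j + 1 + 1 + 1) ++ C.c j :: (C.leg j).reverse
    T₂ := C.leg (j + 1) ++ C.c (j + 1) :: C.cyc (j + 1)
    T₃ := (C.cyc (j + 1 + 1)).reverse
    T₄ := C.leg (j + 1 + 1)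
    T₅ := (C.leg (j + 1 + 1 + 1)).reverse
    -- The only segment of the circuit that the five paths do not use is the one between the ends of
    -- the legs of a and c; it is matched within itself.
    R := C.cyc j
    mem_iff := fun v => hperm.mem_iff
    nodup := hperm.nodup_iff.1 C.nodup_all
    chain₁ := isChain_join h (isChain_reverse_path (C.chain_leg j))
    chain₂ := isChain_join (C.chain_leg (j + 1)) (C.chain_cyc (j + 1))
    chain₃ := isChain_reverse_path (C.chain_cyc (j + 1 + 1))
    chain₄ := C.chain_leg (j + 1 + 1)
    chain₅ := isChain_reverse_path (C.chain_leg (j + 1 + 1 + 1))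
    chainR := (C.chain_cyc j).of_cons.left_of_append
    evenR := C.even_cyc j
    colour_α := by tauto
    colour_β := by tauto }

/-- The five paths of a circuit with legs, in the other orientation of the circuit. -/
def thetaReverse (hA : ∀ u v, G.Adj u v → (A u ↔ ¬ A v)) (j : Fin 4) (hj : A (s j)) :
    Theta G A {v | v ∈ C.all} (s j) (s (j + 1 + 1)) (s (j + 1 + 1 + 1)) (s (j + 1)) := by
  have hperm : C.all.Perm (C.c (j + 1 + 1) :: C.c (j + 1) ::
      (((C.cyc j).reverse ++ C.c j :: (C.leg j).reverse) ++
        ((C.leg (j + 1 + 1 + 1) ++ C.c (j + 1 + 1 + 1) :: (C.cyc (j + 1 + 1)).reverse) ++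
          (C.cyc (j + 1) ++ (C.leg (j + 1 + 1) ++ ((C.leg (j + 1)).reverse ++
            C.cyc (j + 1 + 1 + 1))))))) := by
    classical
    refine (C.perm_all_shift j).trans ?_
    rw [List.perm_iff_count]
    intro v
    simp only [List.count_cons, List.count_append, List.count_reverse]
    omega
  have hc := C.colour_c hA j
  have hc1 := C.colour_c_succ hA j
  have hc2 := C.colour_c_succ hA (j + 1)
  exact
  { α := C.c (j + 1 + 1)
    β := C.c (j + 1)
    T₁ := (C.cyc j).reverse ++ C.c j :: (C.leg j).reverse
    T₂ := C.leg (j + 1 + 1 + 1) ++ C.c (j + 1 + 1 + 1) :: (C.cyc (j + 1 + 1)).reverse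
    T₃ := C.cyc (j + 1)
    T₄ := C.leg (j + 1 + 1)
    T₅ := (C.leg (j + 1)).reverse
    R := C.cyc (j + 1 + 1 + 1)
    mem_iff := fun v => hperm.mem_iff
    nodup := hperm.nodup_iff.1 C.nodup_all
    chain₁ := isChain_join (isChain_reverse_path (C.chain_cyc j))
      (isChain_reverse_path (C.chain_leg j))
    chain₂ := isChain_join (C.chain_leg (j + 1 + 1 + 1))
      (isChain_reverse_path (C.chain_cyc (j + 1 + 1)))
    chain₃ := C.chain_cyc (j + 1)
    chain₄ := C.chain_leg (j + 1 + 1)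
    chain₅ := isChain_reverse_path (C.chain_leg (j + 1))
    chainR := (C.chain_cyc (j + 1 + 1 + 1)).of_cons.left_of_append
    evenR := C.even_cyc (j + 1 + 1 + 1)
    colour_α := by tauto
    colour_β := by tauto }

theorem reachable_of_isChain {u v : V} {l : List V} (h : List.IsChain G.Adj (u :: l))
    (hv : v ∈ u :: l) : G.Reachable u v := by
  induction l generalizing u with
  | nil => obtain rfl := List.mem_singleton.1 hv; exact .rfl
  | cons a l ih =>
    rcases List.mem_cons.1 hv with rfl | hv
    · exact .rfl
    · rw [List.isChain_cons_cons] at h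
      exact h.1.reachable.trans (ih h.2 hv)

theorem reachable_s (j : Fin 4) : G.Reachable (s j) (C.c j) :=
  reachable_of_isChain (C.chain_leg j) (by simp)

theorem reachable_c (j : Fin 4) : G.Reachable (C.c 0) (C.c j) := by
  have h : ∀ j, G.Reachable (C.c j) (C.c (j + 1)) := fun j =>
    reachable_of_isChain (C.chain_cyc j) (by simp)
  match j with
  | 0 => exact .rfl
  | 1 => exact h 0
  | 2 => exact (h 0).trans (h 1)
  | 3 => exact ((h 0).trans (h 1)).trans (h 2)

theorem reachable {v : V} (hv : v ∈ C.all) : G.Reachable (C.c 0) v := by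
  obtain ⟨j, rfl | hv | hv⟩ := C.mem_all.1 hv
  · exact C.reachable_c j
  · exact ((C.reachable_c j).trans (C.reachable_s j).symm).trans
      (reachable_of_isChain (C.chain_leg j) (by simp [hv]))
  · exact (C.reachable_c j).trans (reachable_of_isChain (C.chain_cyc j) (by simp [hv]))

/-- A circuit with legs is connected without the ends of the legs. -/
theorem reachable_of_notMem {T : SimpleGraph V} {S : Set V}
    (hT : ∀ u v, G.Adj u v → u ∉ S → v ∉ S → T.Adj u v) (hS : ∀ v ∈ C.all, v ∉ S) {v : V}
    (hv : v ∈ C.all) : T.Reachable (C.c 0) v := by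
  have hl : ∀ {u l}, List.IsChain G.Adj (u :: l) → (∀ v ∈ u :: l, v ∈ C.all) →
      List.IsChain T.Adj (u :: l) := by
    intro u l h hl
    induction l generalizing u with
    | nil => simp
    | cons a l ih =>
      rw [List.isChain_cons_cons] at h ⊢
      exact ⟨hT _ _ h.1 (hS u (hl u (by simp))) (hS a (hl a (by simp))),
        ih h.2 fun v hv => hl v (by simp [hv])⟩
  have hc : ∀ j, List.IsChain T.Adj (C.c j :: (C.cyc j ++ [C.c (j + 1)])) := fun j => by
    refine hl (C.chain_cyc j) fun v hv => C.mem_all.2 ?_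
    rcases List.mem_cons.1 hv with h | h
    · exact ⟨j, .inl h⟩
    rcases List.mem_append.1 h with h | h
    · exact ⟨j, .inr (.inr h)⟩
    · exact ⟨j + 1, .inl (List.mem_singleton.1 h)⟩
  have hc' : ∀ j, T.Reachable (C.c j) (C.c (j + 1)) := fun j =>
    reachable_of_isChain (hc j) (by simp)
  have h0 : ∀ j, T.Reachable (C.c 0) (C.c j) := fun j =>
    match j with
    | 0 => .rfl
    | 1 => hc' 0
    | 2 => (hc' 0).trans (hc' 1)
    | 3 => ((hc' 0).trans (hc' 1)).trans (hc' 2)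
  obtain ⟨j, rfl | hv | hv⟩ := C.mem_all.1 hv
  · exact h0 j
  · have h := (isChain_reverse_path (C.chain_leg j))
    rw [← List.cons_append] at h
    have h := hl h.left_of_append fun v hv => C.mem_all.2 (by
      rcases List.mem_cons.1 hv with h | h
      · exact ⟨j, .inl h⟩
      · exact ⟨j, .inr (.inl (List.mem_reverse.1 h))⟩)
    exact (h0 j).trans (reachable_of_isChain h (by simp [hv]))
  · exact (h0 j).trans (reachable_of_isChain (hc j) (by simp [hv]))

end LeggedCircuit
end SimpleGraph

/-! ### The circuits of a model of Rotunda -/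

namespace SimpleGraph

variable {V W : Type*} {G : SimpleGraph V} {R : SimpleGraph W}

theorem nodup_sum_count {ι : Type*} [Fintype ι] [DecidableEq V] {f : ι → List V}
    (hn : ∀ x, (f x).Nodup) (hd : ∀ x y v, v ∈ f x → v ∈ f y → x = y) (v : V) :
    ∑ x, (f x).count v ≤ 1 := by
  classical
  by_cases h : ∃ x, v ∈ f x
  · obtain ⟨x, hx⟩ := h
    rw [Finset.sum_eq_single_of_mem x (Finset.mem_univ _) fun y _ hy =>
      List.count_eq_zero_of_not_mem fun h => hy (hd _ _ v h hx)]
    exact List.nodup_iff_count_le_one.1 (hn x) v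
  · push Not at h
    rw [Finset.sum_eq_zero fun x _ => List.count_eq_zero_of_not_mem (h x)]
    exact zero_le_one

namespace EvenEmbedding

variable (φ : EvenEmbedding R G)

/-- The inner vertices of the path of an edge. -/
def interior {w w' : W} (h : R.Adj w w') : List V := (φ.path h).support.tail.dropLast

theorem support_eq {w w' : W} (h : R.Adj w w') :
    (φ.path h).support = φ.vert w :: (φ.interior h ++ [φ.vert w']) := by
  have h1 := (φ.path h).cons_tail_support
  have h2 : (φ.path h).support.tail ≠ [] := by
    intro h3
    rw [h3] at h1
    have h4 := (φ.path h).end_mem_support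
    rw [← h1, List.mem_singleton] at h4
    exact h.ne' (φ.vert_injective h4)
  have h3 : (φ.path h).support.tail.getLast h2 = φ.vert w' := by
    rw [List.getLast_tail]
    exact (φ.path h).getLast_support
  have h5 := List.dropLast_append_getLast h2
  rw [h3] at h5
  rw [← h1, interior, h5]

theorem isChain_path {w w' : W} (h : R.Adj w w') :
    List.IsChain φ.toSubgraph.spanningCoe.Adj (φ.vert w :: (φ.interior h ++ [φ.vert w'])) := by
  have hle : (φ.path h).toSubgraph ≤ φ.toSubgraph :=
    (le_iSup (fun d : R.Dart => (φ.path d.adj).toSubgraph) ⟨(w, w'), h⟩).trans le_sup_right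
  have he : ∀ e ∈ (φ.path h).edges, e ∈ φ.toSubgraph.spanningCoe.edgeSet := by
    intro e he
    rw [Subgraph.edgeSet_spanningCoe]
    exact Subgraph.edgeSet_mono hle ((Walk.mem_edges_toSubgraph _).2 he)
  have := ((φ.path h).transfer _ he).isChain_adj_support
  rwa [Walk.support_transfer, support_eq] at this

theorem even_interior {w w' : W} (h : R.Adj w w') : Even (φ.interior h).length := by
  have := φ.even_vertices h
  rw [support_eq] at this
  simpa [parity_simps] using this

theorem nodup_support {w w' : W} (h : R.Adj w w') :
    (φ.vert w :: (φ.interior h ++ [φ.vert w'])).Nodup := by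
  rw [← support_eq]; exact (φ.isPath h).support_nodup

theorem nodup_interior {w w' : W} (h : R.Adj w w') : (φ.interior h).Nodup :=
  (φ.nodup_support h).of_cons.of_append_left

theorem mem_support_iff {w w' : W} (h : R.Adj w w') {v : V} :
    v ∈ (φ.path h).support ↔ v = φ.vert w ∨ v ∈ φ.interior h ∨ v = φ.vert w' := by
  rw [support_eq]; simp

theorem vert_notMem_interior {w w' : W} (h : R.Adj w w') (x : W) : φ.vert x ∉ φ.interior h := by
  intro hx
  have hn := φ.nodup_support h
  rw [List.nodup_cons, List.nodup_append] at hn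
  rcases φ.vert_mem_path h x ((φ.mem_support_iff h).2 (.inr (.inl hx))) with rfl | rfl
  · exact hn.1 (by simp [hx])
  · exact hn.2.2.2 _ hx _ (List.mem_singleton_self _) rfl

theorem eq_of_mem_interior {w w' x x' : W} (h : R.Adj w w') (k : R.Adj x x') {v : V}
    (hv : v ∈ φ.interior h) (hv' : v ∈ φ.interior k) : s(w, w') = s(x, x') := by
  by_contra hne
  rcases (φ.path_disjoint h k hne v ((φ.mem_support_iff h).2 (.inr (.inl hv)))
    ((φ.mem_support_iff k).2 (.inr (.inl hv')))).1 with rfl | rfl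
  · exact φ.vert_notMem_interior h _ hv
  · exact φ.vert_notMem_interior h _ hv

theorem interior_symm {w w' : W} (h : R.Adj w w') :
    φ.interior h.symm = (φ.interior h).reverse := by
  have h1 := φ.support_eq h.symm
  rw [φ.path_symm, Walk.support_reverse, support_eq] at h1
  simpa using h1.symm

theorem mem_verts_toSubgraph {v : V} : v ∈ φ.toSubgraph.verts ↔ (∃ w, v = φ.vert w) ∨
    ∃ (w w' : W) (h : R.Adj w w'), v ∈ φ.interior h := by
  simp only [toSubgraph, Subgraph.verts_sup, Subgraph.verts_iSup, Set.mem_union,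
    Set.mem_iUnion, singletonSubgraph_verts, Set.mem_singleton_iff, Walk.mem_verts_toSubgraph,
    mem_support_iff]
  constructor
  · rintro (⟨w, h⟩ | ⟨d, h | h | h⟩)
    · exact .inl ⟨w, h⟩
    · exact .inl ⟨_, h⟩
    · exact .inr ⟨_, _, d.adj, h⟩
    · exact .inl ⟨_, h⟩
  · rintro (⟨w, h⟩ | ⟨w, w', h, hv⟩)
    · exact .inl ⟨w, h⟩
    · exact .inr ⟨⟨(w, w'), h⟩, .inr (.inl hv)⟩

end EvenEmbedding

theorem rotunda_adj_leg (i : Fin 3) (j : Fin 4) : rotunda.Adj (.inl j) (.inr (i, j)) := rfl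

theorem rotunda_adj_circuit (i : Fin 3) (j : Fin 4) :
    rotunda.Adj (.inr (i, j)) (.inr (i, j + 1)) := ⟨rfl, .inl rfl⟩

namespace EvenEmbedding

variable (φ : EvenEmbedding rotunda G)

/-- The pieces of which the circuits of a model of Rotunda and their legs consist. -/
def piece (x : Fin 3 × (Fin 4 ⊕ Fin 4 ⊕ Fin 4)) : List V :=
  match x with
  | (i, .inl j) => [φ.vert (.inr (i, j))]
  | (i, .inr (.inl j)) => φ.interior (rotunda_adj_leg i j)
  | (i, .inr (.inr j)) => φ.interior (rotunda_adj_circuit i j)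

theorem nodup_piece (x : Fin 3 × (Fin 4 ⊕ Fin 4 ⊕ Fin 4)) : (φ.piece x).Nodup := by
  obtain ⟨i, j | j | j⟩ := x
  · exact List.nodup_singleton _
  · exact φ.nodup_interior _
  · exact φ.nodup_interior _

theorem eq_of_mem_piece (x y : Fin 3 × (Fin 4 ⊕ Fin 4 ⊕ Fin 4)) (v : V) (hx : v ∈ φ.piece x)
    (hy : v ∈ φ.piece y) : x = y := by
  obtain ⟨i, j | j | j⟩ := x <;> obtain ⟨i', j' | j' | j'⟩ := y <;>
    simp only [piece, List.mem_singleton] at hx hy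
  · have := φ.vert_injective (hx.symm.trans hy)
    simp only [Sum.inr.injEq, Prod.mk.injEq] at this
    rw [this.1, this.2]
  · exact absurd (hx ▸ hy) (φ.vert_notMem_interior _ _)
  · exact absurd (hx ▸ hy) (φ.vert_notMem_interior _ _)
  · exact absurd (hy ▸ hx) (φ.vert_notMem_interior _ _)
  · have := φ.eq_of_mem_interior _ _ hx hy
    simp only [Sym2.eq_iff, Sum.inl.injEq, Sum.inr.injEq, Prod.mk.injEq, reduceCtorEq, and_false,
      or_false] at this
    rw [this.2.1, this.1]
  · have := φ.eq_of_mem_interior _ _ hx hy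
    simp at this
  · exact absurd (hy ▸ hx) (φ.vert_notMem_interior _ _)
  · have := φ.eq_of_mem_interior _ _ hx hy
    simp at this
  · have := φ.eq_of_mem_interior _ _ hx hy
    simp only [Sym2.eq_iff, Sum.inr.injEq, Prod.mk.injEq] at this
    have h : i = i' ∧ j = j' := by
      rcases this with h | h
      · exact h.1
      -- Two circuit edges that agree with opposite directions would need j' = j + 1 and j = j' + 1,
      -- impossible modulo 4.
      · exact absurd h.1.2 ((by decide : ∀ j j' : Fin 4, j + 1 = j' → j ≠ j' + 1) j j' h.2.2)
    rw [h.1, h.2]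

/-- A component of a model of Rotunda without the center, together with the center. -/
def leggedCircuit (i : Fin 3) :
    LeggedCircuit φ.toSubgraph.spanningCoe fun j => φ.vert (.inl j) where
  c j := φ.vert (.inr (i, j))
  leg j := φ.interior (rotunda_adj_leg i j)
  cyc j := φ.interior (rotunda_adj_circuit i j)
  chain_leg j := φ.isChain_path (rotunda_adj_leg i j)
  chain_cyc j := φ.isChain_path (rotunda_adj_circuit i j)
  even_leg j := φ.even_interior _
  even_cyc j := φ.even_interior _
  nodup := by
    classical
    rw [List.nodup_iff_count_le_one]
    intro v
    have h := nodup_sum_count (f := fun x => φ.piece (i, x)) (fun x => φ.nodup_piece _)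
      (fun x y v hx hy => by simpa using φ.eq_of_mem_piece _ _ v hx hy) v
    simp only [Fintype.sum_sum_type, Fin.sum_univ_four, piece, List.count_cons,
      List.count_nil] at h
    simp only [List.count_cons, List.count_append]
    omega

theorem mem_leggedCircuit {i : Fin 3} {v : V} :
    v ∈ (φ.leggedCircuit i).all ↔ ∃ x, v ∈ φ.piece (i, x) := by
  rw [LeggedCircuit.mem_all]
  simp only [Sum.exists, piece, List.mem_singleton, leggedCircuit]
  constructor
  · rintro ⟨j, h | h | h⟩
    · exact .inl ⟨j, h⟩
    · exact .inr (.inl ⟨j, h⟩)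
    · exact .inr (.inr ⟨j, h⟩)
  · rintro (⟨j, h⟩ | ⟨j, h⟩ | ⟨j, h⟩)
    · exact ⟨j, .inl h⟩
    · exact ⟨j, .inr (.inl h)⟩
    · exact ⟨j, .inr (.inr h)⟩

theorem leggedCircuit_disjoint {i i' : Fin 3} {v : V} (h : v ∈ (φ.leggedCircuit i).all)
    (h' : v ∈ (φ.leggedCircuit i').all) : i = i' := by
  obtain ⟨x, hx⟩ := φ.mem_leggedCircuit.1 h
  obtain ⟨y, hy⟩ := φ.mem_leggedCircuit.1 h'
  exact congrArg Prod.fst (φ.eq_of_mem_piece _ _ v hx hy)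

theorem vert_inl_notMem (i : Fin 3) (j : Fin 4) :
    φ.vert (.inl j) ∉ (φ.leggedCircuit i).all := by
  intro h
  obtain ⟨j' | j' | j', h⟩ := φ.mem_leggedCircuit.1 h
  · have := φ.vert_injective (List.mem_singleton.1 h)
    simp at this
  · exact φ.vert_notMem_interior _ _ h
  · exact φ.vert_notMem_interior _ _ h

theorem mem_verts_rotunda {v : V} : v ∈ φ.toSubgraph.verts ↔ (∃ j, v = φ.vert (.inl j)) ∨
    ∃ i, v ∈ (φ.leggedCircuit i).all := by
  simp only [mem_verts_toSubgraph, mem_leggedCircuit]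
  constructor
  · rintro (⟨j | ⟨i, j⟩, h⟩ | ⟨j | ⟨i, j⟩, j' | ⟨i', j'⟩, h, hv⟩)
    · exact .inl ⟨j, h⟩
    · exact .inr ⟨i, .inl j, List.mem_singleton.2 h⟩
    · exact absurd h id
    · obtain rfl : j = j' := h
      exact .inr ⟨i', .inr (.inl j), hv⟩
    · obtain rfl : j = j' := h
      have hv : v ∈ φ.interior (rotunda_adj_leg i j).symm := hv
      rw [φ.interior_symm (rotunda_adj_leg i j), List.mem_reverse] at hv
      exact .inr ⟨i, .inr (.inl j), hv⟩
    · obtain ⟨rfl, rfl | rfl⟩ : i = i' ∧ (j' = j + 1 ∨ j = j' + 1) := h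
      · exact .inr ⟨i, .inr (.inr j), hv⟩
      · have hv : v ∈ φ.interior (rotunda_adj_circuit i j').symm := hv
        rw [φ.interior_symm (rotunda_adj_circuit i j'), List.mem_reverse] at hv
        exact .inr ⟨i, .inr (.inr j'), hv⟩
  · rintro (⟨j, h⟩ | ⟨i, j | j | j, h⟩)
    · exact .inl ⟨_, h⟩
    · exact .inl ⟨_, List.mem_singleton.1 h⟩
    · exact .inr ⟨_, _, _, h⟩
    · exact .inr ⟨_, _, _, h⟩

end EvenEmbedding
end SimpleGraph

/-! ### The frame of a model of Rotunda, and the conclusion -/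

namespace SimpleGraph

variable {V : Type*} {G : SimpleGraph V} {A : V → Prop} {m : V → V}

/-- The circuits of a model of Rotunda in a brace without a model of `K₃,₃`, as a frame. -/
noncomputable def LeggedCircuit.frame [Finite V] {s : Fin 4 → V} (hG : G.IsExtendable 2)
    (hA : ∀ u v, G.Adj u v → (A u ↔ ¬ A v)) (C : Fin 3 → LeggedCircuit G s)
    (hs : Function.Injective s) (hC : ∀ i j v, v ∈ (C i).all → v ∈ (C j).all → i = j)
    (hm : ∀ v, m (m v) = v) (hadj : ∀ v, m v ≠ v → G.Adj v (m v))
    (hfix : ∀ v, m v = v ↔ v = s 0 ∨ v = s 2 ∨ v = s 1 ∨ v = s 3)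
    (hsw : ∀ i, Swaps m (C i).all) (h0 : A (s 0))
    (hno : ¬ ContainsGraph G (completeBipartiteGraph (Fin 3) (Fin 3))) :
    DigraphLinkage.Frame (fun v w => A v ∧ G.Adj v (m w)) (s 0) (s 2) (s 1) (s 3) where
  g i := (C i).gadget hA h0 (hsw i) ((hfix _).2 (by simp)) ((hfix _).2 (by simp))
  terminals := by simp [hs.eq_iff]
  not_in₀ v hv := by
    rw [(hfix (s 0)).2 (by simp)] at hv
    exact (hA _ _ hv.2).1 hv.1 h0
  not_in₂ v hv := by
    rw [(hfix (s 2)).2 (by simp)] at hv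
    exact (hA _ _ hv.2).1 hv.1 ((C 0).colour hA h0).1.2.1
  not_out₁ v hv := ((C 0).colour hA h0).1.1 hv.1
  not_out₃ v hv := ((C 0).colour hA h0).1.2.2 hv.1
  not_mem i v hv := by
    rw [mem_gadget] at hv
    have h := ((C i).pairList_all hA h0).mem_of_swaps (hsw i) hv.1
    have h' : m v ≠ v := h.2.2.ne'
    rw [Ne, hfix] at h'
    tauto
  disj i j hij v hv hv' := by
    rw [mem_gadget] at hv hv'
    exact hij (hC i j v hv.1 hv'.1)
  -- Only the component of the model is considered, since G need not be connected.
  N := {v | A v ∧ m v ≠ v ∧ G.Reachable (s 0) v}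
  mem_N i v hv := by
    rw [mem_gadget] at hv
    exact ⟨hv.2, (((C i).pairList_all hA h0).mem_of_swaps (hsw i) hv.1).2.2.ne',
      ((C i).reachable_s 0).trans ((C i).reachable hv.1)⟩
  out_N v w hvw hv h1 h3 := by
    have hw : m w ≠ w := by
      intro e
      rcases (hfix w).1 e with rfl | rfl | rfl | rfl
      · rw [e] at hvw
        exact (hA _ _ hvw.2).1 hvw.1 h0
      · rw [e] at hvw
        exact (hA _ _ hvw.2).1 hvw.1 ((C 0).colour hA h0).1.2.1
      · exact h1 rfl
      · exact h3 rfl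
    refine ⟨?_, hw, (hv.2.2.trans hvw.2.reachable).trans (hadj w hw).symm.reachable⟩
    have e1 := hA _ _ hvw.2
    have e2 := hA _ _ (hadj w hw)
    have := hvw.1
    tauto
  in_N v w hvw hw h0' h2 := by
    refine ⟨hvw.1, ?_, (hw.2.2.trans (hadj w hw.2.1).reachable).trans hvw.2.symm.reachable⟩
    intro e
    have hvA : A v := hvw.1
    rcases (hfix v).1 e with rfl | rfl | rfl | rfl
    · exact h0' rfl
    · exact h2 rfl
    · exact ((C 0).colour hA h0).1.1 hvA
    · exact ((C 0).colour hA h0).1.2.2 hvA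
  reach₀ v hv := by
    obtain ⟨k1, k2, k3⟩ := ((C 0).colour hA h0).1
    exact hG.reach_of_source hA hm hadj hfix h0 k2 k1 k3 (hs.ne (by decide)) hv.1 hv.2.1 hv.2.2
  reach₂ v hv := by
    obtain ⟨k1, k2, k3⟩ := ((C 0).colour hA h0).1
    exact hG.reach_of_source hA hm hadj (fun v => (hfix v).trans (by tauto)) k2 h0 k1 k3
      (hs.ne (by decide)) hv.1 hv.2.1 (((C 0).reachable_s 2).trans
        (((C 0).reachable_c 2).symm.trans (((C 0).reachable_s 0).symm.trans hv.2.2)))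
  reach₁ v hv := by
    obtain ⟨k1, k2, k3⟩ := ((C 0).colour hA h0).1
    exact hG.reach_to_sink hA hm hadj hfix h0 k2 k1 k3
      (hs.ne (by decide)) hv.1 hv.2.1 (((C 0).reachable_s 1).trans
        (((C 0).reachable_c 1).symm.trans (((C 0).reachable_s 0).symm.trans hv.2.2)))
  reach₃ v hv := by
    obtain ⟨k1, k2, k3⟩ := ((C 0).colour hA h0).1
    exact hG.reach_to_sink hA hm hadj (fun v => (hfix v).trans (by tauto)) h0 k2 k3 k1
      (hs.ne (by decide)) hv.1 hv.2.1 (((C 0).reachable_s 3).trans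
        (((C 0).reachable_c 3).symm.trans (((C 0).reachable_s 0).symm.trans hv.2.2)))
  noJump k a a' c c' ha hc hj := by
    classical
    obtain ⟨k1, k2, k3⟩ := ((C 0).colour hA h0).1
    have hK := fun v (hv : v ∈ (C k).all) =>
      ((C k).pairList_all hA h0).mem_of_swaps (hsw k) hv
    simp only [mem_gadget] at hj
    have key : ∀ {a a' c c'}, (∀ v, m v = v ↔ v = a ∨ v = a' ∨ v = c ∨ v = c') → A a → ¬ A c →
        Theta G A {v | v ∈ (C k).all} a a' c c' → ¬ DigraphLinkage.DoubleJump
          (fun v w => A v ∧ G.Adj v (m w)) {v | v ∈ (C k).all ∧ A v} a a' c c' :=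
      fun hfix ha hc θ hj => hno (containsGraph_of_doubleJump hA hm hadj hfix ha hc
        (fun v hv => (hK v hv).1) (fun v hv => (hK v hv).2.2.ne') θ hj)
    -- The four choices of the first source and first sink are the two thetas of opposite
    -- orientation at each of the two sources.
    rcases ha with ⟨rfl, rfl⟩ | ⟨rfl, rfl⟩ <;> rcases hc with ⟨rfl, rfl⟩ | ⟨rfl, rfl⟩
    · exact key (fun v => (hfix v).trans (by tauto)) h0 k1 ((C k).theta hA 0 h0) hj
    · exact key (fun v => (hfix v).trans (by tauto)) h0 k3 ((C k).thetaReverse hA 0 h0) hj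
    · exact key (fun v => (hfix v).trans (by tauto)) k2 k1 ((C k).thetaReverse hA 2 k2) hj
    · exact key (fun v => (hfix v).trans (by tauto)) k2 k3 ((C k).theta hA 2 k2) hj

/-- In a brace without a model of `K₃,₃`, different components of a model of Rotunda without its
center are not joined by paths that avoid the center. -/
theorem LeggedCircuit.eq_of_walk [Finite V] {s : Fin 4 → V} (hG : G.IsExtendable 2)
    (hA : ∀ u v, G.Adj u v → (A u ↔ ¬ A v)) (C : Fin 3 → LeggedCircuit G s)
    (hs : Function.Injective s) (hC : ∀ i j v, v ∈ (C i).all → v ∈ (C j).all → i = j)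
    (hm : ∀ v, m (m v) = v) (hadj : ∀ v, m v ≠ v → G.Adj v (m v))
    (hfix : ∀ v, m v = v ↔ v = s 0 ∨ v = s 2 ∨ v = s 1 ∨ v = s 3)
    (hsw : ∀ i, Swaps m (C i).all) (h0 : A (s 0))
    (hno : ¬ ContainsGraph G (completeBipartiteGraph (Fin 3) (Fin 3))) {i j : Fin 3} {u v : V}
    (hu : u ∈ (C i).all) (hv : v ∈ (C j).all) (P : G.Walk u v) (hP : ∀ w ∈ P.support, m w ≠ w) :
    i = j := by
  classical
  let F := LeggedCircuit.frame hG hA C hs hC hm hadj hfix hsw h0 hno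
  -- Each vertex is sent to the member of colour A of its matched pair. An edge of G off the center
  -- becomes an arc in one of the two directions, possibly a loop.
  let π : V → V := fun w => if A w then w else m w
  have hπA : ∀ w, m w ≠ w → A (π w) ∧ m (π w) ≠ π w ∧ G.Reachable w (π w) := by
    intro w hw
    by_cases h : A w
    · simp only [π, if_pos h]
      exact ⟨h, hw, .rfl⟩
    · simp only [π, if_neg h]
      refine ⟨?_, by rw [hm]; exact hw.symm, (hadj w hw).reachable⟩
      have := hA _ _ (hadj w hw)
      tauto
  have hπ : ∀ i, ∀ w ∈ (C i).all, π w ∈ (F.g i).all := by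
    intro i w hw
    have h := ((C i).pairList_all hA h0).mem_of_swaps (hsw i) hw
    refine ((C i).mem_gadget hA h0 (hsw i) ((hfix _).2 (by simp))
      ((hfix _).2 (by simp))).2 ⟨?_, (hπA w h.2.2.ne').1⟩
    by_cases hAw : A w
    · simpa only [π, if_pos hAw] using hw
    · simpa only [π, if_neg hAw] using h.1
  have hadjπ : ∀ x y, G.Adj x y → (A (π x) ∧ G.Adj (π x) (m (π y))) ∨
      (A (π y) ∧ G.Adj (π y) (m (π x))) := by
    intro x y hxy
    by_cases h : A x
    · have hy := (hA _ _ hxy).1 h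
      simp only [π, if_pos h, if_neg hy, hm]
      exact .inl ⟨h, hxy⟩
    · have hy : A y := by have := hA _ _ hxy; tauto
      simp only [π, if_neg h, if_pos hy, hm]
      exact .inr ⟨hy, hxy.symm⟩
  have hwalk : ∀ {u v : V} (P : G.Walk u v), (∀ w ∈ P.support, m w ≠ w) → G.Reachable (s 0) u →
      Relation.ReflTransGen (fun x y => ((A x ∧ G.Adj x (m y)) ∨ (A y ∧ G.Adj y (m x))) ∧
        y ∈ F.N) (π u) (π v) := by
    intro u v P
    induction P with
    | nil => intro _ _; exact .refl
    | @cons a b c h P ih =>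
      intro hP hr
      have hb := hr.trans h.reachable
      have hπb := hπA b (hP b (by simp))
      exact .head ⟨hadjπ _ _ h, hπb.1, hπb.2.1, hb.trans hπb.2.2⟩
        (ih (fun w hw => hP w (by simp [hw])) hb)
  exact F.eq_of_reach (hπ i u hu) (hπ j v hv)
    (hwalk P hP (((C i).reachable_s 0).trans ((C i).reachable hu)))

/-- All paths of the subdivision have evenly many inner vertices, so each circuit with legs splits
into consecutive matched pairs. Off the model the matching given by centrality is used. -/
theorem EvenEmbedding.exists_involution (φ : EvenEmbedding rotunda G)
    (hA : ∀ u v, G.Adj u v → (A u ↔ ¬ A v)) (h0 : A (φ.vert (.inl 0)))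
    (hφ : φ.toSubgraph.IsCentral) :
    ∃ m : V → V, (∀ v, m (m v) = v) ∧ (∀ v, m v ≠ v → G.Adj v (m v)) ∧
      (∀ v, m v = v ↔ ∃ j, v = φ.vert (.inl j)) ∧ ∀ i, Swaps m (φ.leggedCircuit i).all := by
  classical
  obtain ⟨M, hM, hMv⟩ := hφ
  have hMm : ∀ v, v ∈ M.verts ↔ v ∉ φ.toSubgraph.verts := fun v => by rw [hMv]; rfl
  have hp : ∀ i, PairList G A (φ.leggedCircuit i).all := fun i =>
    ((φ.leggedCircuit i).mono φ.toSubgraph.spanningCoe_le).pairList_all hA h0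
  obtain ⟨m₀, hm₀⟩ : ∃ m₀ : V → V, ∀ v, (v ∈ φ.toSubgraph.verts → m₀ v = v) ∧
      (v ∉ φ.toSubgraph.verts → M.Adj v (m₀ v)) := by
    have : ∀ v, ∃ w, (v ∈ φ.toSubgraph.verts → w = v) ∧ (v ∉ φ.toSubgraph.verts → M.Adj v w) := by
      intro v
      by_cases h : v ∈ φ.toSubgraph.verts
      · exact ⟨v, fun _ => rfl, fun h' => absurd h h'⟩
      · obtain ⟨w, hw, -⟩ := hM ((hMm v).2 h)
        exact ⟨w, fun h' => absurd h' h, fun _ => hw⟩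
    choose m₀ h using this
    exact ⟨m₀, h⟩
  have hn : ((φ.leggedCircuit 0).all ++ ((φ.leggedCircuit 1).all ++
      (φ.leggedCircuit 2).all)).Nodup := by
    have hd : ∀ i j, i ≠ j → ∀ v ∈ (φ.leggedCircuit i).all, ∀ w ∈ (φ.leggedCircuit j).all,
        v ≠ w := by
      rintro i j hij v hv w hw rfl
      exact hij (φ.leggedCircuit_disjoint hv hw)
    refine List.nodup_append.2 ⟨LeggedCircuit.nodup_all _, List.nodup_append.2
      ⟨LeggedCircuit.nodup_all _, LeggedCircuit.nodup_all _, hd 1 2 (by decide)⟩, ?_⟩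
    intro v hv w hw
    rcases List.mem_append.1 hw with hw | hw
    · exact hd 0 1 (by decide) v hv w hw
    · exact hd 0 2 (by decide) v hv w hw
  obtain ⟨m, hsw, hm⟩ := ((hp 0).append ((hp 1).append (hp 2))).exists_swaps hn m₀
  rw [(hp 0).swaps_append, (hp 1).swaps_append] at hsw
  have hsw' : ∀ i, Swaps m (φ.leggedCircuit i).all := fun i =>
    match i with
    | 0 => hsw.1
    | 1 => hsw.2.1
    | 2 => hsw.2.2
  replace hm : ∀ v, (∀ i, v ∉ (φ.leggedCircuit i).all) → m v = m₀ v := fun v hv =>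
    hm v (by simp [hv])
  have hs : ∀ j, m (φ.vert (.inl j)) = φ.vert (.inl j) := fun j => by
    rw [hm _ fun i => φ.vert_inl_notMem i j]
    exact (hm₀ _).1 (φ.mem_verts_rotunda.2 (.inl ⟨j, rfl⟩))
  have hout : ∀ v, v ∉ φ.toSubgraph.verts → M.Adj v (m v) := by
    intro v hv
    rw [hm v fun i hi => hv (φ.mem_verts_rotunda.2 (.inr ⟨i, hi⟩))]
    exact (hm₀ v).2 hv
  have hcase : ∀ v, (∃ j, v = φ.vert (.inl j)) ∨ (∃ i, v ∈ (φ.leggedCircuit i).all) ∨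
      v ∉ φ.toSubgraph.verts := by
    intro v
    rw [φ.mem_verts_rotunda]
    tauto
  refine ⟨m, ?_, ?_, ?_, hsw'⟩
  · intro v
    rcases hcase v with ⟨j, rfl⟩ | ⟨i, hi⟩ | hv
    · rw [hs, hs]
    · exact ((hp i).mem_of_swaps (hsw' i) hi).2.1
    · have h := hout v hv
      have h' := hout (m v) ((hMm _).1 h.snd_mem)
      exact (hM h.snd_mem).unique h' h.symm
  · intro v hmv
    rcases hcase v with ⟨j, rfl⟩ | ⟨i, hi⟩ | hv
    · exact absurd (hs j) hmv
    · exact ((hp i).mem_of_swaps (hsw' i) hi).2.2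
    · exact (hout v hv).adj_sub
  · intro v
    refine ⟨fun h => ?_, fun ⟨j, hj⟩ => hj ▸ hs j⟩
    rcases hcase v with hj | ⟨i, hi⟩ | hv
    · exact hj
    · exact absurd h ((hp i).mem_of_swaps (hsw' i) hi).2.2.ne'
    · exact absurd h (hout v hv).adj_sub.ne'

theorem Subgraph.reachable_coe_of_spanningCoe {H : G.Subgraph} {u v : V}
    (h : H.spanningCoe.Reachable u v) (hu : u ∈ H.verts) (hv : v ∈ H.verts) :
    H.coe.Reachable ⟨u, hu⟩ ⟨v, hv⟩ := by
  obtain ⟨p⟩ := h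
  induction p with
  | nil => exact .rfl
  | @cons a b c h p ih =>
    have hab : H.Adj a b := h
    have : H.coe.Adj ⟨a, hu⟩ ⟨b, hab.snd_mem⟩ := hab
    exact this.reachable.trans (ih hab.snd_mem hv)

end SimpleGraph

theorem mainTheorem5 {V : Type*} [Finite V] (G : SimpleGraph V) (hG : G.IsBrace)
    (H : G.Subgraph) (hH : SimpleGraph.IsModel SimpleGraph.rotunda H)
    (φ : SimpleGraph.EvenEmbedding SimpleGraph.rotunda G) (hφ : φ.toSubgraph = H)
    (S : Set V) (hS : S = φ.vert '' SimpleGraph.rotundaCenter)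
    (hP : ∃ (u v : (H.deleteVerts S).verts) (P : G.Walk (u : V) (v : V)),
      H.IsPathOf P ∧ (∀ x ∈ P.support, x ∉ S) ∧
      (H.deleteVerts S).coe.connectedComponentMk u ≠
        (H.deleteVerts S).coe.connectedComponentMk v) :
    G.ContainsGraph (completeBipartiteGraph (Fin 3) (Fin 3)) := by
  classical
  by_contra hno
  obtain ⟨⟨u, hu⟩, ⟨v, hv⟩, P, -, hPS, hne⟩ := hP
  subst hφ
  obtain ⟨col⟩ := hG.1
  -- The distinguished colour A is that of the image of s₀ in a 2-colouring.
  have hA : ∀ u v, G.Adj u v →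
      (col u = col (φ.vert (.inl 0)) ↔ ¬ col v = col (φ.vert (.inl 0))) := by
    intro u v huv
    have h := col.valid huv
    generalize col u = x at h ⊢
    generalize col v = y at h ⊢
    generalize col (φ.vert (.inl 0)) = z
    revert x y z
    decide
  obtain ⟨m, hm, hadj, hfix, hsw⟩ := φ.exists_involution
    (A := fun v => col v = col (φ.vert (.inl 0))) hA rfl hH.1
  have hSm : ∀ v, v ∈ S ↔ ∃ j, v = φ.vert (.inl j) := by
    intro v
    rw [hS]
    constructor
    · rintro ⟨_, ⟨j, rfl⟩, rfl⟩; exact ⟨j, rfl⟩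
    · rintro ⟨j, rfl⟩; exact ⟨_, ⟨j, rfl⟩, rfl⟩
  have hmem : ∀ v ∈ (φ.toSubgraph.deleteVerts S).verts, ∃ i, v ∈ (φ.leggedCircuit i).all := by
    intro v hv
    rw [SimpleGraph.Subgraph.deleteVerts_verts] at hv
    exact (φ.mem_verts_rotunda.1 hv.1).resolve_left fun h => hv.2 ((hSm v).2 h)
  obtain ⟨i, hi⟩ := hmem u hu
  obtain ⟨j, hj⟩ := hmem v hv
  have hij : i = j := SimpleGraph.LeggedCircuit.eq_of_walk hG.2 hA
    (fun i => (φ.leggedCircuit i).mono φ.toSubgraph.spanningCoe_le)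
    (fun a b h => Sum.inl_injective (φ.vert_injective h))
    (fun i j v h h' => φ.leggedCircuit_disjoint h h') hm hadj (fun v => (hfix v).trans (by
      rw [Fin.exists_fin_succ]
      simp only [Fin.exists_fin_succ, IsEmpty.exists_iff, or_false]
      have h1 : Fin.succ (0 : Fin 3) = (1 : Fin 4) := rfl
      have h2 : Fin.succ (Fin.succ (0 : Fin 2)) = (2 : Fin 4) := rfl
      have h3 : Fin.succ (Fin.succ (Fin.succ (0 : Fin 1))) = (3 : Fin 4) := rfl
      rw [h1, h2, h3]
      tauto)) hsw rfl hno hi hj P fun w hw e => hPS w hw ((hSm w).2 ((hfix w).1 e))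
  subst hij
  apply hne
  rw [SimpleGraph.ConnectedComponent.eq]
  -- Both ends of the path lie on the same circuit with legs, which is connected within the model
  -- without its center; this contradicts the choice of the ends.
  have hT : ∀ w ∈ (φ.leggedCircuit i).all,
      (φ.toSubgraph.deleteVerts S).spanningCoe.Reachable ((φ.leggedCircuit i).c 0) w := by
    intro w hw
    refine (φ.leggedCircuit i).reachable_of_notMem (S := S) ?_ ?_ hw
    · intro a b hab ha hb
      have hab : φ.toSubgraph.Adj a b := hab
      exact SimpleGraph.Subgraph.deleteVerts_adj.2 ⟨hab.fst_mem, ha, hab.snd_mem, hb, hab⟩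
    · intro a ha haS
      obtain ⟨j, rfl⟩ := (hSm a).1 haS
      exact φ.vert_inl_notMem i j ha
  exact SimpleGraph.Subgraph.reachable_coe_of_spanningCoe ((hT u hi).symm.trans (hT v hj)) hu hv
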